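/- **Setting.** Let $M$ be a smooth surface (2-manifold, Hausdorff, second countable). A smooth immersion $f:M\to\mathbb R^5$ is *centroaffine* if $f(x)\notin df_x(T_xM)$ for all $x$ (so $f$ avoids $0$). A *1-adapted frame field* on an open $U\subset M$ is a smooth frame $s=(e_0,\dots,e_4)$ of $\mathbb R^5$ on $U$ with $e_0=f$ and $\mathrm{span}(e_1,e_2)=df(TM)$; its Maurer–Cartan forms $\Omega=(\omega^i_j)=s^{-1}ds$ are given by $de_j=\sum_i e_i\,\omega^i_j$. There are symmetric $2\times2$ matrices $h^k$ ($k=0,3,4$) with $\omega^k_i=h^k_{i1}\omega^1_0+h^k_{i2}\omega^2_0$ for $i=1,2$. The surface is *nondegenerate* if $h^0,h^3,h^4$ are linearly independent at every point. It is *space-like* (resp. *time-like*) if at every point the quadratic form $Q(h)=-\det h$ is positive definite (resp. indefinite) on $\mathrm{span}(h^3,h^4)$. These notions do not depend on the 1-adapted frame field. A 1-adapted frame field is *3-adapted* if $\omega^0_3=\omega^0_4=0$ and * (space-like case) $h^3=\begin{bmatrix}1&0\\0&-1\end{bmatrix}$, $h^4=\begin{bmatrix}0&1\\1&0\end{bmatrix}$,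 $h^0=\epsilon I_2$ with $\epsilon=\pm1$; * (time-like case) $h^3=\begin{bmatrix}1&0\\0&0\end{bmatrix}$, $h^4=\begin{bmatrix}0&0\\0&1\end{bmatrix}$, $h^0=\begin{bmatrix}0&1\\1&0\end{bmatrix}$. A *bundle of 3-adapted frames* $\mathcal F_3\subset M\times GL(5,\mathbb R)$ is a principal bundle over $M$ whose local sections are 3-adapted frame fields and whose structure group, acting by right multiplication, is, in the space-like case, $\{\mathrm{diag}(1,R_\theta,R_{2\theta}):\theta\in\mathbb R\}\cong SO(2)$, where $R_\theta$ is the rotation by $\theta$, and, in the time-like case, $\{\mathrm{diag}(1,e^\lambda,e^{-\lambda},e^{2\lambda},e^{-2\lambda}):\lambda\in\mathbb R\}\cong SO^+(1,1)$. The *centroaffine metric* is $(\omega^1_0)^2+(\omega^2_0)^2$ (space-like case), resp. $2\,\omega^1_0\,\omega^2_0$ (time-like case), computed in a 3-adapted frame field. A *symmetry* is a diffeomorphism $\phi$ of $\mathcal F_3$ with $\phi^*\Omega=\Omega$. The surface is *homogeneous* if, for some such bundle $\mathcal F_3$, the group of all symmetries is a 3-dimensional (Hausdorff, second countable) Lie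 group acting smoothly and transitively on $\mathcal F_3$. **Models.** Let $\Sigma_1,\Sigma_2,\Sigma_3\subset\mathbb R^5\setminus\{0\}$ be the images of the following maps $f_1,f_2,f_3$ of $(u,v)\in\mathbb R^2$: $$f_1=\begin{bmatrix}\frac12(3\cosh^2u\cosh^2v-1)\\ \sqrt3\sinh u\cosh u\cosh^2v\\ \sqrt3\cosh u\sinh v\cosh v\\ \frac32(\cosh^2v(\cosh^2u-2)+1)\\ 3\sinh u\sinh v\cosh v\end{bmatrix},\qquad f_2=\begin{bmatrix}\frac12(3\cos^2u\cos^2v-1)\\ \sqrt3\sin u\cos u\cos^2v\\ \sqrt3\cos u\sin v\cos v\\ \frac32(\cos^2v(2-\cos^2u)-1)\\ 3\sin u\sin v\cos v\end{bmatrix},$$ $$f_3=\begin{bmatrix}\frac14[3\cos^2u(\cosh2v+1)-2]\\ \frac{\sqrt6}4\cos u[\sin u(\cosh2v+1)+\sinh2v]\\ -\frac{\sqrt6}4\cos u[\sin u(\cosh2v+1)-\sinh2v]\\ -\frac38[\cos^2u(\cosh2v+1)-2(\cosh2v+\sin u\sinh2v)]\\ -\frac38[\cos^2u(\cosh2v+1)-2(\cosh2v-\sin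 u\sinh2v)]\end{bmatrix}.$$ **Theorem.** Let $f:M\to\mathbb R^5\setminus\{0\}$ be a centroaffine immersion that is nondegenerate, space-like or time-like, and homogeneous. Then there is $g\in GL(5,\mathbb R)$ with $g\cdot f(M)=\Sigma_i$ for some $i\in\{1,2,3\}$. Moreover, $\Sigma_1,\Sigma_2,\Sigma_3$ are the orbits of $(1,0,0,0,0)^T$ under faithful irreducible continuous representations on $\mathbb R^5$ of $SO^+(1,2)$, $SO(3)$, $SO^+(2,1)$, respectively, and: * *(hyperbolic plane)* $f_1$ is a centroaffine immersion and a topological embedding of $\mathbb R^2$; it has 3-adapted frame fields of space-like type near every point, and its centroaffine metric is $3(\cosh^2v\,du^2+dv^2)$, of Gauss curvature $K=-\frac13$. * *(sphere)* There is a centroaffine immersion $\varphi:S^2\to\mathbb R^5$ of the unit sphere with $f_2(u,v)=\varphi(\cos u\cos v,\sin u\cos v,\sin v)$; one has $\varphi(p)=\varphi(q)$ exactly when $q=\pm p$. Where $\cos v\ne0$, $f_2$ has 3-adapted frame fields of space-like type, and its centroaffine metric is $3(\cos^2v\,du^2+dv^2)$, of Gauss curvature $K=\frac13$. * *(Lorentzian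 surface)* $f_3$ is a centroaffine immersion of $\mathbb R^2$ with 3-adapted frame fields of time-like type near every point, and its centroaffine metric is $3(-\cosh^2v\,du^2+dv^2)$. The map $f_3:\mathbb R^2\to\Sigma_3$ is a topological quotient map, and $f_3(u,v)=f_3(u',v')$ if and only if $u'=u+n\pi$, $v'=(-1)^nv$ for some $n\in\mathbb Z$ (so $\Sigma_3$ is a Möbius band). Equivalently, $\psi(u,v)=\pm\psi(u',v')$, where $\psi(u,v)=\sqrt3(\cos u\cosh v,\sin u\cosh v,\sinh v)$ maps $\mathbb R^2$ onto $S^{2,1}=\{p\in\mathbb R^3:p_0^2+p_1^2-p_2^2=3\}$; so $S^{2,1}$ covers $\Sigma_3$ two-to-one. In the space-like case the Gauss curvature $K$ is defined by $d\alpha=K\,\omega^1_0\wedge\omega^2_0$ with $\alpha=\frac12(\omega^1_2-\omega^2_1)$ in a 3-adapted frame field. -/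

import Mathlib

open scoped Manifold ContDiff Topology Matrix

universe u

noncomputable section

/-! ### Centroaffine surfaces, frame fields and Maurer-Cartan forms -/

/-- The parameter plane (the model space of surfaces). -/
abbrev Plane : Type := EuclideanSpace ℝ (Fin 2)

/-- The vector space `ℝ⁵`. -/
abbrev R5 : Type := Fin 5 → ℝ

/-- A 5-tuple `e = (e 0, …, e 4)` of vectors of `ℝ⁵`; `e j i` is the `i`-th coordinate of `e j`. -/
abbrev Frame : Type := Fin 5 → R5

/-- The `5 × 5` matrix whose columns are the vectors of the tuple. -/
def frameMatrix (e : Frame) : Matrix (Fin 5) (Fin 5) ℝ := (Matrix.of e)ᵀ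

section Forms

variable {n : ℕ} {N : Type*} [TopologicalSpace N] [ChartedSpace (EuclideanSpace ℝ (Fin n)) N]

/-- The pullback `Ω = s⁻¹ ds` of the Maurer-Cartan form of `GL(5,ℝ)` by a frame-valued map `s`:
`maurerCartan s x v i j` is `ω^i_j(v)`, where `d e_j = ∑ i, e_i ω^i_j`. -/
def maurerCartan (s : N → Frame) (x : N) (v : TangentSpace (𝓡 n) x) : Matrix (Fin 5) (Fin 5) ℝ :=
  (frameMatrix (s x))⁻¹ * frameMatrix (mfderiv (𝓡 n) 𝓘(ℝ, Frame) s x v)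

end Forms

section Surfaces

variable {M : Type*} [TopologicalSpace M] [ChartedSpace Plane M]

/-- A smooth immersion whose position vector is transversal to the tangent plane at each point
(so that, in particular, it takes its values in `ℝ⁵ ∖ {0}`). -/
def IsCentroaffineImmersion (f : M → R5) : Prop :=
  ContMDiff (𝓡 2) 𝓘(ℝ, R5) ∞ f ∧
  ∀ x, Function.Injective (mfderiv (𝓡 2) 𝓘(ℝ, R5) f x) ∧
    ∀ v : TangentSpace (𝓡 2) x, mfderiv (𝓡 2) 𝓘(ℝ, R5) f x v ≠ f x

/-- `s` is a 1-adapted frame field along `f` on the open set `U`: a smooth frame field with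
`e_0 = f` such that `e_1, e_2` span the tangent plane. -/
def IsOneAdapted (f : M → R5) (U : Set M) (s : M → Frame) : Prop :=
  IsOpen U ∧ ContMDiffOn (𝓡 2) 𝓘(ℝ, Frame) ∞ s U ∧
  ∀ y ∈ U, LinearIndependent ℝ (s y) ∧ s y 0 = f y ∧
    (Submodule.span ℝ {s y 1, s y 2} : Set R5) = Set.range (mfderiv (𝓡 2) 𝓘(ℝ, R5) f y)

/-- The frame indices `1, 2` of the tangential vectors. -/
def tangIdx : Fin 2 → Fin 5 := ![1, 2]

/-- `h` is the matrix `h^k` of the frame field `s` at `x`: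
`ω^k_i = h_{i1} ω^1_0 + h_{i2} ω^2_0` for `i = 1, 2`. -/
def IsCoeffMatrix (s : M → Frame) (x : M) (k : Fin 5) (h : Matrix (Fin 2) (Fin 2) ℝ) : Prop :=
  ∀ (v : TangentSpace (𝓡 2) x) (i : Fin 2),
    maurerCartan s x v k (tangIdx i) = ∑ j, h i j * maurerCartan s x v (tangIdx j) 0

/-- At `x` there is a 1-adapted frame field of `f` whose coefficient matrices `h^0, h^3, h^4` have
the property `C`. -/
def HasCoeffs (f : M → R5) (x : M)
    (C : Matrix (Fin 2) (Fin 2) ℝ → Matrix (Fin 2) (Fin 2) ℝ → Matrix (Fin 2) (Fin 2) ℝ → Prop) :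
    Prop :=
  ∃ (U : Set M) (s : M → Frame) (h0 h3 h4 : Matrix (Fin 2) (Fin 2) ℝ),
    x ∈ U ∧ IsOneAdapted f U s ∧
    IsCoeffMatrix s x 0 h0 ∧ IsCoeffMatrix s x 3 h3 ∧ IsCoeffMatrix s x 4 h4 ∧ C h0 h3 h4

/-- `h^0, h^3, h^4` are linearly independent at every point (this does not depend on the choice of
the 1-adapted frame field). -/
def IsNondegenerate (f : M → R5) : Prop :=
  ∀ x, HasCoeffs f x fun h0 h3 h4 => LinearIndependent ℝ ![h0, h3, h4]

/-- The quadratic form `Q(h) = -det h` on symmetric `2 × 2` matrices. -/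
def quadForm (h : Matrix (Fin 2) (Fin 2) ℝ) : ℝ := -h.det

/-- At every point `Q` is positive definite on the plane spanned by `h^3, h^4`. -/
def IsSpaceLike (f : M → R5) : Prop :=
  ∀ x, HasCoeffs f x fun _ h3 h4 => LinearIndependent ℝ ![h3, h4] ∧
    ∀ h ∈ Submodule.span ℝ {h3, h4}, h ≠ 0 → 0 < quadForm h

/-- At every point `Q` is indefinite on the plane spanned by `h^3, h^4`. -/
def IsTimeLike (f : M → R5) : Prop :=
  ∀ x, HasCoeffs f x fun _ h3 h4 => LinearIndependent ℝ ![h3, h4] ∧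
    (∃ h ∈ Submodule.span ℝ {h3, h4}, 0 < quadForm h) ∧
    ∃ h ∈ Submodule.span ℝ {h3, h4}, quadForm h < 0

/-- 2-adapted frame fields, space-like case. -/
def IsTwoAdaptedSpaceLike (f : M → R5) (U : Set M) (s : M → Frame) : Prop :=
  IsOneAdapted f U s ∧
  ∃ ε : ℝ, (ε = 1 ∨ ε = -1) ∧ ∀ y ∈ U,
    IsCoeffMatrix s y 3 !![1, 0; 0, -1] ∧ IsCoeffMatrix s y 4 !![0, 1; 1, 0] ∧
    IsCoeffMatrix s y 0 !![ε, 0; 0, ε]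

/-- 2-adapted frame fields, time-like case. -/
def IsTwoAdaptedTimeLike (f : M → R5) (U : Set M) (s : M → Frame) : Prop :=
  IsOneAdapted f U s ∧
  ∀ y ∈ U,
    IsCoeffMatrix s y 3 !![1, 0; 0, 0] ∧ IsCoeffMatrix s y 4 !![0, 0; 0, 1] ∧
    IsCoeffMatrix s y 0 !![0, 1; 1, 0]

/-- 3-adapted frame fields, space-like case: 2-adapted with `ω^0_3 = ω^0_4 = 0`. -/
def IsThreeAdaptedSpaceLike (f : M → R5) (U : Set M) (s : M → Frame) : Prop :=
  IsTwoAdaptedSpaceLike f U s ∧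
  ∀ y ∈ U, ∀ v : TangentSpace (𝓡 2) y,
    maurerCartan s y v 0 3 = 0 ∧ maurerCartan s y v 0 4 = 0

/-- 3-adapted frame fields, time-like case: 2-adapted with `ω^0_3 = ω^0_4 = 0`. -/
def IsThreeAdaptedTimeLike (f : M → R5) (U : Set M) (s : M → Frame) : Prop :=
  IsTwoAdaptedTimeLike f U s ∧
  ∀ y ∈ U, ∀ v : TangentSpace (𝓡 2) y,
    maurerCartan s y v 0 3 = 0 ∧ maurerCartan s y v 0 4 = 0

/-- The structure group `G₃ ≅ SO(2)` of the space-like case. -/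
def spaceLikeGroup : Set (Matrix (Fin 5) (Fin 5) ℝ) :=
  Set.range fun θ : ℝ =>
    !![1, 0, 0, 0, 0;
       0, Real.cos θ, -Real.sin θ, 0, 0;
       0, Real.sin θ, Real.cos θ, 0, 0;
       0, 0, 0, Real.cos (2 * θ), -Real.sin (2 * θ);
       0, 0, 0, Real.sin (2 * θ), Real.cos (2 * θ)]

/-- The structure group `G₃ ≅ SO⁺(1,1)` of the time-like case. -/
def timeLikeGroup : Set (Matrix (Fin 5) (Fin 5) ℝ) :=
  Set.range fun l : ℝ =>
    !![1, 0, 0, 0, 0;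
       0, Real.exp l, 0, 0, 0;
       0, 0, Real.exp (-l), 0, 0;
       0, 0, 0, Real.exp (2 * l), 0;
       0, 0, 0, 0, Real.exp (-(2 * l))]

/-- `F` is a principal bundle over `M` with structure group `G` whose local sections are frame
fields of the kind `adapted`: through every point of `F` passes a smooth local section of `F` of
that kind, every fibre is non-empty, and every fibre is a single `G`-orbit. -/
def IsFrameBundle (adapted : Set M → (M → Frame) → Prop) (G : Set (Matrix (Fin 5) (Fin 5) ℝ))
    (F : Set (M × Frame)) : Prop :=
  (∀ p ∈ F, ∃ (U : Set M) (s : M → Frame),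
    p.1 ∈ U ∧ adapted U s ∧ s p.1 = p.2 ∧ ∀ y ∈ U, (y, s y) ∈ F) ∧
  (∀ x, ∃ e, (x, e) ∈ F) ∧
  ∀ x e e', (x, e) ∈ F →
    ((x, e') ∈ F ↔ ∃ g ∈ G, frameMatrix e' = frameMatrix e * g)

/-- `F` is a bundle `𝓕₃` of 3-adapted frames along the (space-like or time-like) surface `f`. -/
def IsThreeAdaptedBundle (f : M → R5) (F : Set (M × Frame)) : Prop :=
  IsFrameBundle (IsThreeAdaptedSpaceLike f) spaceLikeGroup F ∨
  IsFrameBundle (IsThreeAdaptedTimeLike f) timeLikeGroup F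

end Surfaces

/-! ### Symmetries and homogeneity -/

section Symmetry

variable {P : Type*} [TopologicalSpace P] [ChartedSpace (EuclideanSpace ℝ (Fin 3)) P]

/-- A self-diffeomorphism of the (3-dimensional) bundle `P` that preserves the pullback to `P`, by
`e : P → Frame`, of the Maurer-Cartan forms: `φ^* Ω = Ω`. -/
def IsSymmetry (e : P → Frame) (φ : P ≃ₘ^∞⟮𝓡 3, 𝓡 3⟯ P) : Prop :=
  ∀ (q : P) (v : TangentSpace (𝓡 3) q),
    maurerCartan e (φ q) (mfderiv (𝓡 3) (𝓡 3) φ q v) = maurerCartan e q v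

end Symmetry

/-- The surface `f` is homogeneous: for a bundle `F` of 3-adapted frames along `f`, regarded as the
3-dimensional embedded submanifold `ι : P → M × Frame` with image `F`, the group of all
symmetries is a 3-dimensional Lie group `G` that acts (smoothly and) transitively. -/
def IsHomogeneous {M : Type u} [TopologicalSpace M] [ChartedSpace Plane M] (f : M → R5) : Prop :=
  ∃ F : Set (M × Frame), IsThreeAdaptedBundle f F ∧
  ∃ (P : Type u) (_ : TopologicalSpace P) (_ : ChartedSpace (EuclideanSpace ℝ (Fin 3)) P)
    (_ : IsManifold (𝓡 3) ∞ P) (ι : P → M × Frame),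
    (ContMDiff (𝓡 3) ((𝓡 2).prod 𝓘(ℝ, Frame)) ∞ ι ∧
      (∀ q, Function.Injective (mfderiv (𝓡 3) ((𝓡 2).prod 𝓘(ℝ, Frame)) ι q)) ∧
      Topology.IsEmbedding ι ∧ Set.range ι = F) ∧
  ∃ (G : Type u) (_ : Group G) (_ : TopologicalSpace G) (_ : T2Space G)
    (_ : SecondCountableTopology G) (_ : ChartedSpace (EuclideanSpace ℝ (Fin 3)) G)
    (_ : LieGroup (𝓡 3) ∞ G) (_ : MulAction G P),
    (∀ φ : P ≃ₘ^∞⟮𝓡 3, 𝓡 3⟯ P,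
      IsSymmetry (fun q => (ι q).2) φ ↔ ∃ g : G, ∀ q, φ q = g • q) ∧
    FaithfulSMul G P ∧ ContMDiffSMul (𝓡 3) (𝓡 3) ∞ G P ∧ MulAction.IsPretransitive G P

/-! ### Equivalence, centroaffine metric and Gauss curvature -/

/-- Equivalence of subsets of `ℝ⁵` under the linear action of `GL(5,ℝ)`. -/
def GLEquivalent (S S' : Set R5) : Prop :=
  ∃ g : GL (Fin 5) ℝ, (fun y => (g : Matrix (Fin 5) (Fin 5) ℝ) *ᵥ y) '' S = S'

/-- `f` has, at `x`, 3-adapted frame fields (space-like case) and the centroaffine metric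
`(ω^1_0)² + (ω^2_0)²`, as a quadratic form on the tangent plane at `x`, is `q`. -/
def HasSpaceLikeMetricAt (f : Plane → R5) (x : Plane) (q : Plane → ℝ) : Prop :=
  ∃ (U : Set Plane) (s : Plane → Frame), x ∈ U ∧ IsThreeAdaptedSpaceLike f U s ∧
    ∀ w : Plane, q w = maurerCartan s x w 1 0 ^ 2 + maurerCartan s x w 2 0 ^ 2

/-- `f` has, at `x`, 3-adapted frame fields (time-like case) and the centroaffine metric
`2 ω^1_0 ω^2_0`, as a quadratic form on the tangent plane at `x`, is `q`. -/
def HasTimeLikeMetricAt (f : Plane → R5) (x : Plane) (q : Plane → ℝ) : Prop :=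
  ∃ (U : Set Plane) (s : Plane → Frame), x ∈ U ∧ IsThreeAdaptedTimeLike f U s ∧
    ∀ w : Plane, q w = 2 * maurerCartan s x w 1 0 * maurerCartan s x w 2 0

/-- The Levi-Civita connection form `α = (ω^1_2 - ω^2_1) / 2` of the centroaffine metric in a
3-adapted frame field (space-like case). -/
def connForm (s : Plane → Frame) (y w : Plane) : ℝ :=
  (maurerCartan s y w 1 2 - maurerCartan s y w 2 1) / 2

/-- The Gauss curvature of the centroaffine metric of a space-like surface at `x` is `K`:
`dα = K ω^1_0 ∧ ω^2_0`. -/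
def HasGaussCurvatureAt (f : Plane → R5) (x : Plane) (K : ℝ) : Prop :=
  ∃ (U : Set Plane) (s : Plane → Frame), x ∈ U ∧ IsThreeAdaptedSpaceLike f U s ∧
    ∀ a b : Plane,
      fderiv ℝ (fun y => connForm s y b) x a - fderiv ℝ (fun y => connForm s y a) x b =
        K * (maurerCartan s x a 1 0 * maurerCartan s x b 2 0 -
          maurerCartan s x b 1 0 * maurerCartan s x a 2 0)

/-! ### The three model surfaces -/

open Real in
/-- The hyperbolic model, in coordinates `(u, v) = (x 0, x 1)`. -/
def hyperbolicModel (x : Plane) : R5 :=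
  ![(3 * cosh (x 0) ^ 2 * cosh (x 1) ^ 2 - 1) / 2,
    √3 * sinh (x 0) * cosh (x 0) * cosh (x 1) ^ 2,
    √3 * cosh (x 0) * sinh (x 1) * cosh (x 1),
    3 / 2 * (cosh (x 1) ^ 2 * (cosh (x 0) ^ 2 - 2) + 1),
    3 * sinh (x 0) * sinh (x 1) * cosh (x 1)]

open Real in
/-- The spherical model, in coordinates `(u, v) = (x 0, x 1)`. -/
def sphericalModel (x : Plane) : R5 :=
  ![(3 * cos (x 0) ^ 2 * cos (x 1) ^ 2 - 1) / 2,
    √3 * sin (x 0) * cos (x 0) * cos (x 1) ^ 2,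
    √3 * cos (x 0) * sin (x 1) * cos (x 1),
    3 / 2 * (cos (x 1) ^ 2 * (2 - cos (x 0) ^ 2) - 1),
    3 * sin (x 0) * sin (x 1) * cos (x 1)]

open Real in
/-- The Lorentzian model, in coordinates `(u, v) = (x 0, x 1)`. -/
def lorentzianModel (x : Plane) : R5 :=
  ![(3 * cos (x 0) ^ 2 * (cosh (2 * x 1) + 1) - 2) / 4,
    √6 / 4 * cos (x 0) * (sin (x 0) * (cosh (2 * x 1) + 1) + sinh (2 * x 1)),
    -(√6 / 4 * cos (x 0) * (sin (x 0) * (cosh (2 * x 1) + 1) - sinh (2 * x 1))),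
    -(3 / 8 * (cos (x 0) ^ 2 * (cosh (2 * x 1) + 1)
      - 2 * (cosh (2 * x 1) + sin (x 0) * sinh (2 * x 1)))),
    -(3 / 8 * (cos (x 0) ^ 2 * (cosh (2 * x 1) + 1)
      - 2 * (cosh (2 * x 1) - sin (x 0) * sinh (2 * x 1))))]

open Real in
/-- Latitude-longitude parametrization of the unit sphere. -/
def sphereParam (x : Plane) : EuclideanSpace ℝ (Fin 3) :=
  !₂[cos (x 0) * cos (x 1), sin (x 0) * cos (x 1), sin (x 1)]

open Real in
/-- Parametrization of the hyperboloid of one sheet `p₀² + p₁² - p₂² = 3`. -/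
def hyperboloidParam (x : Plane) : Fin 3 → ℝ :=
  ![√3 * (cos (x 0) * cosh (x 1)), √3 * (sin (x 0) * cosh (x 1)), √3 * sinh (x 1)]

/-- The surface `S^{2,1}`: the space-like vectors of length `√3` of `ℝ^{2,1}`. -/
def oneSheetHyperboloid : Set (Fin 3 → ℝ) := {p | p 0 ^ 2 + p 1 ^ 2 - p 2 ^ 2 = 3}

/-! ### The groups and their representations -/

/-- The diagonal Lorentzian form on `ℝ³` with time axis `k`. -/
def lorentzForm (k : Fin 3) : Matrix (Fin 3) (Fin 3) ℝ :=
  Matrix.diagonal fun i => if i = k then -1 else 1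

theorem lorentzForm_sq (k : Fin 3) : lorentzForm k * lorentzForm k = 1 := by
  rw [lorentzForm, Matrix.diagonal_mul_diagonal, ← Matrix.diagonal_one]
  congr 1
  funext i
  split_ifs <;> norm_num

theorem lorentz_aux {a b a₁ a₂ b₁ b₂ : ℝ} (ha : 0 < a) (hb : 0 < b)
    (h : a₁ ^ 2 + a₂ ^ 2 = a ^ 2 - 1) (h' : b₁ ^ 2 + b₂ ^ 2 = b ^ 2 - 1) :
    0 < a * b + a₁ * b₁ + a₂ * b₂ := by
  have hab : 0 < a * b := mul_pos ha hb
  have h1 : (a₁ * b₁ + a₂ * b₂) ^ 2 < (a * b) ^ 2 := by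
    have e : (a₁ * b₁ + a₂ * b₂) ^ 2 + (a₁ * b₂ - a₂ * b₁) ^ 2
        = (a ^ 2 - 1) * (b ^ 2 - 1) := by
      rw [← h, ← h']; ring
    nlinarith [sq_nonneg (a₁ * b₂ - a₂ * b₁), sq_nonneg a₁, sq_nonneg a₂, sq_nonneg b₁,
      sq_nonneg b₂]
  have h2 := (abs_lt.mp (abs_lt_of_sq_lt_sq h1 hab.le)).1
  linarith

theorem lorentz_transpose {k : Fin 3} {A : Matrix (Fin 3) (Fin 3) ℝ}
    (h : Aᵀ * lorentzForm k * A = lorentzForm k) : A * lorentzForm k * Aᵀ = lorentzForm k := by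
  have h1 : (lorentzForm k * Aᵀ * lorentzForm k) * A = 1 := by
    rw [mul_assoc, mul_assoc, ← mul_assoc Aᵀ, h, lorentzForm_sq]
  have h2 : A * (lorentzForm k * Aᵀ * lorentzForm k) = 1 := mul_eq_one_comm.mp h1
  calc A * lorentzForm k * Aᵀ
      = A * (lorentzForm k * Aᵀ * lorentzForm k) * lorentzForm k := by
        simp only [mul_assoc, lorentzForm_sq, mul_one]
    _ = lorentzForm k := by rw [h2, one_mul]

/-- The proper orthochronous Lorentz group of `ℝ³` with time axis `k`: `SO⁺(1,2)` for `k = 0` and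
`SO⁺(2,1)` for `k = 2`. -/
def soPlus (k : Fin 3) : Subgroup (GL (Fin 3) ℝ) where
  carrier := {A | (A : Matrix (Fin 3) (Fin 3) ℝ)ᵀ * lorentzForm k * A = lorentzForm k ∧
    (A : Matrix (Fin 3) (Fin 3) ℝ).det = 1 ∧ 0 < (A : Matrix (Fin 3) (Fin 3) ℝ) k k}
  one_mem' := by simp
  mul_mem' := by
    rintro A B ⟨hA, dA, pA⟩ ⟨hB, dB, pB⟩
    refine ⟨?_, by simp [dA, dB], ?_⟩
    · rw [Units.val_mul, Matrix.transpose_mul]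
      calc _ = (B : Matrix (Fin 3) (Fin 3) ℝ)ᵀ *
            ((A : Matrix (Fin 3) (Fin 3) ℝ)ᵀ * lorentzForm k * A) * B := by
              simp only [mul_assoc]
        _ = _ := by rw [hA, hB]
    · have hA' := congrFun (congrFun (lorentz_transpose hA) k) k
      have hB' := congrFun (congrFun hB k) k
      rw [Units.val_mul, Matrix.mul_apply]
      fin_cases k <;>
        simp [Matrix.mul_apply, lorentzForm, Fin.sum_univ_three, Matrix.diagonal_apply]
          at hA' hB' pA pB ⊢
      · have := lorentz_aux pA pB (a₁ := A 0 1) (a₂ := A 0 2) (b₁ := B 1 0) (b₂ := B 2 0)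
          (by linarith) (by linarith)
        linarith
      · have := lorentz_aux pA pB (a₁ := A 1 0) (a₂ := A 1 2) (b₁ := B 0 1) (b₂ := B 2 1)
          (by linarith) (by linarith)
        linarith
      · have := lorentz_aux pA pB (a₁ := A 2 0) (a₂ := A 2 1) (b₁ := B 0 2) (b₂ := B 1 2)
          (by linarith) (by linarith)
        linarith
  inv_mem' := by
    rintro A ⟨hA, dA, pA⟩
    have h1 : (lorentzForm k * (A : Matrix (Fin 3) (Fin 3) ℝ)ᵀ * lorentzForm k) * A = 1 := by
      rw [mul_assoc, mul_assoc, ← mul_assoc (A : Matrix (Fin 3) (Fin 3) ℝ)ᵀ, hA, lorentzForm_sq]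
    have h2 : ((A⁻¹ : GL (Fin 3) ℝ) : Matrix (Fin 3) (Fin 3) ℝ) =
        lorentzForm k * (A : Matrix (Fin 3) (Fin 3) ℝ)ᵀ * lorentzForm k :=
      Units.inv_eq_of_mul_eq_one_left h1
    have h3 : (lorentzForm k).det * (lorentzForm k).det = 1 := by
      rw [← Matrix.det_mul, lorentzForm_sq, Matrix.det_one]
    refine ⟨?_, ?_, ?_⟩
    · have ht := lorentz_transpose hA
      have hs : (lorentzForm k)ᵀ = lorentzForm k := Matrix.diagonal_transpose _
      rw [h2, Matrix.transpose_mul, Matrix.transpose_mul, Matrix.transpose_transpose, hs]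
      calc _ = lorentzForm k * ((A : Matrix (Fin 3) (Fin 3) ℝ) *
            (lorentzForm k * lorentzForm k * lorentzForm k) *
            (A : Matrix (Fin 3) (Fin 3) ℝ)ᵀ) * lorentzForm k := by simp only [mul_assoc]
        _ = _ := by rw [lorentzForm_sq, one_mul, ht, lorentzForm_sq, one_mul]
    · rw [h2, Matrix.det_mul, Matrix.det_mul, Matrix.det_transpose, dA, mul_one, h3]
    · rw [h2]
      simpa [lorentzForm, Matrix.diagonal_mul, Matrix.mul_diagonal] using pA

/-- `S` is the orbit of `(1, 0, 0, 0, 0)` under a faithful irreducible continuous representation of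
the topological group `Γ` on `ℝ⁵`. -/
def IsIrreducibleOrbit (Γ : Type*) [Group Γ] [TopologicalSpace Γ] (S : Set R5) : Prop :=
  ∃ ρ : Γ →* GL (Fin 5) ℝ, Continuous ρ ∧ Function.Injective ρ ∧
    (∀ W : Submodule ℝ R5,
      (∀ γ, ∀ w ∈ W, (ρ γ : Matrix (Fin 5) (Fin 5) ℝ) *ᵥ w ∈ W) → W = ⊥ ∨ W = ⊤) ∧
    S = Set.range fun γ => (ρ γ : Matrix (Fin 5) (Fin 5) ℝ) *ᵥ (Pi.single 0 1 : R5)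

end

noncomputable section

/-! ### Calculus with matrix-valued maps -/

/-! The classification is a moving-frame argument. On the frame bundle `P` let Ω = e⁻¹de be the
Maurer–Cartan form of the tautological map `e : P → Frame`. Since `P` is immersed in `M × Frame`,
the values of Ω at a point q form a 3-dimensional space V of matrices, and since symmetries preserve
Ω and act transitively, V is the same at every point. Differentiating a V-valued Ω and using
symmetry of second derivatives shows that V is closed under commutators (`commutator_mem`). The
linear relations of 3-adapted frames and the generator of the structure group leave few unknown
entries in V, and bracket closure determines them: V is the algebra of all `spaceLikeMat ε a b c` or
of all `timeLikeMat a b c` (`mem_iff_spaceLikeMat`, `mem_iff_timeLikeMat`).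

Connectedness of `P` is not assumed. It follows from the dimension of the symmetry group: on a
disconnected `P` symmetries could be chosen independently on two components, so a 3-dimensional
group would act transitively on a 6-dimensional product (`preconnectedSpace_of_symmetries`). Over a
connected `P` every symmetry is a left translation of frames, so the matrices e(q)⁻¹e(p) are closed
under multiplication.

It remains to identify e(q)⁻¹f(M) with a model, without integrating V to a group. If N is a
V-equivariant map of ℝ⁵ killing the first basis vector, then e(p)N(e(p)⁻¹w) is constant in p, so N
vanishes on e(q)⁻¹f(M) (`equivariant_eq_zero`). A quadratic covariant and a quadratic invariant cut
out the model up to a second sheet, and a continuous function without zeros separates the sheets.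
Conversely, the model has the form exp(uX)exp(vY)e₀ with X, Y in V, and such solution curves cannot
leave the orbit (`solution_mem_orbit`).

The models are made explicit by one construction, `QuadraticModel`: ℝ⁵ is the space of symmetric 3 ×
3 matrices modulo an involution J of the relevant signature, on which A acts by S ↦ ASAᵀ, and each
surface is the image of a quadric pᵀJp = 1 under the Veronese map p ↦ ppᵀ. Applying the
representation to an explicit J-orthogonal matrix A(u,v) gives a 3-adapted frame whose Maurer–Cartan
form is read off from A⁻¹dA. This yields the metrics and curvatures. Irreducibility follows from the
Lie algebra action, and the fibres are ±p because ppᵀ determines p up to sign. -/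

/-- The space of real `5 × 5` matrices. -/
abbrev Mat5 : Type := Matrix (Fin 5) (Fin 5) ℝ

attribute [local instance] Matrix.linftyOpNormedRing Matrix.linftyOpNormedAlgebra

/-- `frameMatrix` as a continuous linear map. -/
def frameMatrixL : Frame →L[ℝ] Mat5 :=
  LinearMap.toContinuousLinearMap
    { toFun := frameMatrix
      map_add' := fun _ _ => rfl
      map_smul' := fun _ _ => rfl }

theorem frameMatrix_apply (e : Frame) (i j : Fin 5) : frameMatrix e i j = e j i := rfl

theorem frameMatrix_injective : Function.Injective frameMatrix := fun e e' h => by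
  funext j i
  exact congrFun (congrFun h i) j

/-- The tuple of columns of a matrix. -/
def columns (A : Mat5) : Frame := fun j i => A i j

/-- `columns` as a continuous linear map. -/
def columnsL : Mat5 →L[ℝ] Frame :=
  LinearMap.toContinuousLinearMap
    { toFun := columns
      map_add' := fun _ _ => rfl
      map_smul' := fun _ _ => rfl }

theorem isUnit_frameMatrix {e : Frame} : IsUnit (frameMatrix e) ↔ LinearIndependent ℝ e := by
  rw [← Matrix.linearIndependent_cols_iff_isUnit]
  rfl

/-- Reduces to the derivative of `Ring.inverse` in a complete normed algebra. This is why matrices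
carry the operator norm as a local instance. -/
theorem HasDerivAt.matrixInv {A : ℝ → Mat5} {A' : Mat5} {t : ℝ} (h : HasDerivAt A A' t)
    (hu : IsUnit (A t)) :
    HasDerivAt (fun t => (A t)⁻¹) (-((A t)⁻¹ * A' * (A t)⁻¹)) t := by
  obtain ⟨w, hw⟩ := hu
  have h1 := (hasFDerivAt_ringInverse (𝕜 := ℝ) w)
  rw [hw] at h1
  have h2 := h1.comp_hasDerivAt t h
  have e1 : (fun t => (A t)⁻¹) = Ring.inverse ∘ A := by
    funext s
    simp [Matrix.nonsing_inv_eq_ringInverse]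
  have h3 : ((w⁻¹ : Mat5ˣ) : Mat5) = (A t)⁻¹ := by
    rw [← hw, Matrix.coe_units_inv]
  have h4 : (-((ContinuousLinearMap.mulLeftRight ℝ Mat5) ↑w⁻¹) ↑w⁻¹) A' =
      -((A t)⁻¹ * A' * (A t)⁻¹) := by
    rw [← h3]
    rfl
  rw [e1, ← h4]
  exact h2

theorem differentiableAt_matrixInv {A : Mat5} (hu : IsUnit A) :
    DifferentiableAt ℝ (fun B : Mat5 => B⁻¹) A := by
  have : (fun B : Mat5 => B⁻¹) = Ring.inverse := by
    funext s
    simp [Matrix.nonsing_inv_eq_ringInverse]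
  rw [this]
  exact differentiableAt_inverse hu

/-- The passage between matrices and tuples of columns is linear in finite dimension, so the choice
of norm on matrices is immaterial. -/
theorem hasDerivAt_matrix_iff {A : ℝ → Mat5} {A' : Mat5} {t : ℝ} :
    HasDerivAt A A' t ↔ ∀ i j, HasDerivAt (fun s => A s i j) (A' i j) t := by
  constructor
  · intro h i j
    exact ((LinearMap.toContinuousLinearMap
      (Matrix.entryLinearMap ℝ ℝ i j)).hasFDerivAt.comp_hasDerivAt t h)
  · intro h
    have h1 : HasDerivAt (fun s => columns (A s)) (columns A') t :=
      hasDerivAt_pi.2 fun j => hasDerivAt_pi.2 fun i => h i j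
    exact frameMatrixL.hasFDerivAt.comp_hasDerivAt t h1

theorem HasDerivAt.frameMat {e : ℝ → Frame} {e' : Frame} {t : ℝ} (h : HasDerivAt e e' t) :
    HasDerivAt (fun s => frameMatrix (e s)) (frameMatrix e') t :=
  frameMatrixL.hasFDerivAt.comp_hasDerivAt t h

theorem HasDerivAt.columns {A : ℝ → Mat5} {A' : Mat5} {t : ℝ} (h : HasDerivAt A A' t) :
    HasDerivAt (fun s => columns (A s)) (columns A') t :=
  columnsL.hasFDerivAt.comp_hasDerivAt t h

theorem HasDerivAt.matrixMulVec {A : ℝ → Mat5} {A' : Mat5} {y : ℝ → R5} {y' : R5} {t : ℝ}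
    (hA : HasDerivAt A A' t) (hy : HasDerivAt y y' t) :
    HasDerivAt (fun s => A s *ᵥ y s) (A' *ᵥ y t + A t *ᵥ y') t := by
  rw [hasDerivAt_pi] at hy ⊢
  intro i
  have h1 : ∀ j ∈ Finset.univ, HasDerivAt (fun s => A s i j * y s j)
      (A' i j * y t j + A t i j * y' j) t :=
    fun j _ => (hasDerivAt_matrix_iff.1 hA i j).mul (hy j)
  have h2 := HasDerivAt.fun_sum h1
  simpa [Matrix.mulVec, dotProduct, Finset.sum_add_distrib] using h2

/-! ### Curves in manifolds and locally constant functions -/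

section Curves

variable {n : ℕ} {P : Type*} [TopologicalSpace P] [ChartedSpace (EuclideanSpace ℝ (Fin n)) P]
  [IsManifold (𝓡 n) ∞ P]

theorem contMDiffAt_extChartAt_symm (q : P) {x : EuclideanSpace ℝ (Fin n)}
    (hx : x ∈ (extChartAt (𝓡 n) q).target) :
    ContMDiffAt (𝓡 n) (𝓡 n) ∞ (extChartAt (𝓡 n) q).symm x :=
  (contMDiffOn_extChartAt_symm q).contMDiffAt ((isOpen_extChartAt_target q).mem_nhds hx)

theorem mdifferentiableAt_extChartAt_symm (q : P) {x : EuclideanSpace ℝ (Fin n)}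
    (hx : x ∈ (extChartAt (𝓡 n) q).target) :
    MDifferentiableAt (𝓡 n) (𝓡 n) (extChartAt (𝓡 n) q).symm x :=
  (contMDiffAt_extChartAt_symm q hx).mdifferentiableAt (by simp)

/-- The derivative of a map in the preferred chart at a point. -/
theorem mfderiv_eq_fderiv_comp_chart {F : Type*} [NormedAddCommGroup F] [NormedSpace ℝ F] (q : P)
    {h : P → F} (hh : MDifferentiableAt (𝓡 n) 𝓘(ℝ, F) h q) :
    DifferentiableAt ℝ (h ∘ (extChartAt (𝓡 n) q).symm) (extChartAt (𝓡 n) q q) ∧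
    ∀ v, mfderiv (𝓡 n) 𝓘(ℝ, F) h q v = fderiv ℝ (h ∘ (extChartAt (𝓡 n) q).symm)
      (extChartAt (𝓡 n) q q) (mfderiv (𝓡 n) (𝓡 n) (extChartAt (𝓡 n) q) q v) := by
  have h1 : MDifferentiableAt (𝓡 n) 𝓘(ℝ, F) (h ∘ (extChartAt (𝓡 n) q).symm)
      (extChartAt (𝓡 n) q q) := by
    refine MDifferentiableAt.comp _ ?_
      (mdifferentiableAt_extChartAt_symm q (mem_extChartAt_target q))
    rwa [extChartAt_to_inv]
  refine ⟨h1.differentiableAt, fun v => ?_⟩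
  have h2 : MDifferentiableAt (𝓡 n) (𝓡 n) (extChartAt (𝓡 n) q) q := by
    have : IsManifold (𝓡 n) 1 P := IsManifold.of_le (n := ∞) (by simp)
    exact mdifferentiableAt_extChartAt (mem_chart_source _ q)
  have h3 := h1.differentiableAt.hasFDerivAt.hasMFDerivAt.comp q h2.hasMFDerivAt
  have h4 : h =ᶠ[𝓝 q] (h ∘ (extChartAt (𝓡 n) q).symm) ∘ extChartAt (𝓡 n) q := by
    filter_upwards [extChartAt_source_mem_nhds (I := 𝓡 n) q] with y hy
    simp only [Function.comp_apply, (extChartAt (𝓡 n) q).left_inv hy]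
  rw [(h3.congr_of_eventuallyEq h4).mfderiv]
  rfl

theorem fderiv_comp_extChartAt_symm {F : Type*} [NormedAddCommGroup F] [NormedSpace ℝ F]
    {h : P → F} (hh : MDifferentiable (𝓡 n) 𝓘(ℝ, F) h) (q : P) {x : EuclideanSpace ℝ (Fin n)}
    (hx : x ∈ (extChartAt (𝓡 n) q).target) (w : EuclideanSpace ℝ (Fin n)) :
    ∃ v : TangentSpace (𝓡 n) ((extChartAt (𝓡 n) q).symm x),
      fderiv ℝ (h ∘ (extChartAt (𝓡 n) q).symm) x w =
        (id (mfderiv (𝓡 n) 𝓘(ℝ, F) h ((extChartAt (𝓡 n) q).symm x) v) : F) := by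
  let D : EuclideanSpace ℝ (Fin n) →L[ℝ] F :=
    (mfderiv (𝓡 n) 𝓘(ℝ, F) h ((extChartAt (𝓡 n) q).symm x)).comp
      (mfderiv (𝓡 n) (𝓡 n) (extChartAt (𝓡 n) q).symm x)
  have h1 : HasFDerivAt (h ∘ (extChartAt (𝓡 n) q).symm) D x := ((hh _).hasMFDerivAt.comp x
    (mdifferentiableAt_extChartAt_symm q hx).hasMFDerivAt).hasFDerivAt
  refine ⟨mfderiv (𝓡 n) (𝓡 n) (extChartAt (𝓡 n) q).symm x (show TangentSpace (𝓡 n) x from w), ?_⟩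
  exact congrArg (fun L : EuclideanSpace ℝ (Fin n) →L[ℝ] F => L w) h1.fderiv

/-- Every tangent vector is the velocity of a curve. -/
theorem exists_curve (q : P) (v : TangentSpace (𝓡 n) q) :
    ∃ γ : ℝ → P, γ 0 = q ∧ ContinuousAt γ 0 ∧
      ∀ {F : Type} [NormedAddCommGroup F] [NormedSpace ℝ F] (h : P → F),
        MDifferentiableAt (𝓡 n) 𝓘(ℝ, F) h q →
        HasDerivAt (F := F) (h ∘ γ) (mfderiv (𝓡 n) 𝓘(ℝ, F) h q v) 0 := by
  set D : EuclideanSpace ℝ (Fin n) := mfderiv (𝓡 n) (𝓡 n) (extChartAt (𝓡 n) q) q v with hD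
  set x : EuclideanSpace ℝ (Fin n) := extChartAt (𝓡 n) q q with hx
  -- The curve is a straight line in the chart. It depends only on v, so one curve serves every test
  -- map h.
  have hl : HasDerivAt (fun t : ℝ => x + t • D) D 0 := by
    simpa using ((hasDerivAt_id (0 : ℝ)).smul_const D).const_add x
  refine ⟨fun t => (extChartAt (𝓡 n) q).symm (x + t • D), by simp [hx], ?_, ?_⟩
  · refine ContinuousAt.comp (f := fun t : ℝ => x + t • D) ?_ hl.continuousAt
    simpa [hx] using continuousAt_extChartAt_symm (I := 𝓡 n) q
  · intro F _ _ h hh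
    obtain ⟨h1, h2⟩ := mfderiv_eq_fderiv_comp_chart q hh
    rw [h2 v]
    have h3 : HasFDerivAt (h ∘ (extChartAt (𝓡 n) q).symm)
      (fderiv ℝ (h ∘ (extChartAt (𝓡 n) q).symm) x) (x + (0 : ℝ) • D) := by
        rw [zero_smul, add_zero]
        exact h1.hasFDerivAt
    exact h3.comp_hasDerivAt (0 : ℝ) hl

theorem isLocallyConstant_of_mfderiv_eq_zero {F : Type*} [NormedAddCommGroup F] [NormedSpace ℝ F]
    {h : P → F} (hd : MDifferentiable (𝓡 n) 𝓘(ℝ, F) h)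
    (h0 : ∀ q v, mfderiv (𝓡 n) 𝓘(ℝ, F) h q v = 0) : IsLocallyConstant h := by
  rw [IsLocallyConstant.iff_eventually_eq]
  intro q
  have hq := isOpen_extChartAt_target (I := 𝓡 n) q
  obtain ⟨r, hr, hb⟩ := Metric.isOpen_iff.1 hq _ (mem_extChartAt_target q)
  have hfd : ∀ x ∈ Metric.ball (extChartAt (𝓡 n) q q) r,
      HasFDerivAt (h ∘ (extChartAt (𝓡 n) q).symm) (0 : EuclideanSpace ℝ (Fin n) →L[ℝ] F) x := by
    intro x hx
    have h1 := ((hd _).hasMFDerivAt.comp x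
      (mdifferentiableAt_extChartAt_symm q (hb hx)).hasMFDerivAt).hasFDerivAt
    have h2 : (0 : EuclideanSpace ℝ (Fin n) →L[ℝ] F) =
        (mfderiv (𝓡 n) 𝓘(ℝ, F) h ((extChartAt (𝓡 n) q).symm x)).comp
          (mfderiv (𝓡 n) (𝓡 n) (extChartAt (𝓡 n) q).symm x) := by
      ext v
      exact (h0 _ _).symm
    rw [h2]
    exact h1
  have hc : ∀ x ∈ Metric.ball (extChartAt (𝓡 n) q q) r,
      (h ∘ (extChartAt (𝓡 n) q).symm) x = h q := by
    intro x hx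
    have h2 := Metric.isOpen_ball.is_const_of_fderiv_eq_zero (𝕜 := ℝ)
      (convex_ball (extChartAt (𝓡 n) q q) r).isPreconnected
      (fun y hy => (hfd y hy).differentiableAt.differentiableWithinAt)
      (fun y hy => (hfd y hy).fderiv) hx (Metric.mem_ball_self hr)
    rw [h2, Function.comp_apply, extChartAt_to_inv]
  have h3 : ∀ᶠ y in 𝓝 q, extChartAt (𝓡 n) q y ∈ Metric.ball (extChartAt (𝓡 n) q q) r :=
    (continuousAt_extChartAt q).eventually (Metric.isOpen_ball.mem_nhds (Metric.mem_ball_self hr))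
  filter_upwards [h3, extChartAt_source_mem_nhds (I := 𝓡 n) q] with y hy hy'
  rw [← hc _ hy, Function.comp_apply, (extChartAt (𝓡 n) q).left_inv hy']

theorem eq_of_mfderiv_eq_zero [PreconnectedSpace P] {F : Type*} [NormedAddCommGroup F]
    [NormedSpace ℝ F] {h : P → F} (hd : MDifferentiable (𝓡 n) 𝓘(ℝ, F) h)
    (h0 : ∀ q v, mfderiv (𝓡 n) 𝓘(ℝ, F) h q v = 0) (p q : P) : h p = h q :=
  (isLocallyConstant_of_mfderiv_eq_zero hd h0).apply_eq_of_isPreconnected isPreconnected_univ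
    trivial trivial

end Curves

end

noncomputable section

/-! ### The symmetry algebras -/

/-- The algebras of values of the Maurer-Cartan form, space-like case. -/
def spaceLikeMat (ε a b c : ℝ) : Mat5 :=
  !![0, ε * a, ε * b, 0, 0;
     a, 0, -c, ε / 3 * a, ε / 3 * b;
     b, c, 0, -(ε / 3 * b), ε / 3 * a;
     0, a, -b, 0, -(2 * c);
     0, b, a, 2 * c, 0]

/-- The algebra of values of the Maurer-Cartan form, time-like case. -/
def timeLikeMat (a b c : ℝ) : Mat5 :=
  !![0, b, a, 0, 0;
     a, c, 0, 2 / 3 * b, 0;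
     b, 0, -c, 0, 2 / 3 * a;
     0, a, 0, 2 * c, 0;
     0, 0, b, 0, -(2 * c)]

/-- The linear relations between the Maurer-Cartan forms of a 3-adapted frame field, space-like
case. -/
structure SpaceLikeRel (ε : ℝ) (X : Mat5) : Prop where
  h00 : X 0 0 = 0
  h30 : X 3 0 = 0
  h40 : X 4 0 = 0
  h01 : X 0 1 = ε * X 1 0
  h02 : X 0 2 = ε * X 2 0
  h31 : X 3 1 = X 1 0
  h32 : X 3 2 = -X 2 0
  h41 : X 4 1 = X 2 0
  h42 : X 4 2 = X 1 0
  h03 : X 0 3 = 0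
  h04 : X 0 4 = 0

/-- The linear relations between the Maurer-Cartan forms of a 3-adapted frame field, time-like
case. -/
structure TimeLikeRel (X : Mat5) : Prop where
  h00 : X 0 0 = 0
  h30 : X 3 0 = 0
  h40 : X 4 0 = 0
  h01 : X 0 1 = X 2 0
  h02 : X 0 2 = X 1 0
  h31 : X 3 1 = X 1 0
  h32 : X 3 2 = 0
  h41 : X 4 1 = 0
  h42 : X 4 2 = X 2 0
  h03 : X 0 3 = 0
  h04 : X 0 4 = 0

/-- Coordinates on a 3-dimensional space of matrices. -/
theorem exists_dual_of_finrank_eq_three {V : Submodule ℝ Mat5} (hV : Module.finrank ℝ V = 3)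
    (k : Fin 5 × Fin 5) (h : ∀ X ∈ V, X 1 0 = 0 → X 2 0 = 0 → X k.1 k.2 = 0 → X = 0) :
    (∀ a b c : ℝ, ∃ X ∈ V, X 1 0 = a ∧ X 2 0 = b ∧ X k.1 k.2 = c) ∧
    ∀ X ∈ V, ∀ Y ∈ V, X 1 0 = Y 1 0 → X 2 0 = Y 2 0 → X k.1 k.2 = Y k.1 k.2 → X = Y := by
  have h2 : ∀ X ∈ V, ∀ Y ∈ V, X 1 0 = Y 1 0 → X 2 0 = Y 2 0 → X k.1 k.2 = Y k.1 k.2 → X = Y := by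
    intro X hX Y hY e1 e2 e3
    exact sub_eq_zero.1 (h _ (V.sub_mem hX hY) (by simp [e1]) (by simp [e2]) (by simp [e3]))
  refine ⟨?_, h2⟩
  let T : Mat5 →ₗ[ℝ] (Fin 3 → ℝ) := LinearMap.pi
    ![Matrix.entryLinearMap ℝ ℝ 1 0, Matrix.entryLinearMap ℝ ℝ 2 0,
      Matrix.entryLinearMap ℝ ℝ k.1 k.2]
  have hinj : Function.Injective (T.domRestrict V) := by
    rintro ⟨X, hX⟩ ⟨Y, hY⟩ e
    exact Subtype.ext (h2 X hX Y hY (congrFun e 0) (congrFun e 1) (congrFun e 2))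
  have hsurj := (LinearMap.injective_iff_surjective_of_finrank_eq_finrank
    (by rw [hV]; simp)).1 hinj
  intro a b c
  obtain ⟨⟨X, hX⟩, e⟩ := hsurj ![a, b, c]
  exact ⟨X, hX, congrFun e 0, congrFun e 1, congrFun e 2⟩

/-- An argument by weights of the isotropy group SO(2). Brackets with its generator Z kill every
unknown entry that cannot pair equivariantly with (a, b). What survives is a two-parameter coupling
of the normal plane to the tangent plane, and the bracket of the two tangential directions fixes it
to ε/3. -/
theorem mem_iff_spaceLikeMat {V : Submodule ℝ Mat5} (hV : Module.finrank ℝ V = 3) {ε : ℝ}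
    (hrel : ∀ X ∈ V, SpaceLikeRel ε X)
    (hker : ∀ X ∈ V, X 1 0 = 0 → X 2 0 = 0 → ∃ c, X = spaceLikeMat ε 0 0 c)
    (hbr : ∀ X ∈ V, ∀ Y ∈ V, X * Y - Y * X ∈ V) (X : Mat5) :
    X ∈ V ↔ ∃ a b c, X = spaceLikeMat ε a b c := by
  obtain ⟨hex, hext⟩ := exists_dual_of_finrank_eq_three hV (2, 1) (by
    intro X hX h1 h2 h3
    obtain ⟨c, rfl⟩ := hker X hX h1 h2
    have : c = 0 := by simpa [spaceLikeMat] using h3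
    subst this
    ext i j
    fin_cases i <;> fin_cases j <;> simp [spaceLikeMat])
  obtain ⟨Z, hZ, z1, z2, z3⟩ := hex 0 0 1
  obtain ⟨A, hA, a1, a2, a3⟩ := hex 1 0 0
  obtain ⟨B, hB, b1, b2, b3⟩ := hex 0 1 0
  dsimp only at a3 b3 z3 hext
  obtain ⟨c, rfl⟩ := hker Z hZ z1 z2
  obtain rfl : c = 1 := by simpa [spaceLikeMat] using z3
  -- Coefficients are entries. Applied to a bracket, this turns bracket closure into polynomial
  -- equations in the unknown entries of A and B.
  have hcomb : ∀ Y ∈ V, Y = Y 1 0 • A + Y 2 0 • B + Y 2 1 • spaceLikeMat ε 0 0 1 := by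
    intro Y hY
    refine hext _ hY _ (V.add_mem (V.add_mem (V.smul_mem _ hA) (V.smul_mem _ hB))
      (V.smul_mem _ hZ)) ?_ ?_ ?_
    · simp [a1, b1, z1]
    · simp [a2, b2, z2]
    · simp [a3, b3, z3]
  obtain ⟨ra, rb⟩ := And.intro (hrel A hA) (hrel B hB)
  -- Brackets with Z give linear equations: all blocks except the one with rows 1, 2 and columns 3,
  -- 4 become known.
  have h1 := fun i j => congrFun (congrFun (hcomb _ (hbr _ hZ _ hA)) i) j
  have h2 := fun i j => congrFun (congrFun (hcomb _ (hbr _ hZ _ hB)) i) j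
  simp only [spaceLikeMat, Matrix.sub_apply, Matrix.add_apply, Matrix.smul_apply, smul_eq_mul,
    Matrix.mul_apply, Fin.sum_univ_five, a1, a2, a3, b1, b2, b3] at h1 h2
  obtain ⟨A00, A30, A40, A01, A02, A31, A32, A41, A42, A03, A04⟩ := ra
  obtain ⟨B00, B30, B40, B01, B02, B31, B32, B41, B42, B03, B04⟩ := rb
  simp only [Fin.forall_fin_succ, IsEmpty.forall_iff, and_true] at h1 h2
  simp [A00, A30, A40, A01, A02, A31, A32, A41, A42, A03, A04, a1, a2, a3, B00, B30, B40, B01, B02, B31, B32, B41, B42, B03, B04, b1, b2, b3] at h1 h2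
  obtain ⟨⟨p1, p2, p3, p4⟩, ⟨p5, p6, p7⟩, ⟨-, p8, p9⟩, -, p10, p11⟩ := h1
  obtain ⟨⟨q1, q2, q3, q4⟩, ⟨q5, q6, q7⟩, ⟨-, q8, q9⟩, -, q10, q11⟩ := h2
  have A11 : A 1 1 = 0 := by linarith
  have A22 : A 2 2 = 0 := by linarith
  have B12 : B 1 2 = 0 := by linarith
  have B11 : B 1 1 = 0 := by linarith
  have B22 : B 2 2 = 0 := by linarith
  have A12 : A 1 2 = 0 := by linarith
  have A33 : A 3 3 = 0 := by linarith
  have A44 : A 4 4 = 0 := by linarith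
  have A34 : A 3 4 = 0 := by linarith
  have A43 : A 4 3 = 0 := by linarith
  have B33 : B 3 3 = 0 := by linarith
  have B44 : B 4 4 = 0 := by linarith
  have B34 : B 3 4 = 0 := by linarith
  have B43 : B 4 3 = 0 := by linarith
  -- The remaining block is fixed by the bracket of A and B, combined with the equations left over
  -- from the previous brackets.
  have h3 := fun i j => congrFun (congrFun (hcomb _ (hbr _ hA _ hB)) i) j
  simp only [spaceLikeMat, Matrix.sub_apply, Matrix.add_apply, Matrix.smul_apply, smul_eq_mul,
    Matrix.mul_apply, Fin.sum_univ_five, a1, a2, a3, b1, b2, b3] at h3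
  simp only [Fin.forall_fin_succ, IsEmpty.forall_iff, and_true] at h3
  simp [A00, A30, A40, A01, A02, A31, A32, A41, A42, A03, A04, a1, a2, a3, B00, B30, B40, B01,
    B02, B31, B32, B41, B42, B03, B04, b1, b2, b3, A11, A22, B12, B11, B22, A12, A33, A44, A34,
    A43, B33, B44, B34, B43] at h3
  obtain ⟨-, ⟨r1, r2⟩, r3, ⟨r4, r5⟩, r6, r7⟩ := h3
  have A14 : A 1 4 = 0 := by linarith
  have A23 : A 2 3 = 0 := by linarith
  have B13 : B 1 3 = 0 := by linarith
  have B24 : B 2 4 = 0 := by linarith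
  have A13 : A 1 3 = ε / 3 := by linarith
  have A24 : A 2 4 = ε / 3 := by linarith
  have B14 : B 1 4 = ε / 3 := by linarith
  have B23 : B 2 3 = -(ε / 3) := by linarith
  have eA : A = spaceLikeMat ε 1 0 0 := by
    ext i j
    fin_cases i <;> fin_cases j <;> simp [spaceLikeMat,
      A00, A30, A40, A01, A02, A31, A32, A41, A42, A03, A04,
      A11, A12, A22, A13, A14, A23, A24, A33, A34, A43, A44, a1, a2, a3]
  have eB : B = spaceLikeMat ε 0 1 0 := by
    ext i j
    fin_cases i <;> fin_cases j <;> simp [spaceLikeMat,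
      B00, B30, B40, B01, B02, B31, B32, B41, B42, B03, B04,
      B11, B12, B22, B13, B14, B23, B24, B33, B34, B43, B44, b1, b2, b3]
  have key : ∀ a b c, spaceLikeMat ε a b c = a • A + b • B + c • spaceLikeMat ε 0 0 1 := by
    intro a b c
    rw [eA, eB]
    ext i j
    fin_cases i <;> fin_cases j <;> simp [spaceLikeMat] <;> ring
  constructor
  · intro hX
    exact ⟨_, _, _, (hcomb X hX).trans (key _ _ _).symm⟩
  · rintro ⟨a, b, c, rfl⟩
    rw [key]
    exact V.add_mem (V.add_mem (V.smul_mem _ hA) (V.smul_mem _ hB)) (V.smul_mem _ hZ)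

/-- Here Z is diagonal with weights 0, 1, -1, 2, -2. Closure under bracketing with Z makes A
homogeneous of weight 1 and B of weight -1. The only entries then left free, `A 2 4` and `B 1 3`,
are determined by the bracket of A and B. -/
theorem mem_iff_timeLikeMat {V : Submodule ℝ Mat5} (hV : Module.finrank ℝ V = 3)
    (hrel : ∀ X ∈ V, TimeLikeRel X)
    (hker : ∀ X ∈ V, X 1 0 = 0 → X 2 0 = 0 → ∃ c, X = timeLikeMat 0 0 c)
    (hbr : ∀ X ∈ V, ∀ Y ∈ V, X * Y - Y * X ∈ V) (X : Mat5) :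
    X ∈ V ↔ ∃ a b c, X = timeLikeMat a b c := by
  obtain ⟨hex, hext⟩ := exists_dual_of_finrank_eq_three hV (1, 1) (by
    intro X hX h1 h2 h3
    obtain ⟨c, rfl⟩ := hker X hX h1 h2
    have : c = 0 := by simpa [timeLikeMat] using h3
    subst this
    ext i j
    fin_cases i <;> fin_cases j <;> simp [timeLikeMat])
  obtain ⟨Z, hZ, z1, z2, z3⟩ := hex 0 0 1
  obtain ⟨A, hA, a1, a2, a3⟩ := hex 1 0 0
  obtain ⟨B, hB, b1, b2, b3⟩ := hex 0 1 0
  dsimp only at a3 b3 z3 hext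
  obtain ⟨c, rfl⟩ := hker Z hZ z1 z2
  obtain rfl : c = 1 := by simpa [timeLikeMat] using z3
  have hcomb : ∀ Y ∈ V, Y = Y 1 0 • A + Y 2 0 • B + Y 1 1 • timeLikeMat 0 0 1 := by
    intro Y hY
    refine hext _ hY _ (V.add_mem (V.add_mem (V.smul_mem _ hA) (V.smul_mem _ hB))
      (V.smul_mem _ hZ)) ?_ ?_ ?_
    · simp [a1, b1, z1]
    · simp [a2, b2, z2]
    · simp [a3, b3, z3]
  obtain ⟨A00, A30, A40, A01, A02, A31, A32, A41, A42, A03, A04⟩ := hrel A hA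
  obtain ⟨B00, B30, B40, B01, B02, B31, B32, B41, B42, B03, B04⟩ := hrel B hB
  have h1 := fun i j => congrFun (congrFun (hcomb _ (hbr _ hZ _ hA)) i) j
  have h2 := fun i j => congrFun (congrFun (hcomb _ (hbr _ hZ _ hB)) i) j
  simp only [timeLikeMat, Matrix.sub_apply, Matrix.add_apply, Matrix.smul_apply, smul_eq_mul,
    Matrix.mul_apply, Fin.sum_univ_five, a1, a2, a3, b1, b2, b3] at h1 h2
  simp only [Fin.forall_fin_succ, IsEmpty.forall_iff, and_true] at h1 h2
  simp [A00, A30, A40, A01, A02, A31, A32, A41, A42, A03, A04, a1, a2, a3, B00, B30, B40, B01,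
    B02, B31, B32, B41, B42, B03, B04, b1, b2, b3] at h1 h2
  obtain ⟨⟨A12, A13, A14⟩, ⟨p1, p2, p3, -⟩, ⟨-, p5, p6⟩, p7, p8⟩ := h1
  obtain ⟨⟨q1, -, q3⟩, ⟨B21, B22, B23, B24⟩, ⟨q5, q6⟩, -, q7, q8⟩ := h2
  have A21 : A 2 1 = 0 := by linarith
  have A22 : A 2 2 = 0 := by linarith
  have A23 : A 2 3 = 0 := by linarith
  have A33 : A 3 3 = 0 := by linarith
  have A34 : A 3 4 = 0 := by linarith
  have A43 : A 4 3 = 0 := by linarith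
  have A44 : A 4 4 = 0 := by linarith
  have B12 : B 1 2 = 0 := by linarith
  have B14 : B 1 4 = 0 := by linarith
  have B33 : B 3 3 = 0 := by linarith
  have B34 : B 3 4 = 0 := by linarith
  have B43 : B 4 3 = 0 := by linarith
  have B44 : B 4 4 = 0 := by linarith
  have h3 := fun i j => congrFun (congrFun (hcomb _ (hbr _ hA _ hB)) i) j
  simp only [timeLikeMat, Matrix.sub_apply, Matrix.add_apply, Matrix.smul_apply, smul_eq_mul,
    Matrix.mul_apply, Fin.sum_univ_five, a1, a2, a3, b1, b2, b3] at h3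
  simp only [Fin.forall_fin_succ, IsEmpty.forall_iff, and_true] at h3
  simp [A00, A30, A40, A01, A02, A31, A32, A41, A42, A03, A04, a1, a2, a3, B00, B30, B40, B01,
    B02, B31, B32, B41, B42, B03, B04, b1, b2, b3, A12, A13, A14, A21, A22, A23, A33, A34, A43,
    A44, B12, B14, B21, B22, B23, B24, B33, B34, B43, B44] at h3
  obtain ⟨r1, r2, r3⟩ := h3
  have A24 : A 2 4 = 2 / 3 := by linarith
  have B13 : B 1 3 = 2 / 3 := by linarith
  have eA : A = timeLikeMat 1 0 0 := by
    ext i j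
    fin_cases i <;> fin_cases j <;> simp [timeLikeMat,
      A00, A30, A40, A01, A02, A31, A32, A41, A42, A03, A04,
      A12, A22, A13, A14, A23, A24, A33, A34, A43, A44, A21, a1, a2, a3]
  have eB : B = timeLikeMat 0 1 0 := by
    ext i j
    fin_cases i <;> fin_cases j <;> simp [timeLikeMat,
      B00, B30, B40, B01, B02, B31, B32, B41, B42, B03, B04,
      B12, B22, B13, B14, B23, B24, B33, B34, B43, B44, B21, b1, b2, b3]
  have key : ∀ a b c, timeLikeMat a b c = a • A + b • B + c • timeLikeMat 0 0 1 := by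
    intro a b c
    rw [eA, eB]
    ext i j
    fin_cases i <;> fin_cases j <;> simp [timeLikeMat] <;> ring
  constructor
  · intro hX
    exact ⟨_, _, _, (hcomb X hX).trans (key _ _ _).symm⟩
  · rintro ⟨a, b, c, rfl⟩
    rw [key]
    exact V.add_mem (V.add_mem (V.smul_mem _ hA) (V.smul_mem _ hB)) (V.smul_mem _ hZ)

end

noncomputable section

attribute [local instance] Matrix.linftyOpNormedRing Matrix.linftyOpNormedAlgebra

/-! ### Tangent vectors of the structure groups -/

theorem hasDerivAt_entry {A : ℝ → Mat5} {A' : Mat5} {t : ℝ} (h : HasDerivAt A A' t)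
    (i j : Fin 5) : HasDerivAt (fun s => A s i j) (A' i j) t :=
  hasDerivAt_matrix_iff.1 h i j

/-- The curve is described by the pair cos θ, sin θ, that is by two of its own entries, so no
differentiable choice of θ(t) is needed. -/
theorem tangent_spaceLikeGroup (ε : ℝ) {K : ℝ → Mat5} {K' : Mat5} (hK : HasDerivAt K K' 0)
    (h1 : K 0 = 1) (hG : ∀ᶠ t in 𝓝 0, K t ∈ spaceLikeGroup) : ∃ c, K' = spaceLikeMat ε 0 0 c := by
  have ha := hasDerivAt_entry hK 1 1
  have hb := hasDerivAt_entry hK 2 1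
  have hG' : ∀ᶠ t in 𝓝 0, K t 1 1 ^ 2 + K t 2 1 ^ 2 = 1 ∧ K t =
      !![1, 0, 0, 0, 0;
        0, K t 1 1, -K t 2 1, 0, 0;
        0, K t 2 1, K t 1 1, 0, 0;
        0, 0, 0, K t 1 1 ^ 2 - K t 2 1 ^ 2, -(2 * K t 2 1 * K t 1 1);
        0, 0, 0, 2 * K t 2 1 * K t 1 1, K t 1 1 ^ 2 - K t 2 1 ^ 2] := by
    filter_upwards [hG] with t ht
    obtain ⟨θ, hθ⟩ := ht
    rw [← hθ]
    constructor
    · simp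
    · simp only [Real.cos_two_mul', Real.sin_two_mul]
      rfl
  -- Differentiating cos² + sin² = 1 at the identity.
  have hda : K' 1 1 = 0 := by
    have h2 : HasDerivAt (fun t => K t 1 1 ^ 2 + K t 2 1 ^ 2) 0 0 :=
      (hasDerivAt_const (0 : ℝ) (1 : ℝ)).congr_of_eventuallyEq (hG'.mono fun t h => h.1)
    have h3 := ((ha.pow 2).add (hb.pow 2)).unique h2
    simp [h1] at h3
    exact h3
  refine ⟨K' 2 1, ?_⟩
  have hM : HasDerivAt K (spaceLikeMat ε 0 0 (K' 2 1)) 0 := by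
    refine HasDerivAt.congr_of_eventuallyEq ?_ (hG'.mono fun t h => h.2)
    refine hasDerivAt_matrix_iff.2 ?_
    have hc := ((ha.pow 2).sub (hb.pow 2))
    have hs := ((hb.const_mul 2).mul ha)
    simp [h1, hda] at hc hs
    rw [hda] at ha
    intro i j
    fin_cases i <;> fin_cases j <;> simp [spaceLikeMat] <;>
      first
      | exact hasDerivAt_const _ _
      | exact ha
      | exact hb
      | exact hb.neg
      | exact hc
      | exact hs
      | exact hs.neg
  exact hK.unique hM

/-- As in the rotation case, the diagonal entries replace the parameter l, and their product being 1
makes their derivatives opposite at the identity. -/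
theorem tangent_timeLikeGroup {K : ℝ → Mat5} {K' : Mat5} (hK : HasDerivAt K K' 0)
    (h1 : K 0 = 1) (hG : ∀ᶠ t in 𝓝 0, K t ∈ timeLikeGroup) : ∃ c, K' = timeLikeMat 0 0 c := by
  have ha := hasDerivAt_entry hK 1 1
  have hb := hasDerivAt_entry hK 2 2
  have hG' : ∀ᶠ t in 𝓝 0, K t 1 1 * K t 2 2 = 1 ∧ K t =
      !![1, 0, 0, 0, 0;
        0, K t 1 1, 0, 0, 0;
        0, 0, K t 2 2, 0, 0;
        0, 0, 0, K t 1 1 ^ 2, 0;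
        0, 0, 0, 0, K t 2 2 ^ 2] := by
    filter_upwards [hG] with t ht
    obtain ⟨l, hl⟩ := ht
    rw [← hl]
    constructor
    · simp [← Real.exp_add]
    · have e1 : Real.exp (2 * l) = Real.exp l ^ 2 := by rw [← Real.exp_nat_mul]; simp
      have e2 : Real.exp (-(2 * l)) = Real.exp (-l) ^ 2 := by rw [← Real.exp_nat_mul]; simp
      simp only [e1, e2]
      rfl
  have hda : K' 2 2 = -K' 1 1 := by
    have h2 : HasDerivAt (fun t => K t 1 1 * K t 2 2) 0 0 :=
      (hasDerivAt_const (0 : ℝ) (1 : ℝ)).congr_of_eventuallyEq (hG'.mono fun t h => h.1)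
    have h3 := (ha.mul hb).unique h2
    simp [h1] at h3
    linarith
  refine ⟨K' 1 1, ?_⟩
  have hM : HasDerivAt K (timeLikeMat 0 0 (K' 1 1)) 0 := by
    refine HasDerivAt.congr_of_eventuallyEq ?_ (hG'.mono fun t h => h.2)
    refine hasDerivAt_matrix_iff.2 ?_
    have hc := ha.pow 2
    have hs := hb.pow 2
    simp [h1, hda] at hc hs
    rw [hda] at hb
    intro i j
    fin_cases i <;> fin_cases j <;> simp [timeLikeMat] <;>
      first
      | exact hasDerivAt_const _ _
      | exact ha
      | exact hb
      | exact hc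
      | exact hs
  exact hK.unique hM

/-! ### Maurer-Cartan forms of 1-adapted and 3-adapted frame fields -/

section Adapted

variable {M : Type*} [TopologicalSpace M] [ChartedSpace Plane M]

theorem frameMatrix_mfderiv {n : ℕ} {N : Type*} [TopologicalSpace N]
    [ChartedSpace (EuclideanSpace ℝ (Fin n)) N] {s : N → Frame} {x : N}
    (hs : LinearIndependent ℝ (s x)) (v : TangentSpace (𝓡 n) x) :
    frameMatrix (mfderiv (𝓡 n) 𝓘(ℝ, Frame) s x v) = frameMatrix (s x) * maurerCartan s x v := by
  rw [maurerCartan, ← mul_assoc, Matrix.mul_nonsing_inv _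
    ((Matrix.isUnit_iff_isUnit_det _).1 (isUnit_frameMatrix.2 hs)), one_mul]

theorem maurerCartan_eq_of {n : ℕ} {N : Type*} [TopologicalSpace N]
    [ChartedSpace (EuclideanSpace ℝ (Fin n)) N] {s : N → Frame} {x : N}
    (hs : LinearIndependent ℝ (s x)) {v : TangentSpace (𝓡 n) x} {A : Mat5}
    (h : frameMatrix (mfderiv (𝓡 n) 𝓘(ℝ, Frame) s x v) = frameMatrix (s x) * A) :
    maurerCartan s x v = A := by
  rw [maurerCartan, h, ← mul_assoc, Matrix.nonsing_inv_mul _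
    ((Matrix.isUnit_iff_isUnit_det _).1 (isUnit_frameMatrix.2 hs)), one_mul]

theorem IsOneAdapted.mdifferentiableAt {f : M → R5} {U : Set M} {s : M → Frame}
    (h : IsOneAdapted f U s) {x : M} (hx : x ∈ U) :
    MDifferentiableAt (𝓡 2) 𝓘(ℝ, Frame) s x :=
  (h.2.1.contMDiffAt (h.1.mem_nhds hx)).mdifferentiableAt (by simp)

theorem mfderiv_frame_apply {n : ℕ} {N : Type*} [TopologicalSpace N]
    [ChartedSpace (EuclideanSpace ℝ (Fin n)) N] {s : N → Frame} {f : N → R5} {x : N} {j : Fin 5}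
    (hs : MDifferentiableAt (𝓡 n) 𝓘(ℝ, Frame) s x) (hf : (fun y => s y j) =ᶠ[𝓝 x] f)
    (v : TangentSpace (𝓡 n) x) :
    mfderiv (𝓡 n) 𝓘(ℝ, R5) f x v = (mfderiv (𝓡 n) 𝓘(ℝ, Frame) s x v : Frame) j := by
  have h1 := ((ContinuousLinearMap.proj (R := ℝ) (φ := fun _ : Fin 5 => R5)
    j).hasFDerivAt.hasMFDerivAt.comp x hs.hasMFDerivAt).congr_of_eventuallyEq hf.symm
  rw [h1.mfderiv]
  rfl

/-- The forms `ω^k_0`, `k = 0, 3, 4`, of a 1-adapted frame field vanish, and `ω^1_0, ω^2_0` are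
coordinates on the tangent plane. -/
theorem IsOneAdapted.maurerCartan_zero {f : M → R5} {U : Set M} {s : M → Frame}
    (h : IsOneAdapted f U s) {x : M} (hx : x ∈ U) (v : TangentSpace (𝓡 2) x) :
    (maurerCartan s x v 0 0 = 0 ∧ maurerCartan s x v 3 0 = 0 ∧ maurerCartan s x v 4 0 = 0) ∧
    @Eq R5 (mfderiv (𝓡 2) 𝓘(ℝ, R5) f x v)
      (maurerCartan s x v 1 0 • s x 1 + maurerCartan s x v 2 0 • s x 2) := by
  obtain ⟨hli, h0, hspan⟩ := h.2.2 x hx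
  have hd := mfderiv_frame_apply (h.mdifferentiableAt hx) (f := f) (j := 0)
    (by filter_upwards [h.1.mem_nhds hx] with y hy using (h.2.2 y hy).2.1) v
  have hmem : (mfderiv (𝓡 2) 𝓘(ℝ, R5) f x v : R5) ∈
      (Submodule.span ℝ {s x 1, s x 2} : Set R5) := by
    rw [hspan]
    exact ⟨v, rfl⟩
  have hm := frameMatrix_mfderiv hli v
  generalize (mfderiv (𝓡 2) 𝓘(ℝ, R5) f x v : R5) = w at hd hmem ⊢
  generalize (mfderiv (𝓡 2) 𝓘(ℝ, Frame) s x v : Frame) = S' at hd hm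
  generalize maurerCartan s x v = Y at hm ⊢
  obtain ⟨a, b, hab⟩ := Submodule.mem_span_pair.1 hmem
  -- Both sides expand the differential of e₀ = f in the frame, once by Ω and once by tangency to
  -- span(e₁, e₂).
  have hsum : ∑ i, Y i 0 • s x i = ∑ i, (![0, a, b, 0, 0] : Fin 5 → ℝ) i • s x i := by
    have h3 : ∑ i, Y i 0 • s x i = S' 0 := by
      funext i
      have := congrFun (congrFun hm i) 0
      rw [Matrix.mul_apply] at this
      change S' 0 i = _ at this
      simpa [frameMatrix_apply, mul_comm] using this.symm
    rw [h3, ← hd, ← hab]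
    simp [Fin.sum_univ_five]
  have hc : ∀ i, Y i 0 = (![0, a, b, 0, 0] : Fin 5 → ℝ) i := by
    have h5 := Fintype.linearIndependent_iff.1 hli
      (fun i => Y i 0 - (![0, a, b, 0, 0] : Fin 5 → ℝ) i)
      (by simp only [sub_smul, Finset.sum_sub_distrib, hsum, sub_self])
    exact fun i => sub_eq_zero.1 (h5 i)
  have h1 : Y 1 0 = a := hc 1
  have h2 : Y 2 0 = b := hc 2
  exact ⟨⟨hc 0, hc 3, hc 4⟩, by rw [← hab, h1, h2]⟩

theorem IsThreeAdaptedSpaceLike.rel {f : M → R5} {U : Set M} {s : M → Frame}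
    (h : IsThreeAdaptedSpaceLike f U s) : ∃ ε : ℝ, (ε = 1 ∨ ε = -1) ∧
      ∀ x ∈ U, ∀ v : TangentSpace (𝓡 2) x, SpaceLikeRel ε (maurerCartan s x v) := by
  obtain ⟨⟨h1, ε, hε, h2⟩, h3⟩ := h
  refine ⟨ε, hε, fun x hx v => ?_⟩
  obtain ⟨⟨a0, a3, a4⟩, -⟩ := h1.maurerCartan_zero hx v
  obtain ⟨c3, c4, c0⟩ := h2 x hx
  have c := And.intro (And.intro (c3 v 0) (c3 v 1)) (And.intro (And.intro (c4 v 0) (c4 v 1))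
    (And.intro (c0 v 0) (c0 v 1)))
  simp [tangIdx] at c
  exact ⟨a0, a3, a4, c.2.2.1, c.2.2.2, c.1.1, c.1.2, c.2.1.1, c.2.1.2, (h3 x hx v).1, (h3 x hx v).2⟩

theorem IsThreeAdaptedTimeLike.rel {f : M → R5} {U : Set M} {s : M → Frame}
    (h : IsThreeAdaptedTimeLike f U s) :
      ∀ x ∈ U, ∀ v : TangentSpace (𝓡 2) x, TimeLikeRel (maurerCartan s x v) := by
  obtain ⟨⟨h1, h2⟩, h3⟩ := h
  intro x hx v
  obtain ⟨⟨a0, a3, a4⟩, -⟩ := h1.maurerCartan_zero hx v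
  obtain ⟨c3, c4, c0⟩ := h2 x hx
  have c := And.intro (And.intro (c3 v 0) (c3 v 1)) (And.intro (And.intro (c4 v 0) (c4 v 1))
    (And.intro (c0 v 0) (c0 v 1)))
  simp [tangIdx] at c
  exact ⟨a0, a3, a4, c.2.2.1, c.2.2.2, c.1.1, c.1.2, c.2.1.1, c.2.1.2, (h3 x hx v).1, (h3 x hx v).2⟩

end Adapted

/-! ### The Maurer-Cartan form of a bundle of 3-adapted frames -/

section Bundle

variable {M : Type*} [TopologicalSpace M] [ChartedSpace Plane M]
variable {P : Type*} [TopologicalSpace P] [ChartedSpace (EuclideanSpace ℝ (Fin 3)) P]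
  [IsManifold (𝓡 3) ∞ P]

/-- The Maurer-Cartan form of the bundle is that of a local section plus a multiple of the
infinitesimal generator of the structure group. -/
theorem exists_maurerCartan_eq {G : Set Mat5} {Z : ℝ → Mat5}
    (hGZ : ∀ (K : ℝ → Mat5) (K' : Mat5), HasDerivAt K K' 0 → K 0 = 1 →
      (∀ᶠ t in 𝓝 0, K t ∈ G) → ∃ c, K' = Z c)
    {f : M → R5} {π : P → M} {e : P → Frame} (hπ : ContMDiff (𝓡 3) (𝓡 2) ∞ π)
    (he : ContMDiff (𝓡 3) 𝓘(ℝ, Frame) ∞ e) {q : P} {U : Set M} {s : M → Frame}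
    (hs : IsOneAdapted f U s) (hq : π q ∈ U) (hsq : s (π q) = e q)
    (hg : ∀ p, π p ∈ U → ∃ g ∈ G, frameMatrix (e p) = frameMatrix (s (π p)) * g)
    (v : TangentSpace (𝓡 3) q) :
    ∃ c, maurerCartan e q v =
      maurerCartan s (π q) (mfderiv (𝓡 3) (𝓡 2) π q v) + Z c := by
  obtain ⟨γ, h0, hc, hγ⟩ := exists_curve q v
  have hsm := hs.mdifferentiableAt hq
  have hπm : MDifferentiableAt (𝓡 3) (𝓡 2) π q := hπ.mdifferentiableAt (by simp)
  have hE := hγ e (he.mdifferentiableAt (by simp))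
  have hS := hγ (s ∘ π) (hsm.comp q hπm)
  have hcomp : (mfderiv (𝓡 3) 𝓘(ℝ, Frame) (s ∘ π) q v : Frame) =
      mfderiv (𝓡 2) 𝓘(ℝ, Frame) s (π q) (mfderiv (𝓡 3) (𝓡 2) π q v) :=
    mfderiv_comp_apply q hsm hπm v
  rw [hcomp] at hS
  have hE' := hE.frameMat
  have hS' := hS.frameMat
  have hli := (hs.2.2 _ hq).1
  have hu : IsUnit (frameMatrix (s (π q))) := isUnit_frameMatrix.2 hli
  -- The curve s⁻¹e lies in the structure group and starts at 1. Its velocity is the difference of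
  -- the two Maurer–Cartan forms.
  have hK := (hS'.matrixInv (by simpa [h0] using hu)).mul hE'
  have hev : ∀ᶠ t in 𝓝 (0 : ℝ), π (γ t) ∈ U := by
    have : ContinuousAt (fun t => π (γ t)) 0 :=
      ContinuousAt.comp (by rw [h0]; exact hπ.continuous.continuousAt) hc
    exact this (hs.1.mem_nhds (by simpa only [h0] using hq))
  have hdet : IsUnit (frameMatrix (s (π q))).det := (Matrix.isUnit_iff_isUnit_det _).1 hu
  obtain ⟨c, hcc⟩ := hGZ _ _ hK
    (by
      simp only [Pi.mul_apply, Function.comp_apply, h0, hsq]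
      rw [← hsq]
      exact Matrix.nonsing_inv_mul _ hdet)
    (by
      filter_upwards [hev] with t ht
      obtain ⟨g, hgG, hge⟩ := hg _ ht
      have h4 : IsUnit (frameMatrix (s (π (γ t)))).det :=
        (Matrix.isUnit_iff_isUnit_det _).1 (isUnit_frameMatrix.2 (hs.2.2 _ ht).1)
      simp only [Pi.mul_apply, Function.comp_apply, hge]
      rwa [← mul_assoc, Matrix.nonsing_inv_mul _ h4, one_mul])
  refine ⟨c, ?_⟩
  rw [← hcc]
  simp only [maurerCartan, Function.comp_apply, h0, hsq]
  have h5 : (frameMatrix (e q))⁻¹ * frameMatrix (e q) = 1 := by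
    rw [← hsq]
    exact Matrix.nonsing_inv_mul _ hdet
  rw [neg_mul, mul_assoc (_ * _), h5, mul_one]
  abel

/-- The Maurer-Cartan form of an immersed bundle of frames is injective. -/
theorem eq_zero_of_maurerCartan_eq_zero {f : M → R5} (hf : IsCentroaffineImmersion f)
    {ι : P → M × Frame} (hι : ContMDiff (𝓡 3) ((𝓡 2).prod 𝓘(ℝ, Frame)) ∞ ι)
    (hinj : ∀ q, Function.Injective (mfderiv (𝓡 3) ((𝓡 2).prod 𝓘(ℝ, Frame)) ι q))
    {q : P} {U : Set M} {s : M → Frame} (hs : IsOneAdapted f U s) (hq : (ι q).1 ∈ U)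
    (hsq : s (ι q).1 = (ι q).2) {v : TangentSpace (𝓡 3) q} {Z : Mat5} (hZ1 : Z 1 0 = 0)
    (hZ2 : Z 2 0 = 0)
    (hv : maurerCartan (fun p => (ι p).2) q v = maurerCartan s (ι q).1
      (mfderiv (𝓡 3) (𝓡 2) (fun p => (ι p).1) q v) + Z) :
    (maurerCartan (fun p => (ι p).2) q v 1 0 = 0 →
      maurerCartan (fun p => (ι p).2) q v 2 0 = 0 →
      maurerCartan (fun p => (ι p).2) q v = Z) ∧
    (maurerCartan (fun p => (ι p).2) q v = 0 → v = 0) := by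
  have hπ : MDifferentiableAt (𝓡 3) (𝓡 2) (fun p => (ι p).1) q :=
    (contMDiff_fst.comp hι).mdifferentiableAt (by simp)
  have he : MDifferentiableAt (𝓡 3) 𝓘(ℝ, Frame) (fun p => (ι p).2) q :=
    (contMDiff_snd.comp hι).mdifferentiableAt (by simp)
  have hli := (hs.2.2 _ hq).1
  -- The vertical correction Z does not affect ω¹₀ and ω²₀, so their vanishing means that the
  -- projection of v to the surface is zero.
  have key : maurerCartan (fun p => (ι p).2) q v 1 0 = 0 →
      maurerCartan (fun p => (ι p).2) q v 2 0 = 0 →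
      mfderiv (𝓡 3) (𝓡 2) (fun p => (ι p).1) q v = 0 := by
    intro h1 h2
    rw [hv, Matrix.add_apply, hZ1, add_zero] at h1
    rw [hv, Matrix.add_apply, hZ2, add_zero] at h2
    have h3 := (hs.maurerCartan_zero hq (mfderiv (𝓡 3) (𝓡 2) (fun p => (ι p).1) q v)).2
    rw [h1, h2, zero_smul, zero_smul, add_zero] at h3
    exact (hf.2 _).1 (h3.trans (map_zero _).symm)
  refine ⟨fun h1 h2 => ?_, fun h => ?_⟩
  · rw [hv, key h1 h2]
    simp only [maurerCartan, map_zero, add_eq_right]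
    exact mul_zero _
  · have h1 := key (by rw [h]; rfl) (by rw [h]; rfl)
    have h2 := frameMatrix_mfderiv (s := fun p => (ι p).2) (hsq ▸ hli) v
    rw [h, mul_zero] at h2
    have h3 : mfderiv (𝓡 3) 𝓘(ℝ, Frame) (fun p => (ι p).2) q v = 0 :=
      frameMatrix_injective h2
    refine hinj q ?_
    have h4 : mfderiv (𝓡 3) ((𝓡 2).prod 𝓘(ℝ, Frame)) ι q =
        (mfderiv (𝓡 3) (𝓡 2) (fun p => (ι p).1) q).prod
          (mfderiv (𝓡 3) 𝓘(ℝ, Frame) (fun p => (ι p).2) q) := mfderiv_prodMk hπ he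
    rw [map_zero, h4]
    exact Prod.ext h1 h3

/-- Collects all that is needed about Ω on the bundle. The relations hold for a local section and
are linear, and the vertical term `spaceLikeMat ε 0 0 c` satisfies them as well, so they pass to the
bundle. -/
theorem maurerCartan_spaceLikeBundle {f : M → R5} (hf : IsCentroaffineImmersion f)
    {F : Set (M × Frame)} (hF : IsFrameBundle (IsThreeAdaptedSpaceLike f) spaceLikeGroup F)
    {ι : P → M × Frame} (hι : ContMDiff (𝓡 3) ((𝓡 2).prod 𝓘(ℝ, Frame)) ∞ ι)
    (hinj : ∀ q, Function.Injective (mfderiv (𝓡 3) ((𝓡 2).prod 𝓘(ℝ, Frame)) ι q))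
    (hr : Set.range ι = F) (q : P) :
    LinearIndependent ℝ (ι q).2 ∧ (ι q).2 0 = f (ι q).1 ∧ ∃ ε : ℝ, (ε = 1 ∨ ε = -1) ∧
      ∀ v : TangentSpace (𝓡 3) q, SpaceLikeRel ε (maurerCartan (fun p => (ι p).2) q v) ∧
        (maurerCartan (fun p => (ι p).2) q v 1 0 = 0 →
          maurerCartan (fun p => (ι p).2) q v 2 0 = 0 →
          ∃ c, maurerCartan (fun p => (ι p).2) q v = spaceLikeMat ε 0 0 c) ∧
        (maurerCartan (fun p => (ι p).2) q v = 0 → v = 0) := by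
  have hmem : ∀ p, ι p ∈ F := fun p => hr ▸ Set.mem_range_self p
  obtain ⟨U, s, hqU, hs, hsq, hsF⟩ := hF.1 _ (hmem q)
  obtain ⟨ε, hε, hrel⟩ := hs.rel
  have h0 := hs.1.1.2.2 _ hqU
  refine ⟨hsq ▸ h0.1, hsq ▸ h0.2.1, ε, hε, fun v => ?_⟩
  obtain ⟨c, hc⟩ := exists_maurerCartan_eq (fun K K' => tangent_spaceLikeGroup ε)
    (contMDiff_fst.comp hι) (contMDiff_snd.comp hι) hs.1.1 hqU hsq
    (fun p hp => (hF.2.2 _ _ _ (hsF _ hp)).1 (hmem p)) v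
  obtain ⟨h1, h2⟩ := eq_zero_of_maurerCartan_eq_zero hf hι hinj hs.1.1 hqU hsq
    (by simp [spaceLikeMat]) (by simp [spaceLikeMat]) hc
  refine ⟨?_, fun a b => ⟨c, h1 a b⟩, h2⟩
  have hY := hrel _ hqU (mfderiv (𝓡 3) (𝓡 2) (fun p => (ι p).1) q v)
  change maurerCartan (fun p => (ι p).2) q v = maurerCartan s (ι q).1
      (mfderiv (𝓡 3) (𝓡 2) (fun p => (ι p).1) q v) + _ at hc
  rw [hc]
  obtain ⟨Y00, Y30, Y40, Y01, Y02, Y31, Y32, Y41, Y42, Y03, Y04⟩ := hY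
  constructor <;> simp [spaceLikeMat, *]

/-- The same transfer from a local section to the bundle, with vertical term `timeLikeMat 0 0 c`. -/
theorem maurerCartan_timeLikeBundle {f : M → R5} (hf : IsCentroaffineImmersion f)
    {F : Set (M × Frame)} (hF : IsFrameBundle (IsThreeAdaptedTimeLike f) timeLikeGroup F)
    {ι : P → M × Frame} (hι : ContMDiff (𝓡 3) ((𝓡 2).prod 𝓘(ℝ, Frame)) ∞ ι)
    (hinj : ∀ q, Function.Injective (mfderiv (𝓡 3) ((𝓡 2).prod 𝓘(ℝ, Frame)) ι q))
    (hr : Set.range ι = F) (q : P) :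
    LinearIndependent ℝ (ι q).2 ∧ (ι q).2 0 = f (ι q).1 ∧
      ∀ v : TangentSpace (𝓡 3) q, TimeLikeRel (maurerCartan (fun p => (ι p).2) q v) ∧
        (maurerCartan (fun p => (ι p).2) q v 1 0 = 0 →
          maurerCartan (fun p => (ι p).2) q v 2 0 = 0 →
          ∃ c, maurerCartan (fun p => (ι p).2) q v = timeLikeMat 0 0 c) ∧
        (maurerCartan (fun p => (ι p).2) q v = 0 → v = 0) := by
  have hmem : ∀ p, ι p ∈ F := fun p => hr ▸ Set.mem_range_self p
  obtain ⟨U, s, hqU, hs, hsq, hsF⟩ := hF.1 _ (hmem q)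
  have hrel := hs.rel
  have h0 := hs.1.1.2.2 _ hqU
  refine ⟨hsq ▸ h0.1, hsq ▸ h0.2.1, fun v => ?_⟩
  obtain ⟨c, hc⟩ := exists_maurerCartan_eq (fun K K' => tangent_timeLikeGroup)
    (contMDiff_fst.comp hι) (contMDiff_snd.comp hι) hs.1.1 hqU hsq
    (fun p hp => (hF.2.2 _ _ _ (hsF _ hp)).1 (hmem p)) v
  obtain ⟨h1, h2⟩ := eq_zero_of_maurerCartan_eq_zero hf hι hinj hs.1.1 hqU hsq
    (by simp [timeLikeMat]) (by simp [timeLikeMat]) hc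
  refine ⟨?_, fun a b => ⟨c, h1 a b⟩, h2⟩
  have hY := hrel _ hqU (mfderiv (𝓡 3) (𝓡 2) (fun p => (ι p).1) q v)
  change maurerCartan (fun p => (ι p).2) q v = maurerCartan s (ι q).1
      (mfderiv (𝓡 3) (𝓡 2) (fun p => (ι p).1) q v) + _ at hc
  rw [hc]
  obtain ⟨Y00, Y30, Y40, Y01, Y02, Y31, Y32, Y41, Y42, Y03, Y04⟩ := hY
  constructor <;> simp [timeLikeMat, *]

end Bundle

end

noncomputable section

attribute [local instance] Matrix.linftyOpNormedRing Matrix.linftyOpNormedAlgebra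

/-! ### Frame-valued maps whose Maurer-Cartan form takes values in a fixed space -/

/-- Difference quotients lie in V, and a finite-dimensional V is closed. -/
theorem HasDerivAt.mem_submodule {F : Type*} [NormedAddCommGroup F] [NormedSpace ℝ F]
    [FiniteDimensional ℝ F] (V : Submodule ℝ F) {y : ℝ → F} {y' : F} {t : ℝ}
    (h : HasDerivAt y y' t) (hV : ∀ᶠ s in 𝓝 t, y s ∈ V) : y' ∈ V := by
  have h1 := hasDerivAt_iff_tendsto_slope.1 h
  have ht : y t ∈ V := hV.self_of_nhds
  refine V.closed_of_finiteDimensional.mem_of_tendsto h1 ?_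
  filter_upwards [nhdsWithin_le_nhds hV] with s hs
  exact V.smul_mem _ (V.sub_mem hs ht)

/-! ### Local theory: flatness of Ω and integral curves of left-invariant fields -/

section Flat

variable {E : Type*} [NormedAddCommGroup E] [NormedSpace ℝ E] {a : E → Frame} {O : Set E}
  {V : Submodule ℝ Mat5}

/-- The structure equation dΩ = -Ω∧Ω: the derivative of a V-valued form is V-valued, and
antisymmetrizing it leaves only the commutator because the Hessian of a is symmetric. -/
theorem commutator_mem_of_maurerCartan_mem (hO : IsOpen O) (ha : ContDiffOn ℝ ∞ a O)
    (hli : ∀ x ∈ O, LinearIndependent ℝ (a x))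
    (hV : ∀ x ∈ O, ∀ w, (frameMatrix (a x))⁻¹ * frameMatrix (fderiv ℝ a x w) ∈ V)
    {x : E} (hx : x ∈ O) (u w : E) :
    ((frameMatrix (a x))⁻¹ * frameMatrix (fderiv ℝ a x u)) *
        ((frameMatrix (a x))⁻¹ * frameMatrix (fderiv ℝ a x w)) -
      ((frameMatrix (a x))⁻¹ * frameMatrix (fderiv ℝ a x w)) *
        ((frameMatrix (a x))⁻¹ * frameMatrix (fderiv ℝ a x u)) ∈ V := by
  have hax : ContDiffAt ℝ ∞ a x := ha.contDiffAt (hO.mem_nhds hx)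
  have hd1 : DifferentiableAt ℝ a x := hax.differentiableAt (by simp)
  have hd2 : DifferentiableAt ℝ (fderiv ℝ a) x :=
    (hax.fderiv_right (m := 1) (by norm_cast)).differentiableAt (by simp)
  have hsymm : IsSymmSndFDerivAt ℝ a x :=
    hax.isSymmSndFDerivAt (by simp [minSmoothness_of_isRCLikeNormedField]; norm_cast)
  -- The derivative of Ω(w) in the direction u, by the product rule.
  have key : ∀ u w : E, -((frameMatrix (a x))⁻¹ * frameMatrix (fderiv ℝ a x u) *
      (frameMatrix (a x))⁻¹) * frameMatrix (fderiv ℝ a x w) +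
      (frameMatrix (a x))⁻¹ * frameMatrix (fderiv ℝ (fderiv ℝ a) x u w) ∈ V := by
    intro u w
    have hl : HasDerivAt (fun t : ℝ => x + t • u) u 0 := by
      simpa using ((hasDerivAt_id (0 : ℝ)).smul_const u).const_add x
    have hx0 : x + (0 : ℝ) • u = x := by simp
    have h1 : HasDerivAt (fun t : ℝ => a (x + t • u)) (fderiv ℝ a x u) 0 :=
      HasFDerivAt.comp_hasDerivAt (0 : ℝ) (by rw [hx0]; exact hd1.hasFDerivAt) hl
    have h2 : HasDerivAt (fun t : ℝ => fderiv ℝ a (x + t • u)) (fderiv ℝ (fderiv ℝ a) x u) 0 :=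
      HasFDerivAt.comp_hasDerivAt (0 : ℝ) (by rw [hx0]; exact hd2.hasFDerivAt) hl
    have h3 : HasDerivAt (fun t : ℝ => fderiv ℝ a (x + t • u) w)
        (fderiv ℝ (fderiv ℝ a) x u w) 0 := by
      simpa using h2.clm_apply (hasDerivAt_const (0 : ℝ) w)
    have h4 := (h1.frameMat.matrixInv (by
      simpa [hx0] using isUnit_frameMatrix.2 (hli x hx))).mul h3.frameMat
    have h5 := HasDerivAt.mem_submodule V h4 (by
      have : ∀ᶠ t in 𝓝 (0 : ℝ), x + t • u ∈ O :=
        hl.continuousAt.eventually_mem (by rw [hx0]; exact hO.mem_nhds hx)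
      filter_upwards [this] with t ht using hV _ ht w)
    simpa only [hx0] using h5
  have h6 := V.sub_mem (key w u) (key u w)
  rw [hsymm.eq w u] at h6
  convert h6 using 1
  noncomm_ring

/-- A vector field ξ with da(ξ) = aX exists because Ω maps each tangent space isomorphically onto V;
a C¹ version of it is integrated by Picard–Lindelöf. -/
theorem exists_integral_curve [FiniteDimensional ℝ E] (hO : IsOpen O)
    (ha : ContDiffOn ℝ ∞ a O) (hdim : Module.finrank ℝ V = Module.finrank ℝ E)
    (hV : ∀ x ∈ O, ∀ w, ∃ X ∈ V, frameMatrix (fderiv ℝ a x w) = frameMatrix (a x) * X)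
    (hli : ∀ x ∈ O, LinearIndependent ℝ (a x))
    {x : E} (hx : x ∈ O) (hinj : Function.Injective (fderiv ℝ a x)) {X : Mat5} (hX : X ∈ V) :
    ∃ α : ℝ → E, α 0 = x ∧ ∃ r > 0, ∀ t, |t| < r → α t ∈ O ∧
      HasDerivAt (fun s => frameMatrix (a (α s))) (frameMatrix (a (α t)) * X) t := by
  have : CompleteSpace E := FiniteDimensional.complete ℝ E
  have hax : ContDiffAt ℝ ∞ a x := ha.contDiffAt (hO.mem_nhds hx)
  obtain ⟨L, hL⟩ := LinearMap.exists_leftInverse_of_injective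
    (fderiv ℝ a x : E →ₗ[ℝ] Frame) (LinearMap.ker_eq_bot.2 hinj)
  let Λ : Frame →L[ℝ] E := LinearMap.toContinuousLinearMap L
  let β : E → E →L[ℝ] E := fun y => Λ.comp (fderiv ℝ a y)
  have hβx : β x = ContinuousLinearEquiv.refl ℝ E := by
    ext v
    exact LinearMap.congr_fun hL v
  have hβ : ContDiffAt ℝ 1 β x :=
    contDiffAt_const.clm_comp (hax.fderiv_right (m := 1) (by norm_cast))
  let ψ : E → Frame := fun y => columns (frameMatrix (a y) * X)
  have hψ : ContDiffAt ℝ 1 ψ x := by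
    have h1 : ContDiffAt ℝ 1 a x := hax.of_le (by norm_cast)
    have h2 : ContDiff ℝ 1 (fun e : Frame => columns (frameMatrix e * X)) :=
      (LinearMap.toContinuousLinearMap (E := Frame) (F' := Frame)
        { toFun := fun e => columns (frameMatrix e * X)
          map_add' := fun e e' => by
            funext j i
            simp [columns, Matrix.mul_apply, frameMatrix_apply, add_mul, Finset.sum_add_distrib]
          map_smul' := fun c e => by
            funext j i
            simp [columns, Matrix.mul_apply, frameMatrix_apply, Finset.mul_sum, mul_assoc]
            }).contDiff
    exact h2.contDiffAt.comp x h1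
  let ξ : E → E := fun y => ContinuousLinearMap.inverse (β y) (Λ (ψ y))
  have hξ : ContDiffAt ℝ 1 ξ x := by
    refine ContDiffAt.clm_apply ?_ (Λ.contDiff.contDiffAt.comp x hψ)
    exact ContDiffAt.comp (g := ContinuousLinearMap.inverse) x
      (by rw [hβx]; exact contDiffAt_map_inverse _) hβ
  obtain ⟨α, h0, r, hr, hα⟩ :=
    hξ.exists_forall_mem_closedBall_exists_eq_forall_mem_Ioo_hasDerivAt₀ 0
  have hgood : ∀ᶠ y in 𝓝 x, y ∈ O ∧ (β y).IsInvertible := by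
    have h1 : ∀ᶠ B in 𝓝 (β x), B.IsInvertible := by
      rw [hβx]
      exact ContinuousLinearEquiv.nhds (ContinuousLinearEquiv.refl ℝ E)
    exact (show ∀ᶠ y in 𝓝 x, y ∈ O from hO.mem_nhds hx).and (hβ.continuousAt.eventually h1)
  have hαc : ContinuousAt α 0 := (hα 0 (by constructor <;> linarith)).continuousAt
  obtain ⟨r', hr', hball⟩ := Metric.eventually_nhds_iff.1
    (hαc.eventually (by rw [h0]; exact hgood))
  refine ⟨α, h0, min r r', lt_min hr hr', fun t ht => ?_⟩
  obtain ⟨hr1, hr2⟩ := lt_min_iff.1 ht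
  obtain ⟨hO', hinv⟩ := hball (show dist t 0 < r' by simpa using hr2)
  refine ⟨hO', ?_⟩
  have hd := hα t (by rw [abs_lt] at hr1; constructor <;> linarith)
  have had : HasFDerivAt a (fderiv ℝ a (α t)) (α t) :=
    ((ha.contDiffAt (hO.mem_nhds hO')).differentiableAt (by simp)).hasFDerivAt
  have h3 := (had.comp_hasDerivAt t hd).frameMat
  have hu := isUnit_frameMatrix.2 (hli _ hO')
  choose T hT using hV _ hO'
  have hβinj : Function.Injective (β (α t)) := hinv.injective
  have hdinj : Function.Injective (fderiv ℝ a (α t)) := fun v w h => hβinj (congrArg Λ h)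
  -- Returning to the original equation: Ω at the point is injective into V, hence onto by equality
  -- of dimensions, so aX really lies in the range of da and the square system has lost nothing.
  let T' : E →ₗ[ℝ] V :=
    { toFun := fun v => ⟨T v, (hT v).1⟩
      map_add' := fun v w => Subtype.ext (hu.mul_left_cancel (by
        change _ = _ * (T v + T w)
        rw [mul_add, ← (hT _).2, ← (hT _).2, ← (hT _).2, map_add]
        rfl))
      map_smul' := fun c w => Subtype.ext (hu.mul_left_cancel (by
        change _ = _ * (c • T w)
        rw [mul_smul_comm, ← (hT _).2, ← (hT _).2, map_smul]
        rfl)) }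
  have hT'inj : Function.Injective T' := fun v w h => hdinj (frameMatrix_injective (by
    rw [(hT v).2, (hT w).2, show T v = T w from congrArg Subtype.val h]))
  obtain ⟨w, hw⟩ := (LinearMap.injective_iff_surjective_of_finrank_eq_finrank hdim.symm).1
    hT'inj ⟨X, hX⟩
  have hw' : fderiv ℝ a (α t) w = ψ (α t) := frameMatrix_injective (by
    rw [(hT w).2, show T w = X from congrArg Subtype.val hw]
    rfl)
  have hξw : ξ (α t) = w := by
    change ContinuousLinearMap.inverse (β (α t)) (Λ (ψ (α t))) = w
    rw [← hw']
    exact hinv.inverse_apply_eq.2 rfl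
  rw [hξw, hw'] at h3
  exact h3

end Flat

theorem DifferentiableAt.matrixMulVec {E : Type*} [NormedAddCommGroup E] [NormedSpace ℝ E]
    {A : E → Mat5} {y : E → R5} {x : E} (hA : DifferentiableAt ℝ A x)
    (hy : DifferentiableAt ℝ y x) : DifferentiableAt ℝ (fun z => A z *ᵥ y z) x := by
  rw [differentiableAt_pi] at hy ⊢
  intro i
  simp only [Matrix.mulVec, dotProduct]
  refine DifferentiableAt.fun_sum fun j _ => DifferentiableAt.mul ?_ (hy j)
  exact (LinearMap.toContinuousLinearMap
      (Matrix.entryLinearMap ℝ ℝ i j)).differentiableAt.comp x hA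

/-! ### Global consequences: brackets, left translations, conserved equivariants -/

section Manifold

variable {P : Type*} [TopologicalSpace P] [ChartedSpace (EuclideanSpace ℝ (Fin 3)) P]
  [IsManifold (𝓡 3) ∞ P] {e : P → Frame} {V : Submodule ℝ Mat5}

theorem hasDerivAt_frameMatrix_comp (hli : ∀ q, LinearIndependent ℝ (e q)) {q : P}
    {v : TangentSpace (𝓡 3) q} {γ : ℝ → P}
    (h : HasDerivAt (F := Frame) (e ∘ γ) (mfderiv (𝓡 3) 𝓘(ℝ, Frame) e q v) 0) :
    HasDerivAt (fun t => frameMatrix (e (γ t))) (frameMatrix (e q) * maurerCartan e q v) 0 := by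
  rw [← frameMatrix_mfderiv (hli q)]
  exact h.frameMat

/-- The frame-valued map in the preferred chart at a point. -/
theorem maurerCartan_chart (he : ContMDiff (𝓡 3) 𝓘(ℝ, Frame) ∞ e)
    (hli : ∀ q, LinearIndependent ℝ (e q)) (hV : ∀ q v, maurerCartan (n := 3) e q v ∈ V) (q : P) :
    ContDiffOn ℝ ∞ (e ∘ (extChartAt (𝓡 3) q).symm) (extChartAt (𝓡 3) q).target ∧
    ∀ x ∈ (extChartAt (𝓡 3) q).target, ∀ w, ∃ X ∈ V,
      frameMatrix (fderiv ℝ (e ∘ (extChartAt (𝓡 3) q).symm) x w) =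
        frameMatrix ((e ∘ (extChartAt (𝓡 3) q).symm) x) * X := by
  constructor
  · intro x hx
    exact ((he _).comp x (contMDiffAt_extChartAt_symm q hx)).contDiffAt.contDiffWithinAt
  · intro x hx w
    obtain ⟨v, hv⟩ := fderiv_comp_extChartAt_symm (he.mdifferentiable (by simp)) q hx w
    exact ⟨_, hV _ v, (congrArg frameMatrix hv).trans (frameMatrix_mfderiv (hli _) _)⟩

theorem commutator_mem (he : ContMDiff (𝓡 3) 𝓘(ℝ, Frame) ∞ e)
    (hli : ∀ q, LinearIndependent ℝ (e q)) (hV : ∀ q v, maurerCartan (n := 3) e q v ∈ V) {q : P}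
    (hsurj : ∀ X ∈ V, ∃ v, maurerCartan (n := 3) e q v = X) :
    ∀ X ∈ V, ∀ Y ∈ V, X * Y - Y * X ∈ V := by
  intro X hX Y hY
  obtain ⟨ha, haV⟩ := maurerCartan_chart he hli hV q
  have hval : ∀ X ∈ V, ∃ w, (frameMatrix ((e ∘ (extChartAt (𝓡 3) q).symm)
      (extChartAt (𝓡 3) q q)))⁻¹ * frameMatrix (fderiv ℝ (e ∘ (extChartAt (𝓡 3) q).symm)
      (extChartAt (𝓡 3) q q) w) = X := by
    intro X hX
    obtain ⟨v, rfl⟩ := hsurj X hX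
    refine ⟨mfderiv (𝓡 3) (𝓡 3) (extChartAt (𝓡 3) q) q v, ?_⟩
    · rw [← (mfderiv_eq_fderiv_comp_chart q (he.mdifferentiable (by simp) q)).2 v,
        Function.comp_apply, extChartAt_to_inv]
      rfl
  obtain ⟨u, rfl⟩ := hval X hX
  obtain ⟨w, rfl⟩ := hval Y hY
  refine commutator_mem_of_maurerCartan_mem (isOpen_extChartAt_target q) ha
    (fun x _ => hli _) (fun x hx w => ?_) (mem_extChartAt_target q) u w
  obtain ⟨X, hX, h⟩ := haV x hx w
  rwa [h, ← mul_assoc, Matrix.nonsing_inv_mul (frameMatrix ((e ∘ _) x))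
    ((Matrix.isUnit_iff_isUnit_det _).1 (isUnit_frameMatrix.2 (hli _))), one_mul]

/-- The left-invariant field of X, transported from a chart. Injectivity of the differential at q is
obtained by counting dimensions: the form maps a 3-dimensional tangent space onto the 3-dimensional
V. -/
theorem exists_integral_curve_frame (he : ContMDiff (𝓡 3) 𝓘(ℝ, Frame) ∞ e)
    (hli : ∀ q, LinearIndependent ℝ (e q)) (hV : ∀ q v, maurerCartan (n := 3) e q v ∈ V)
    (hdim : Module.finrank ℝ V = 3) {q : P}
    (hsurj : ∀ X ∈ V, ∃ v, maurerCartan (n := 3) e q v = X) {X : Mat5} (hX : X ∈ V) :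
    ∃ (γ : ℝ → P), γ 0 = q ∧ ∃ r > 0, ∀ t, |t| < r →
      HasDerivAt (fun s => frameMatrix (e (γ s))) (frameMatrix (e (γ t)) * X) t := by
  obtain ⟨ha, haV⟩ := maurerCartan_chart he hli hV q
  have hinj : Function.Injective (fderiv ℝ (e ∘ (extChartAt (𝓡 3) q).symm)
      (extChartAt (𝓡 3) q q)) := by
    choose T hT using haV _ (mem_extChartAt_target q)
    have hu := isUnit_frameMatrix.2 (hli ((extChartAt (𝓡 3) q).symm (extChartAt (𝓡 3) q q)))
    let T' : EuclideanSpace ℝ (Fin 3) →ₗ[ℝ] V :=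
      { toFun := fun v => ⟨T v, (hT v).1⟩
        map_add' := fun v w => Subtype.ext (hu.mul_left_cancel (by
          change frameMatrix ((e ∘ _) _) * _ = frameMatrix ((e ∘ _) _) * (T v + T w)
          rw [mul_add, ← (hT _).2, ← (hT _).2, ← (hT _).2, map_add]
          rfl))
        map_smul' := fun c w => Subtype.ext (hu.mul_left_cancel (by
          change frameMatrix ((e ∘ _) _) * _ = frameMatrix ((e ∘ _) _) * (c • T w)
          rw [mul_smul_comm, ← (hT _).2, ← (hT _).2, map_smul]
          rfl)) }
    have hT's : Function.Surjective T' := by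
      rintro ⟨X, hX⟩
      obtain ⟨v, rfl⟩ := hsurj X hX
      refine ⟨mfderiv (𝓡 3) (𝓡 3) (extChartAt (𝓡 3) q) q v,
        Subtype.ext (hu.mul_left_cancel ((hT _).2.symm.trans ?_))⟩
      rw [← (mfderiv_eq_fderiv_comp_chart q (he.mdifferentiable (by simp) q)).2 v,
        extChartAt_to_inv]
      exact frameMatrix_mfderiv (hli _) _
    have hT'i := (LinearMap.injective_iff_surjective_of_finrank_eq_finrank
      (by rw [hdim]; simp)).2 hT's
    intro v w h
    refine hT'i (Subtype.ext (hu.mul_left_cancel ?_))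
    exact (hT v).2.symm.trans ((congrArg frameMatrix h).trans (hT w).2)
  obtain ⟨α, h0, r, hr, h⟩ := exists_integral_curve (isOpen_extChartAt_target q) ha
    (by rw [hdim]; simp) haV (fun _ _ => hli _) (mem_extChartAt_target q) hinj hX
  exact ⟨fun t => (extChartAt (𝓡 3) q).symm (α t), by simp only [h0, extChartAt_to_inv], r, hr,
    fun t ht => (h t ht).2⟩

/-- A map which preserves the Maurer-Cartan form is given by a left translation. -/
theorem exists_left_translation [PreconnectedSpace P] (he : ContMDiff (𝓡 3) 𝓘(ℝ, Frame) ∞ e)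
    (hli : ∀ q, LinearIndependent ℝ (e q)) {φ : P ≃ₘ^∞⟮𝓡 3, 𝓡 3⟯ P} (hφ : IsSymmetry e φ)
    (p q : P) :
    frameMatrix (e (φ p)) * (frameMatrix (e p))⁻¹ =
      frameMatrix (e (φ q)) * (frameMatrix (e q))⁻¹ := by
  have hφm : MDifferentiable (𝓡 3) (𝓡 3) φ := φ.contMDiff.mdifferentiable (by simp)
  have hem : MDifferentiable (𝓡 3) 𝓘(ℝ, Frame) e := he.mdifferentiable (by simp)
  have hd : MDifferentiable (𝓡 3) 𝓘(ℝ, Frame)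
      (fun p => columns (frameMatrix (e (φ p)) * (frameMatrix (e p))⁻¹)) := by
    intro p
    have h1 : DifferentiableAt ℝ (fun x : Frame × Frame =>
        columns (frameMatrix x.1 * (frameMatrix x.2)⁻¹)) (e (φ p), e p) := by
      refine columnsL.differentiableAt.comp (e (φ p), e p) (DifferentiableAt.mul ?_ ?_)
      · exact frameMatrixL.differentiableAt.comp _ differentiableAt_fst
      · exact DifferentiableAt.comp (e (φ p), e p)
          (differentiableAt_matrixInv (isUnit_frameMatrix.2 (hli p)))
          (frameMatrixL.differentiableAt.comp _ differentiableAt_snd)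
    exact h1.mdifferentiableAt.comp p (((hem _).comp p (hφm p)).prodMk_space (hem p))
  refine congrArg frameMatrix (eq_of_mfderiv_eq_zero hd (fun q v => ?_) p q)
  obtain ⟨γ, h0, -, hγ⟩ := exists_curve q v
  have h1 := hasDerivAt_frameMatrix_comp hli (hγ e (hem q))
  have h2 : HasDerivAt (fun t => frameMatrix (e (φ (γ t))))
      (frameMatrix (e (φ q)) * maurerCartan e q v) 0 := by
    have h3 := (hγ (e ∘ φ) ((hem _).comp q (hφm q))).frameMat
    rw [mfderiv_comp_apply q (hem _) (hφm q), frameMatrix_mfderiv (hli _), hφ q v] at h3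
    exact h3
  have h4 := h2.mul (h1.matrixInv (by rw [h0]; exact isUnit_frameMatrix.2 (hli q)))
  refine ((hγ _ (hd q)).unique h4.columns).trans (congrArg columns (?_ : _ = (0 : Mat5)))
  rw [h0]
  have hu := (Matrix.isUnit_iff_isUnit_det _).1 (isUnit_frameMatrix.2 (hli q))
  rw [← mul_assoc (frameMatrix (e q))⁻¹, Matrix.nonsing_inv_mul _ hu, one_mul]
  simp [mul_assoc]

/-- Equivariant maps are conserved along a frame-valued map. -/
theorem equivariant_eq_zero [PreconnectedSpace P] (he : ContMDiff (𝓡 3) 𝓘(ℝ, Frame) ∞ e)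
    (hli : ∀ q, LinearIndependent ℝ (e q)) (hV : ∀ q v, maurerCartan (n := 3) e q v ∈ V)
    {N : R5 → R5} (hN : Differentiable ℝ N)
    (hNV : ∀ X ∈ V, ∀ y, fderiv ℝ N y (X *ᵥ y) = X *ᵥ N y) (hN0 : N (Pi.single 0 1) = 0)
    (p q : P) : N ((frameMatrix (e q))⁻¹ *ᵥ e p 0) = 0 := by
  have hem : MDifferentiable (𝓡 3) 𝓘(ℝ, Frame) e := he.mdifferentiable (by simp)
  have hdet := fun q => (Matrix.isUnit_iff_isUnit_det _).1 (isUnit_frameMatrix.2 (hli q))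
  have hconst : ∀ w : R5, ∀ p q : P,
      frameMatrix (e p) *ᵥ N ((frameMatrix (e p))⁻¹ *ᵥ w) =
      frameMatrix (e q) *ᵥ N ((frameMatrix (e q))⁻¹ *ᵥ w) := by
    intro w
    have hd : MDifferentiable (𝓡 3) 𝓘(ℝ, R5)
        (fun p => frameMatrix (e p) *ᵥ N ((frameMatrix (e p))⁻¹ *ᵥ w)) := by
      intro p
      have h1 : DifferentiableAt ℝ (fun x : Frame =>
          frameMatrix x *ᵥ N ((frameMatrix x)⁻¹ *ᵥ w)) (e p) := by
        refine DifferentiableAt.matrixMulVec frameMatrixL.differentiableAt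
          (DifferentiableAt.comp (g := N) (e p) (hN _)
            (DifferentiableAt.matrixMulVec ?_ (differentiableAt_const _)))
        exact DifferentiableAt.comp (e p)
          (differentiableAt_matrixInv (isUnit_frameMatrix.2 (hli p)))
          frameMatrixL.differentiableAt
      exact h1.mdifferentiableAt.comp p (hem p)
    refine eq_of_mfderiv_eq_zero hd fun q v => ?_
    obtain ⟨γ, h0, -, hγ⟩ := exists_curve q v
    have h1 := hasDerivAt_frameMatrix_comp hli (hγ e (hem q))
    have h2 := (h1.matrixInv (by rw [h0]; exact isUnit_frameMatrix.2 (hli q))).matrixMulVec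
      (hasDerivAt_const (0 : ℝ) w)
    have h3 := HasFDerivAt.comp_hasDerivAt (0 : ℝ) (hN _).hasFDerivAt h2
    have h4 := (hγ _ (hd q)).unique (h1.matrixMulVec h3)
    rw [h4]
    simp only [h0, Matrix.mulVec_zero, add_zero]
    rw [← mul_assoc, Matrix.nonsing_inv_mul _ (hdet q), one_mul, Matrix.neg_mulVec,
      ← Matrix.mulVec_mulVec, ← Matrix.mulVec_mulVec, map_neg, Matrix.mulVec_neg,
      hNV _ (hV q v)]
    exact add_neg_cancel _
  -- For w = e₀(p) the coordinate vector at p is the first basis vector, where N vanishes, so the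
  -- constant is zero.
  have h1 := hconst (e p 0) p q
  have h2 : (frameMatrix (e p))⁻¹ *ᵥ e p 0 = Pi.single 0 1 := by
    have h3 : frameMatrix (e p) *ᵥ Pi.single 0 1 = e p 0 := by
      rw [Matrix.mulVec_single_one]
      rfl
    rw [← h3, Matrix.mulVec_mulVec, Matrix.nonsing_inv_mul _ (hdet p), Matrix.one_mulVec]
  rw [h2, hN0, Matrix.mulVec_zero] at h1
  have h3 := congrArg (fun y => (frameMatrix (e q))⁻¹ *ᵥ y) h1
  simpa [Matrix.mulVec_mulVec, Matrix.nonsing_inv_mul _ (hdet q)] using h3.symm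

end Manifold

end

noncomputable section

attribute [local instance] Matrix.linftyOpNormedRing Matrix.linftyOpNormedAlgebra

/-! ### Connectedness of homogeneous bundles -/

section Connected

variable {P : Type*} [TopologicalSpace P] [ChartedSpace (EuclideanSpace ℝ (Fin 3)) P]

/-- In this form the condition at q depends only on the germ of e ∘ φ, so it can be verified for a
map glued from pieces. -/
theorem isSymmetry_iff {e : P → Frame} (he : ContMDiff (𝓡 3) 𝓘(ℝ, Frame) ∞ e)
    (φ : P ≃ₘ^∞⟮𝓡 3, 𝓡 3⟯ P) :
    IsSymmetry e φ ↔ ∀ (q : P) (v : TangentSpace (𝓡 3) q),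
      (frameMatrix (e (φ q)))⁻¹ * frameMatrix (mfderiv (𝓡 3) 𝓘(ℝ, Frame) (e ∘ φ) q v) =
        maurerCartan e q v := by
  refine forall_congr' fun q => forall_congr' fun v => ?_
  rw [mfderiv_comp_apply q (he.mdifferentiable (by simp) _)
    (φ.contMDiff.mdifferentiable (by simp) q) v]
  rfl

variable {G : Type*} [Group G] [MulAction G P] [TopologicalSpace G]
  [ChartedSpace (EuclideanSpace ℝ (Fin 3)) G] [ContMDiffSMul (𝓡 3) (𝓡 3) ∞ G P]

theorem contMDiff_smul_left (g : G) : ContMDiff (𝓡 3) (𝓡 3) ∞ fun q : P => g • q :=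
  (contMDiff_smul (I := 𝓡 3) (I' := 𝓡 3) (G := G) (M := P) (n := ∞)).comp
    (contMDiff_const.prodMk contMDiff_id)

theorem contMDiff_smul_right (q : P) : ContMDiff (𝓡 3) (𝓡 3) ∞ fun g : G => g • q :=
  (contMDiff_smul (I := 𝓡 3) (I' := 𝓡 3) (G := G) (M := P) (n := ∞)).comp
    (contMDiff_id.prodMk contMDiff_const)

/-- The diffeomorphism given by the action of a group element. -/
def smulDiffeomorph (g : G) : P ≃ₘ^∞⟮𝓡 3, 𝓡 3⟯ P where
  toEquiv := MulAction.toPerm g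
  contMDiff_toFun := contMDiff_smul_left g
  contMDiff_invFun := contMDiff_smul_left g⁻¹

variable [IsManifold (𝓡 3) ∞ P]

/-- A symmetry may be replaced by the identity outside of a connected component. -/
theorem exists_smul_eq_of_mem_connectedComponent {e : P → Frame}
    (he : ContMDiff (𝓡 3) 𝓘(ℝ, Frame) ∞ e)
    (hG : ∀ φ : P ≃ₘ^∞⟮𝓡 3, 𝓡 3⟯ P, IsSymmetry e φ ↔ ∃ g : G, ∀ q, φ q = g • q)
    [MulAction.IsPretransitive G P] (q p : P) (hp : p ∈ connectedComponent q) :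
    ∃ k : G, k • q = p ∧ ∀ r ∉ connectedComponent q, k • r = r := by
  classical
  have : LocallyConnectedSpace P :=
    ChartedSpace.locallyConnectedSpace (EuclideanSpace ℝ (Fin 3)) P
  set A := connectedComponent q with hA
  have hAo : IsOpen A := isOpen_connectedComponent
  have hAc : IsOpen Aᶜ := isClosed_connectedComponent.isOpen_compl
  obtain ⟨g, hg⟩ := MulAction.exists_smul_eq G q p
  have hmap : ∀ h : G, h • q ∈ A → ∀ r ∈ A, h • r ∈ A := by
    intro h hh r hr
    have h1 : IsPreconnected ((fun x : P => h • x) '' A) :=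
      isPreconnected_connectedComponent.image _
        (contMDiff_smul_left h).continuous.continuousOn
    have h2 := h1.subset_connectedComponent ⟨q, mem_connectedComponent, rfl⟩
    rw [← connectedComponent_eq hh] at h2
    exact h2 ⟨r, hr, rfl⟩
  have hgA : ∀ r ∈ A, g • r ∈ A := hmap g (hg ▸ hp)
  have hgA' : ∀ r ∈ A, g⁻¹ • r ∈ A := by
    intro r hr
    have h1 : IsPreconnected ((fun x : P => g⁻¹ • x) '' A) :=
      isPreconnected_connectedComponent.image _
        (contMDiff_smul_left g⁻¹).continuous.continuousOn
    have h2 := h1.subset_connectedComponent (x := q) ⟨p, hp, by simp [← hg]⟩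
    exact h2 ⟨r, hr, rfl⟩
  have hsmooth : ∀ h : G, ContMDiff (𝓡 3) (𝓡 3) ∞ fun r : P => if r ∈ A then h • r else r := by
    intro h r
    by_cases hr : r ∈ A
    · refine (contMDiff_smul_left h r).congr_of_eventuallyEq ?_
      filter_upwards [hAo.mem_nhds hr] with x hx using if_pos hx
    · refine contMDiff_id.contMDiffAt.congr_of_eventuallyEq ?_
      filter_upwards [hAc.mem_nhds hr] with x hx using if_neg hx
  let φ : P ≃ₘ^∞⟮𝓡 3, 𝓡 3⟯ P :=
    { toFun := fun r => if r ∈ A then g • r else r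
      invFun := fun r => if r ∈ A then g⁻¹ • r else r
      left_inv := fun r => by
        by_cases hr : r ∈ A
        · simp [hr, hgA r hr]
        · simp [hr]
      right_inv := fun r => by
        by_cases hr : r ∈ A
        · simp [hr, hgA' r hr]
        · simp [hr]
      contMDiff_toFun := hsmooth g
      contMDiff_invFun := hsmooth g⁻¹ }
  have hφ : IsSymmetry e φ := by
    rw [isSymmetry_iff he]
    intro r v
    by_cases hr : r ∈ A
    · have h1 := (isSymmetry_iff he (smulDiffeomorph g)).1 ((hG _).2 ⟨g, fun _ => rfl⟩) r v
      have h2 : e ∘ φ =ᶠ[𝓝 r] e ∘ smulDiffeomorph g := by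
        filter_upwards [hAo.mem_nhds hr] with x hx
        exact congrArg e (if_pos hx)
      have h3 : e (φ r) = e (smulDiffeomorph g r) := h2.self_of_nhds
      rw [h2.mfderiv_eq, h3]
      exact h1
    · have h2 : e ∘ φ =ᶠ[𝓝 r] e := by
        filter_upwards [hAc.mem_nhds hr] with x hx
        exact congrArg e (if_neg hx)
      have h3 : e (φ r) = e r := h2.self_of_nhds
      rw [h2.mfderiv_eq, h3]
      rfl
  obtain ⟨k, hk⟩ := (hG φ).1 hφ
  refine ⟨k, ?_, fun r hr => ?_⟩
  · rw [← hk, ← hg]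
    exact if_pos mem_connectedComponent
  · rw [← hk]
    exact if_neg hr

variable [IsManifold (𝓡 3) ∞ G] [SecondCountableTopology G]

open Module in
/-- If the full group of symmetries of a 3-manifold is a transitive Lie group of dimension 3, then
the manifold is connected. -/
theorem preconnectedSpace_of_symmetries {e : P → Frame}
    (he : ContMDiff (𝓡 3) 𝓘(ℝ, Frame) ∞ e)
    (hG : ∀ φ : P ≃ₘ^∞⟮𝓡 3, 𝓡 3⟯ P, IsSymmetry e φ ↔ ∃ g : G, ∀ q, φ q = g • q)
    [MulAction.IsPretransitive G P] : PreconnectedSpace P := by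
  rw [preconnectedSpace_iff_connectedComponent]
  intro q₀
  by_contra hne
  obtain ⟨q₁, hq₁⟩ := (Set.ne_univ_iff_exists_notMem _).1 hne
  have hloc : LocallyConnectedSpace P :=
    ChartedSpace.locallyConnectedSpace (EuclideanSpace ℝ (Fin 3)) P
  have hdisj := connectedComponent_disjoint (x := q₀) (y := q₁) (fun h => hq₁ (by
    rw [h]
    exact mem_connectedComponent))
  -- Each factor moves one component and fixes the other pointwise, so the group acts transitively
  -- on pairs of points of the two components.
  have hsub : ∀ p₀ ∈ connectedComponent q₀, ∀ p₁ ∈ connectedComponent q₁,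
      ∃ g : G, g • q₀ = p₀ ∧ g • q₁ = p₁ := by
    intro p₀ h₀ p₁ h₁
    obtain ⟨k₀, a₀, b₀⟩ := exists_smul_eq_of_mem_connectedComponent he hG q₀ p₀ h₀
    obtain ⟨k₁, a₁, b₁⟩ := exists_smul_eq_of_mem_connectedComponent he hG q₁ p₁ h₁
    refine ⟨k₁ * k₀, ?_, ?_⟩
    · rw [mul_smul, a₀, b₁ _ (fun h => Set.disjoint_left.1 hdisj h₀ h)]
    · rw [mul_smul, b₀ _ hq₁, a₁]
  let E := EuclideanSpace ℝ (Fin 3)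
  let Φ : G → E × E := fun g => (extChartAt (𝓡 3) q₀ (g • q₀), extChartAt (𝓡 3) q₁ (g • q₁))
  let N : Set G := {g | g • q₀ ∈ (chartAt E q₀).source ∧ g • q₁ ∈ (chartAt E q₁).source}
  -- In a chart of the group the orbit map is C¹, hence locally Lipschitz, and does not raise
  -- Hausdorff dimension above 3. Second countability then passes this bound to all of N.
  have hΦ : ∀ g ∈ N, ∃ W ∈ 𝓝 g, dimH (Φ '' W) ≤ 3 := by
    intro g hg
    have h1 : ContMDiffAt (𝓡 3) 𝓘(ℝ, E × E) ∞ Φ g :=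
      ((contMDiffAt_extChartAt' hg.1).comp g (contMDiff_smul_right q₀ g)).prodMk_space
        ((contMDiffAt_extChartAt' hg.2).comp g (contMDiff_smul_right q₁ g))
    have h2 : ContDiffAt ℝ 1 (Φ ∘ (extChartAt (𝓡 3) g).symm) (extChartAt (𝓡 3) g g) := by
      have h3 := ContMDiffAt.comp (g := Φ) (extChartAt (𝓡 3) g g)
        (by rwa [extChartAt_to_inv])
        (contMDiffAt_extChartAt_symm g (mem_extChartAt_target g))
      exact h3.contDiffAt.of_le (by norm_cast)
    obtain ⟨K, t, ht, hK⟩ := h2.exists_lipschitzOnWith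
    refine ⟨(extChartAt (𝓡 3) g).source ∩ extChartAt (𝓡 3) g ⁻¹' t,
      Filter.inter_mem (extChartAt_source_mem_nhds g) ((continuousAt_extChartAt g) ht), ?_⟩
    calc dimH (Φ '' _) ≤ dimH ((Φ ∘ (extChartAt (𝓡 3) g).symm) '' t) := by
          refine dimH_mono ?_
          rintro _ ⟨x, ⟨hx, hxt⟩, rfl⟩
          exact ⟨_, hxt, by rw [Function.comp_apply, (extChartAt (𝓡 3) g).left_inv hx]⟩
      _ ≤ dimH t := hK.dimH_image_le
      _ ≤ dimH (Set.univ : Set E) := dimH_mono (Set.subset_univ _)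
      _ = 3 := by
        rw [Real.dimH_univ_eq_finrank]
        simp [E]
  choose! W hW hWd using hΦ
  obtain ⟨T, hTN, hT, hcov⟩ := TopologicalSpace.countable_cover_nhdsWithin
    (s := N) (f := W) (fun g hg => mem_nhdsWithin_of_mem_nhds (hW g hg))
  have hopen : ∀ q : P, extChartAt (𝓡 3) q ''
      (connectedComponent q ∩ (extChartAt (𝓡 3) q).source) ∈ 𝓝 (extChartAt (𝓡 3) q q) := by
    intro q
    rw [← map_extChartAt_nhds_of_boundaryless]
    exact Filter.image_mem_map (Filter.inter_mem
      (isOpen_connectedComponent.mem_nhds mem_connectedComponent) (extChartAt_source_mem_nhds q))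
  have hR := prod_mem_nhds (hopen q₀) (hopen q₁)
  have hR6 := Real.dimH_of_mem_nhds hR
  have hsubset : (extChartAt (𝓡 3) q₀ ''
      (connectedComponent q₀ ∩ (extChartAt (𝓡 3) q₀).source)) ×ˢ (extChartAt (𝓡 3) q₁ ''
      (connectedComponent q₁ ∩ (extChartAt (𝓡 3) q₁).source)) ⊆ ⋃ g ∈ T, Φ '' (N ∩ W g) := by
    rintro ⟨_, _⟩ ⟨⟨p₀, ⟨h₀, s₀⟩, rfl⟩, p₁, ⟨h₁, s₁⟩, rfl⟩
    obtain ⟨g, rfl, rfl⟩ := hsub p₀ h₀ p₁ h₁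
    rw [extChartAt_source] at s₀ s₁
    obtain ⟨t, ht, hgt⟩ := Set.mem_iUnion₂.1 (hcov (show g ∈ N from ⟨s₀, s₁⟩))
    exact Set.mem_iUnion₂.2 ⟨t, ht, g, ⟨⟨s₀, s₁⟩, hgt⟩, rfl⟩
  have h3 : dimH (⋃ g ∈ T, Φ '' (N ∩ W g)) ≤ 3 := by
    rw [dimH_bUnion hT]
    refine iSup₂_le fun g hg => ?_
    exact (dimH_mono (Set.image_mono Set.inter_subset_right)).trans (hWd g (hTN hg))
  -- The image contains a neighbourhood in a 6-dimensional space, so 6 ≤ 3.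
  have h6 := (dimH_mono hsubset).trans h3
  rw [hR6, finrank_prod] at h6
  simp at h6
  norm_num at h6

end Connected

/-! ### Homogeneous bundles are orbits -/

section Orbit

variable {P : Type*} [TopologicalSpace P] [ChartedSpace (EuclideanSpace ℝ (Fin 3)) P]
  [IsManifold (𝓡 3) ∞ P] {e : P → Frame} {V : Submodule ℝ Mat5}

/-- Solutions of linear differential equations given by the values of the Maurer-Cartan form stay
in the orbit. -/
theorem solution_mem_orbit (he : ContMDiff (𝓡 3) 𝓘(ℝ, Frame) ∞ e)
    (hli : ∀ q, LinearIndependent ℝ (e q)) (hV : ∀ q v, maurerCartan (n := 3) e q v ∈ V)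
    (hdim : Module.finrank ℝ V = 3) {q : P}
    (hsurj : ∀ X ∈ V, ∃ v, maurerCartan (n := 3) e q v = X)
    (hmul : ∀ p p', ∃ r, frameMatrix (e r) =
      frameMatrix (e p) * (frameMatrix (e q))⁻¹ * frameMatrix (e p'))
    {X : Mat5} (hX : X ∈ V) {y : ℝ → R5} (hy : ∀ s, HasDerivAt y (X *ᵥ y s) s)
    (h0 : ∃ p, frameMatrix (e q) *ᵥ y 0 = e p 0) (s : ℝ) :
    ∃ p, frameMatrix (e q) *ᵥ y s = e p 0 := by
  obtain ⟨γ, hγ0, r, hr, hγ⟩ := exists_integral_curve_frame he hli hV hdim hsurj hX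
  have hcol : ∀ p, frameMatrix (e p) *ᵥ Pi.single 0 1 = e p 0 := fun p => by
    rw [Matrix.mulVec_single_one]
    rfl
  have hdet := (Matrix.isUnit_iff_isUnit_det _).1 (isUnit_frameMatrix.2 (hli q))
  -- Along γ the frame satisfies E' = EX while y(s - t) has derivative -Xy, so the product is
  -- constant. This uses γ only for small t but any s.
  have hconst : ∀ s t, |t| < r →
      frameMatrix (e (γ t)) *ᵥ y (s - t) = frameMatrix (e q) *ᵥ y s := by
    intro s t ht
    have hd : ∀ t ∈ Metric.ball (0 : ℝ) r,
        HasDerivAt (fun t => frameMatrix (e (γ t)) *ᵥ y (s - t)) 0 t := by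
      intro t ht
      have h1 : HasDerivAt (fun t => y (s - t)) (-(X *ᵥ y (s - t))) t := by
        have h := HasDerivAt.scomp t (hy (s - t)) ((hasDerivAt_id t).const_sub s)
        rw [neg_one_smul] at h
        exact h
      have h2 := (hγ t (by simpa using ht)).matrixMulVec h1
      rw [← Matrix.mulVec_mulVec, Matrix.mulVec_neg, add_neg_cancel] at h2
      exact h2
    have h3 := Metric.isOpen_ball.is_const_of_deriv_eq_zero
      (convex_ball (0 : ℝ) r).isPreconnected
      (fun t ht => (hd t ht).differentiableAt.differentiableWithinAt)
      (fun t ht => (hd t ht).deriv) (show t ∈ Metric.ball (0 : ℝ) r by simpa using ht)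
      (Metric.mem_ball_self hr)
    simpa [hγ0] using h3
  -- The multiplication property moves the point reached at time s - t by the frame at γ(t). It
  -- replaces completeness of the left-invariant field: large times are reached by n steps of length
  -- s/n.
  have hstep : ∀ s t, |t| < r → (∃ p, frameMatrix (e q) *ᵥ y (s - t) = e p 0) →
      ∃ p, frameMatrix (e q) *ᵥ y s = e p 0 := by
    rintro s t ht ⟨p, hp⟩
    obtain ⟨p', hp'⟩ := hmul (γ t) p
    refine ⟨p', ?_⟩
    rw [← hcol p', hp', ← hconst s t ht, ← Matrix.mulVec_mulVec, hcol, ← hp, Matrix.mulVec_mulVec,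
      mul_assoc, Matrix.nonsing_inv_mul _ hdet, mul_one]
  obtain ⟨n, hn⟩ := exists_nat_gt (|s| / r)
  have hn0 : (0 : ℝ) < n := lt_of_le_of_lt (by positivity) hn
  have hsn : |s / n| < r := by
    rw [abs_div, abs_of_pos hn0, div_lt_comm₀ hn0 hr]
    exact hn
  have hall : ∀ k : ℕ, ∃ p, frameMatrix (e q) *ᵥ y (k * (s / n)) = e p 0 := by
    intro k
    induction k with
    | zero => simpa using h0
    | succ k ih =>
      refine hstep _ (s / n) hsn ?_
      convert ih using 5
      push_cast
      ring
  simpa [mul_div_cancel₀ s hn0.ne'] using hall n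

/-- A vector which is annihilated by all equivariant maps that annihilate the first basis vector. -/
def IsCentralizing (V : Submodule ℝ Mat5) (w : R5) : Prop :=
  ∀ N : R5 → R5, Differentiable ℝ N → (∀ X ∈ V, ∀ y, fderiv ℝ N y (X *ᵥ y) = X *ᵥ N y) →
    N (Pi.single 0 1) = 0 → N w = 0

/-- The criterion behind all three cases. The function c selects a sheet among the vectors
satisfying the equivariant equations; the two curve conditions reach every point of the model, first
along v and then along u. The linear map is e(q)⁻¹. -/
theorem glEquivalent_of_orbit [PreconnectedSpace P] (he : ContMDiff (𝓡 3) 𝓘(ℝ, Frame) ∞ e)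
    (hli : ∀ q, LinearIndependent ℝ (e q)) (hV : ∀ q v, maurerCartan (n := 3) e q v ∈ V)
    (hdim : Module.finrank ℝ V = 3) {q : P}
    (hsurj : ∀ X ∈ V, ∃ v, maurerCartan (n := 3) e q v = X)
    (hmul : ∀ p p', ∃ r, frameMatrix (e r) =
      frameMatrix (e p) * (frameMatrix (e q))⁻¹ * frameMatrix (e p'))
    {m : Plane → R5} (hm0 : m !₂[0, 0] = Pi.single 0 1)
    (hm1 : ∃ Y ∈ V, ∀ v, HasDerivAt (fun t => m !₂[0, t]) (Y *ᵥ m !₂[0, v]) v)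
    (hm2 : ∃ X ∈ V, ∀ v u, HasDerivAt (fun t => m !₂[t, v]) (X *ᵥ m !₂[u, v]) u)
    {c : R5 → ℝ} (hc : Continuous c) (hc0 : 0 < c (Pi.single 0 1))
    (hm : ∀ w, w ≠ 0 → IsCentralizing V w → c w ≠ 0 ∧ (0 < c w → w ∈ Set.range m)) :
    GLEquivalent (Set.range fun p => e p 0) (Set.range m) := by
  have hu := isUnit_frameMatrix.2 (hli q)
  have hdet := (Matrix.isUnit_iff_isUnit_det _).1 hu
  have hcol : ∀ p, frameMatrix (e p) *ᵥ Pi.single 0 1 = e p 0 := fun p => by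
    rw [Matrix.mulVec_single_one]
    rfl
  have hinv : ∀ w w', frameMatrix (e q) *ᵥ w = w' ↔ w = (frameMatrix (e q))⁻¹ *ᵥ w' := by
    intro w w'
    constructor
    · rintro rfl
      rw [Matrix.mulVec_mulVec, Matrix.nonsing_inv_mul _ hdet, Matrix.one_mulVec]
    · rintro rfl
      rw [Matrix.mulVec_mulVec, Matrix.mul_nonsing_inv _ hdet, Matrix.one_mulVec]
  have hcen : ∀ p, (frameMatrix (e q))⁻¹ *ᵥ e p 0 ≠ 0 ∧
      IsCentralizing V ((frameMatrix (e q))⁻¹ *ᵥ e p 0) := by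
    refine fun p => ⟨fun h => ?_, fun N hN hNV hN0 => equivariant_eq_zero he hli hV hN hNV hN0 p q⟩
    have h1 := (hinv 0 (e p 0)).2 h.symm
    rw [Matrix.mulVec_zero] at h1
    exact (hli p).ne_zero 0 h1.symm
  have hcont : Continuous fun p => c ((frameMatrix (e q))⁻¹ *ᵥ e p 0) :=
    hc.comp (continuous_const.matrix_mulVec ((continuous_apply 0).comp he.continuous))
  -- Intermediate values on the connected `P`: c is positive at q and never zero.
  have hpos : ∀ p, 0 < c ((frameMatrix (e q))⁻¹ *ᵥ e p 0) := by
    intro p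
    by_contra hp
    obtain ⟨p', hp'⟩ := mem_range_of_exists_le_of_exists_ge hcont ⟨p, not_lt.1 hp⟩
      ⟨q, by rw [← hcol q, Matrix.mulVec_mulVec, Matrix.nonsing_inv_mul _ hdet,
        Matrix.one_mulVec]; exact hc0.le⟩
    exact (hm _ (hcen p').1 (hcen p').2).1 hp'
  have hval : ((hu.unit⁻¹ : GL (Fin 5) ℝ) : Mat5) = (frameMatrix (e q))⁻¹ := by
    rw [Matrix.coe_units_inv, IsUnit.unit_spec]
  refine ⟨hu.unit⁻¹, Set.Subset.antisymm ?_ ?_⟩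
  · rintro _ ⟨_, ⟨p, rfl⟩, rfl⟩
    simp only [hval]
    exact (hm _ (hcen p).1 (hcen p).2).2 (hpos p)
  · rintro _ ⟨x, rfl⟩
    obtain ⟨Y, hY, hYm⟩ := hm1
    obtain ⟨X, hX, hXm⟩ := hm2
    have h1 := solution_mem_orbit he hli hV hdim hsurj hmul hY hYm
      ⟨q, by rw [hm0, hcol]⟩ (x 1)
    obtain ⟨p, hp⟩ := solution_mem_orbit he hli hV hdim hsurj hmul hX (hXm (x 1)) h1 (x 0)
    have hx : (!₂[x 0, x 1] : Plane) = x := by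
      ext i
      fin_cases i <;> rfl
    rw [hx] at hp
    refine ⟨_, ⟨p, rfl⟩, ?_⟩
    simp only [hval]
    exact ((hinv _ _).1 hp).symm

end Orbit

end

noncomputable section

attribute [local instance] Matrix.linftyOpNormedRing Matrix.linftyOpNormedAlgebra

/-! ### Quadratic models -/

/-- The `3 × 3` matrices. -/
abbrev Mat3 : Type := Matrix (Fin 3) (Fin 3) ℝ

/-- Coordinates on the symmetric `3 × 3` matrices modulo an involution `J`. -/
structure QuadraticModel where
  /-- the matrix of the invariant bilinear form -/
  J : Mat3
  /-- the coordinates of a symmetric matrix -/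
  q : Mat3 →ₗ[ℝ] R5
  /-- the matrix with given coordinates which is trace free with respect to `J` -/
  σ : R5 →ₗ[ℝ] Mat3
  J_mul_J : J * J = 1
  transpose_J : Jᵀ = J
  J_zero_zero : J 0 0 = 1
  q_J : q J = 0
  q_σ : ∀ v, q (σ v) = v
  transpose_σ : ∀ v, (σ v)ᵀ = σ v
  σ_q : ∀ S : Mat3, Sᵀ = S → σ (q S) = S - ((J * S).trace / 3) • J
  q_single : q (Matrix.single 0 0 1) = Pi.single 0 1

namespace QuadraticModel

variable (𝓜 : QuadraticModel)

/-- The representation on trace free symmetric matrices. -/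
def rep (A : Mat3) : Mat5 :=
  LinearMap.toMatrix' (𝓜.q ∘ₗ (LinearMap.mulLeft ℝ A ∘ₗ LinearMap.mulRight ℝ Aᵀ) ∘ₗ 𝓜.σ)

/-- The derivative of the representation. -/
def drep (x : Mat3) : Mat5 :=
  LinearMap.toMatrix' (𝓜.q ∘ₗ (LinearMap.mulLeft ℝ x + LinearMap.mulRight ℝ xᵀ) ∘ₗ 𝓜.σ)

theorem rep_mulVec (A : Mat3) (v : R5) : 𝓜.rep A *ᵥ v = 𝓜.q (A * (𝓜.σ v * Aᵀ)) := by
  rw [rep, LinearMap.toMatrix'_mulVec]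
  rfl

theorem drep_mulVec (x : Mat3) (v : R5) :
    𝓜.drep x *ᵥ v = 𝓜.q (x * 𝓜.σ v + 𝓜.σ v * xᵀ) := by
  rw [drep, LinearMap.toMatrix'_mulVec]
  rfl

/-- The section σ changes S only by a multiple of J, which A preserves and q kills. Thus the formula
for the action may be used on any symmetric representative. -/
theorem rep_mulVec_q {A : Mat3} (hA : A * 𝓜.J * Aᵀ = 𝓜.J) {S : Mat3} (hS : Sᵀ = S) :
    𝓜.rep A *ᵥ 𝓜.q S = 𝓜.q (A * (S * Aᵀ)) := by
  rw [rep_mulVec, 𝓜.σ_q S hS, sub_mul, mul_sub, Matrix.smul_mul, Matrix.mul_smul, ← mul_assoc A 𝓜.J,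
    hA, map_sub, map_smul, 𝓜.q_J, smul_zero, sub_zero]

theorem ext_mulVec {A B : Mat5} (h : ∀ v, A *ᵥ v = B *ᵥ v) : A = B := by
  ext i j
  simpa using congrFun (h (Pi.single j 1)) i

theorem rep_mul {A : Mat3} (hA : A * 𝓜.J * Aᵀ = 𝓜.J) (B : Mat3) :
    𝓜.rep (A * B) = 𝓜.rep A * 𝓜.rep B := by
  refine ext_mulVec fun v => ?_
  rw [← Matrix.mulVec_mulVec, rep_mulVec _ B, rep_mulVec_q _ hA, rep_mulVec, Matrix.transpose_mul]
  · simp only [mul_assoc]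
  · simp only [Matrix.transpose_mul, Matrix.transpose_transpose, 𝓜.transpose_σ, mul_assoc]

theorem rep_mul_drep {A : Mat3} (hA : A * 𝓜.J * Aᵀ = 𝓜.J) (x : Mat3) (v : R5) :
    (𝓜.rep A * 𝓜.drep x) *ᵥ v = 𝓜.q (A * x * (𝓜.σ v * Aᵀ) + A * (𝓜.σ v * (A * x)ᵀ)) := by
  rw [← Matrix.mulVec_mulVec, drep_mulVec, rep_mulVec_q _ hA]
  · simp only [Matrix.transpose_mul, mul_assoc, add_mul, mul_add]
  · simp only [Matrix.transpose_mul, Matrix.transpose_transpose, 𝓜.transpose_σ,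
      Matrix.transpose_add, add_comm]

theorem rep_one : 𝓜.rep 1 = 1 := by
  refine ext_mulVec fun v => ?_
  rw [rep_mulVec]
  simp [𝓜.q_σ]

theorem mul_inv_eq_one {A : Mat3} (hA : A * 𝓜.J * Aᵀ = 𝓜.J) : A * (𝓜.J * Aᵀ * 𝓜.J) = 1 := by
  rw [← mul_assoc, ← mul_assoc, hA, 𝓜.J_mul_J]

theorem isUnit_rep {A : Mat3} (hA : A * 𝓜.J * Aᵀ = 𝓜.J) : IsUnit (𝓜.rep A) := by
  have h : 𝓜.rep A * 𝓜.rep (𝓜.J * Aᵀ * 𝓜.J) = 1 := by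
    rw [← 𝓜.rep_mul hA, 𝓜.mul_inv_eq_one hA, 𝓜.rep_one]
  exact IsUnit.of_mul_eq_one _ h

/-- The image of a vector under the quadratic map. -/
def quad (p : Fin 3 → ℝ) : R5 := 𝓜.q (Matrix.vecMulVec p p)

theorem rep_mulVec_single {A : Mat3} (hA : A * 𝓜.J * Aᵀ = 𝓜.J) :
    𝓜.rep A *ᵥ Pi.single 0 1 = 𝓜.quad (A.col 0) := by
  rw [← 𝓜.q_single, rep_mulVec_q _ hA (by simp), quad]
  congr 1
  ext i j
  simp [Matrix.mul_apply, Matrix.vecMulVec_apply, Matrix.single_apply, Fin.sum_univ_three]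

theorem hasDerivAt_mat3 {A : ℝ → Mat3} {A' : Mat3} {t : ℝ}
    (h : ∀ i j, HasDerivAt (fun s => A s i j) (A' i j) t) : HasDerivAt A A' t := by
  have h1 : HasDerivAt (fun s i j => A s i j) (fun i j => A' i j) t :=
    hasDerivAt_pi.2 fun j => hasDerivAt_pi.2 fun i => h j i
  exact (LinearMap.toContinuousLinearMap
    (Matrix.ofLinearEquiv ℝ : (Fin 3 → Fin 3 → ℝ) ≃ₗ[ℝ] Mat3).toLinearMap).hasFDerivAt.comp_hasDerivAt
      t h1

theorem contDiff_mat3 {E : Type*} [NormedAddCommGroup E] [NormedSpace ℝ E] {A : E → Mat3}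
    (h : ∀ i j, ContDiff ℝ ∞ fun s => A s i j) : ContDiff ℝ ∞ A := by
  have h1 : ContDiff ℝ ∞ (fun s i j => A s i j) :=
    contDiff_pi.2 fun j => contDiff_pi.2 fun i => h j i
  exact (LinearMap.toContinuousLinearMap
    (Matrix.ofLinearEquiv ℝ : (Fin 3 → Fin 3 → ℝ) ≃ₗ[ℝ] Mat3).toLinearMap).contDiff.comp h1

/-- The transposition as a continuous linear map. -/
def transposeL : Mat3 →L[ℝ] Mat3 :=
  LinearMap.toContinuousLinearMap (Matrix.transposeLinearEquiv (Fin 3) (Fin 3) ℝ ℝ).toLinearMap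

/-- A' = Ax gives rep(A)' = rep(A)·drep(x), which is how the Maurer–Cartan form of A is carried to
that of its representation. -/
theorem hasDerivAt_rep {A : ℝ → Mat3} {x : Mat3} {t : ℝ} (hA : A t * 𝓜.J * (A t)ᵀ = 𝓜.J)
    (h : HasDerivAt A (A t * x) t) :
    HasDerivAt (fun s => 𝓜.rep (A s)) (𝓜.rep (A t) * 𝓜.drep x) t := by
  have hT : HasDerivAt (fun s => (A s)ᵀ) (A t * x)ᵀ t :=
    transposeL.hasFDerivAt.comp_hasDerivAt t h
  have h1 : ∀ v, HasDerivAt (fun s => 𝓜.rep (A s) *ᵥ v) ((𝓜.rep (A t) * 𝓜.drep x) *ᵥ v) t := by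
    intro v
    have h2 := h.mul (hT.const_mul (𝓜.σ v))
    have h3 := (LinearMap.toContinuousLinearMap 𝓜.q).hasFDerivAt.comp_hasDerivAt t h2
    rw [rep_mul_drep _ hA]
    refine HasDerivAt.congr_of_eventuallyEq h3 (Filter.Eventually.of_forall fun s => ?_)
    exact 𝓜.rep_mulVec (A s) v
  rw [hasDerivAt_matrix_iff]
  intro i j
  have h4 := hasDerivAt_pi.1 (h1 (Pi.single j 1)) i
  simpa using h4

/-- The frame field of the columns of the representing matrices. -/
def frame (A : Plane → Mat3) (x : Plane) : Frame := columns (𝓜.rep (A x))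

theorem contDiff_frame {A : Plane → Mat3} (hA : ContDiff ℝ ∞ A) : ContDiff ℝ ∞ (𝓜.frame A) := by
  refine contDiff_pi.2 fun j => ?_
  have hT : ContDiff ℝ ∞ fun x => (A x)ᵀ := transposeL.contDiff.comp hA
  have h1 := (LinearMap.toContinuousLinearMap 𝓜.q).contDiff.comp
    (hA.mul ((contDiff_const (c := 𝓜.σ (Pi.single j 1))).mul hT))
  have h2 : (fun x => 𝓜.frame A x j) = fun x => 𝓜.q (A x * (𝓜.σ (Pi.single j 1) * (A x)ᵀ)) := by
    funext x
    have h3 := 𝓜.rep_mulVec (A x) (Pi.single j 1)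
    rw [Matrix.mulVec_single_one] at h3
    exact h3
  rw [h2]
  exact h1

theorem maurerCartan_frame {A : Plane → Mat3} (hA : ContDiff ℝ ∞ A) {x : Plane}
    (hJ : A x * 𝓜.J * (A x)ᵀ = 𝓜.J) {w : Plane} {ξ : Mat3}
    (h : HasDerivAt (fun t : ℝ => A (x + t • w)) (A x * ξ) 0) :
    maurerCartan (𝓜.frame A) x w = 𝓜.drep ξ := by
  have hli : LinearIndependent ℝ (𝓜.frame A x) := isUnit_frameMatrix.1 (𝓜.isUnit_rep hJ)
  refine maurerCartan_eq_of hli ?_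
  have h0 : A (x + (0 : ℝ) • w) = A x := by simp
  have h1 := 𝓜.hasDerivAt_rep (A := fun t : ℝ => A (x + t • w)) (t := 0) (x := ξ) (by simpa using hJ)
    (by simpa using h)
  have hd : DifferentiableAt ℝ (𝓜.frame A) x := (𝓜.contDiff_frame hA).differentiable (by simp) x
  have hl : HasDerivAt (fun t : ℝ => x + t • w) w 0 := by
    simpa using ((hasDerivAt_id (0 : ℝ)).smul_const w).const_add x
  have h2 : HasDerivAt (fun t : ℝ => 𝓜.frame A (x + t • w)) (fderiv ℝ (𝓜.frame A) x w) 0 := by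
    have h4 : HasFDerivAt (𝓜.frame A) (fderiv ℝ (𝓜.frame A) x) (x + (0 : ℝ) • w) := by
      simpa using hd.hasFDerivAt
    exact h4.comp_hasDerivAt (0 : ℝ) hl
  have h3 := h2.frameMat.unique (f := fun t : ℝ => 𝓜.rep (A (x + t • w))) h1
  rw [mfderiv_eq_fderiv]
  simp only [zero_smul, add_zero] at h3
  exact h3

end QuadraticModel

end

noncomputable section

attribute [local instance] Matrix.linftyOpNormedRing Matrix.linftyOpNormedAlgebra

/-! ### The space-like and time-like models -/

/-- The quadratic model of signature `(1, -ε, -ε)`. -/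
def spaceLikeModel (ε : ℝ) (hε : ε * ε = 1) : QuadraticModel where
  J := !![1, 0, 0; 0, -ε, 0; 0, 0, -ε]
  q :=
    { toFun := fun S => ![S 0 0 + ε / 2 * (S 1 1 + S 2 2), √3 / 2 * (S 0 1 + S 1 0),
        √3 / 2 * (S 0 2 + S 2 0), 3 / 2 * (S 1 1 - S 2 2), 3 / 2 * (S 1 2 + S 2 1)]
      map_add' := fun S T => by
        ext i
        fin_cases i <;> simp <;> ring
      map_smul' := fun c S => by
        ext i
        fin_cases i <;> simp <;> ring }
  σ :=
    { toFun := fun v => !![2 / 3 * v 0, √3 / 3 * v 1, √3 / 3 * v 2;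
        √3 / 3 * v 1, ε / 3 * v 0 + v 3 / 3, v 4 / 3;
        √3 / 3 * v 2, v 4 / 3, ε / 3 * v 0 - v 3 / 3]
      map_add' := fun S T => by
        ext i j
        fin_cases i <;> fin_cases j <;> simp <;> ring
      map_smul' := fun c S => by
        ext i j
        fin_cases i <;> fin_cases j <;> simp <;> ring }
  J_mul_J := by
    ext i j
    fin_cases i <;> fin_cases j <;> simp [Matrix.mul_apply, Fin.sum_univ_three, hε]
  transpose_J := by
    ext i j
    fin_cases i <;> fin_cases j <;> simp
  J_zero_zero := by simp
  q_J := by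
    ext i
    fin_cases i <;> simp
    linear_combination -hε
  q_σ := fun v => by
    have h3 : √3 * √3 = 3 := Real.mul_self_sqrt (by norm_num)
    ext i
    fin_cases i <;> simp <;> grind
  transpose_σ := fun v => by
    ext i j
    fin_cases i <;> fin_cases j <;> simp
  σ_q := fun S hS => by
    have h3 : √3 * √3 = 3 := Real.mul_self_sqrt (by norm_num)
    have h01 : S 1 0 = S 0 1 := congrFun (congrFun hS 0) 1
    have h02 : S 2 0 = S 0 2 := congrFun (congrFun hS 0) 2
    have h12 : S 2 1 = S 1 2 := congrFun (congrFun hS 1) 2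
    ext i j
    fin_cases i <;> fin_cases j <;>
      simp [Matrix.trace, Matrix.vecMul, dotProduct, Fin.sum_univ_three,
        h01, h02, h12] <;> grind
  q_single := by
    ext i
    fin_cases i <;> simp

/-- The quadratic model of signature `(1, 1, -1)`, in null coordinates. -/
def timeLikeModel : QuadraticModel where
  J := !![1, 0, 0; 0, 1, 0; 0, 0, -1]
  q :=
    { toFun := fun S => ![S 0 0 - (S 1 1 - S 2 2) / 2,
        √6 / 4 * (S 0 1 + S 1 0 + (S 0 2 + S 2 0)), -(√6 / 4 * (S 0 1 + S 1 0 - (S 0 2 + S 2 0))),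
        3 / 4 * (S 1 1 + S 2 2 + (S 1 2 + S 2 1)), 3 / 4 * (S 1 1 + S 2 2 - (S 1 2 + S 2 1))]
      map_add' := fun S T => by
        ext i
        fin_cases i <;> simp <;> ring
      map_smul' := fun c S => by
        ext i
        fin_cases i <;> simp <;> ring }
  σ :=
    { toFun := fun v => !![2 / 3 * v 0, √6 / 6 * (v 1 - v 2), √6 / 6 * (v 1 + v 2);
        √6 / 6 * (v 1 - v 2), (v 3 + v 4 - v 0) / 3, (v 3 - v 4) / 3;
        √6 / 6 * (v 1 + v 2), (v 3 - v 4) / 3, (v 3 + v 4 + v 0) / 3]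
      map_add' := fun S T => by
        ext i j
        fin_cases i <;> fin_cases j <;> simp <;> ring
      map_smul' := fun c S => by
        ext i j
        fin_cases i <;> fin_cases j <;> simp <;> ring }
  J_mul_J := by
    ext i j
    fin_cases i <;> fin_cases j <;> simp [Matrix.mul_apply, Fin.sum_univ_three]
  transpose_J := by
    ext i j
    fin_cases i <;> fin_cases j <;> simp
  J_zero_zero := by simp
  q_J := by
    ext i
    fin_cases i <;> simp
  q_σ := fun v => by
    have h6 : √6 * √6 = 6 := Real.mul_self_sqrt (by norm_num)
    ext i
    fin_cases i <;> simp <;> grind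
  transpose_σ := fun v => by
    ext i j
    fin_cases i <;> fin_cases j <;> simp
  σ_q := fun S hS => by
    have h6 : √6 * √6 = 6 := Real.mul_self_sqrt (by norm_num)
    have h01 : S 1 0 = S 0 1 := congrFun (congrFun hS 0) 1
    have h02 : S 2 0 = S 0 2 := congrFun (congrFun hS 0) 2
    have h12 : S 2 1 = S 1 2 := congrFun (congrFun hS 1) 2
    ext i j
    fin_cases i <;> fin_cases j <;>
      simp [Matrix.trace, Matrix.vecMul, dotProduct, Fin.sum_univ_three,
        h01, h02, h12] <;> grind
  q_single := by
    ext i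
    fin_cases i <;> simp

/-- The normalizations in `spaceLikeModel` are chosen for this identity: the Lie algebra of J acts
exactly by the algebra found in the classification. The factor √3 is the source of the 3 in the
centroaffine metrics. -/
theorem spaceLikeModel_drep {ε : ℝ} (hε : ε * ε = 1) (a b c : ℝ) :
    (spaceLikeModel ε hε).drep !![0, ε * a, ε * b; a, 0, -c; b, c, 0] =
      spaceLikeMat ε (√3 * a) (√3 * b) c := by
  have h3 : √3 * √3 = 3 := Real.mul_self_sqrt (by norm_num)
  refine QuadraticModel.ext_mulVec fun v => ?_
  rw [QuadraticModel.drep_mulVec]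
  ext i
  fin_cases i <;> simp [spaceLikeModel, spaceLikeMat, Matrix.mulVec, dotProduct, Fin.sum_univ_five,
    Fin.sum_univ_three, Matrix.vecMul, Matrix.vecHead, Matrix.vecTail] <;> grind

/-- The two null forms are √6/2 · (b ± a), so twice their product is 3(b² - a²). -/
theorem timeLikeModel_drep (a b c : ℝ) :
    timeLikeModel.drep !![0, -a, b; a, 0, c; b, c, 0] =
      timeLikeMat (√6 / 2 * (a + b)) (-(√6 / 2 * (a - b))) c := by
  have h6 : √6 * √6 = 6 := Real.mul_self_sqrt (by norm_num)
  refine QuadraticModel.ext_mulVec fun v => ?_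
  rw [QuadraticModel.drep_mulVec]
  ext i
  fin_cases i <;> simp [timeLikeModel, timeLikeMat, Matrix.mulVec, dotProduct, Fin.sum_univ_five,
    Fin.sum_univ_three, Matrix.vecMul, Matrix.vecHead, Matrix.vecTail] <;> grind

/-! ### The moving frames of the models -/

/-- A product of two boosts. -/
def hyperbolicRot (x : Plane) : Mat3 :=
  !![Real.cosh (x 0) * Real.cosh (x 1), Real.sinh (x 0), Real.cosh (x 0) * Real.sinh (x 1);
     Real.sinh (x 0) * Real.cosh (x 1), Real.cosh (x 0), Real.sinh (x 0) * Real.sinh (x 1);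
     Real.sinh (x 1), 0, Real.cosh (x 1)]

/-- A product of two rotations. -/
def sphericalRot (x : Plane) : Mat3 :=
  !![Real.cos (x 0) * Real.cos (x 1), -Real.sin (x 0), -(Real.cos (x 0) * Real.sin (x 1));
     Real.sin (x 0) * Real.cos (x 1), Real.cos (x 0), -(Real.sin (x 0) * Real.sin (x 1));
     Real.sin (x 1), 0, Real.cos (x 1)]

/-- The product of a rotation and a boost. -/
def lorentzianRot (x : Plane) : Mat3 :=
  !![Real.cos (x 0) * Real.cosh (x 1), -Real.sin (x 0), Real.cos (x 0) * Real.sinh (x 1);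
     Real.sin (x 0) * Real.cosh (x 1), Real.cos (x 0), Real.sin (x 0) * Real.sinh (x 1);
     Real.sinh (x 1), 0, Real.cosh (x 1)]

theorem contDiff_hyperbolicRot : ContDiff ℝ ∞ hyperbolicRot := by
  refine QuadraticModel.contDiff_mat3 fun i j => ?_
  fin_cases i <;> fin_cases j <;> simp [hyperbolicRot] <;> fun_prop

theorem contDiff_sphericalRot : ContDiff ℝ ∞ sphericalRot := by
  refine QuadraticModel.contDiff_mat3 fun i j => ?_
  fin_cases i <;> fin_cases j <;> simp [sphericalRot] <;> fun_prop

theorem contDiff_lorentzianRot : ContDiff ℝ ∞ lorentzianRot := by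
  refine QuadraticModel.contDiff_mat3 fun i j => ?_
  fin_cases i <;> fin_cases j <;> simp [lorentzianRot] <;> fun_prop

theorem hyperbolicRot_mul (x : Plane) :
    hyperbolicRot x * (spaceLikeModel 1 (by norm_num)).J * (hyperbolicRot x)ᵀ =
      (spaceLikeModel 1 (by norm_num)).J := by
  have h0 := Real.cosh_sq (x 0)
  have h1 := Real.cosh_sq (x 1)
  ext i j
  fin_cases i <;> fin_cases j <;> simp [hyperbolicRot, spaceLikeModel, Matrix.mul_apply,
    Fin.sum_univ_three] <;> grind

theorem sphericalRot_mul (x : Plane) :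
    sphericalRot x * (spaceLikeModel (-1) (by norm_num)).J * (sphericalRot x)ᵀ =
      (spaceLikeModel (-1) (by norm_num)).J := by
  have h0 := Real.sin_sq_add_cos_sq (x 0)
  have h1 := Real.sin_sq_add_cos_sq (x 1)
  ext i j
  fin_cases i <;> fin_cases j <;> simp [sphericalRot, spaceLikeModel, Matrix.mul_apply,
    Fin.sum_univ_three] <;> grind

theorem lorentzianRot_mul (x : Plane) :
    lorentzianRot x * timeLikeModel.J * (lorentzianRot x)ᵀ = timeLikeModel.J := by
  have h0 := Real.sin_sq_add_cos_sq (x 0)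
  have h1 := Real.cosh_sq (x 1)
  ext i j
  fin_cases i <;> fin_cases j <;> simp [lorentzianRot, timeLikeModel, Matrix.mul_apply,
    Fin.sum_univ_three] <;> grind

theorem hasDerivAt_line (x w : Plane) (i : Fin 2) :
    HasDerivAt (fun t : ℝ => (x + t • w) i) (w i) 0 := by
  simpa using ((hasDerivAt_id (0 : ℝ)).mul_const (w i)).const_add (x i)

/-- The connection matrix A⁻¹dA is written with the redundant factors 1 and the double sign so that
it matches the pattern of `spaceLikeModel_drep` with ε = 1. -/
theorem hasDerivAt_hyperbolicRot (x w : Plane) :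
    HasDerivAt (fun t : ℝ => hyperbolicRot (x + t • w)) (hyperbolicRot x *
      !![0, 1 * (Real.cosh (x 1) * w 0), 1 * w 1; Real.cosh (x 1) * w 0, 0, -(-Real.sinh (x 1) * w 0);
        w 1, -Real.sinh (x 1) * w 0, 0]) 0 := by
  have h1 := Real.cosh_sq (x 1)
  have c0 := (hasDerivAt_line x w 0).cosh
  have s0 := (hasDerivAt_line x w 0).sinh
  have c1 := (hasDerivAt_line x w 1).cosh
  have s1 := (hasDerivAt_line x w 1).sinh
  refine QuadraticModel.hasDerivAt_mat3 fun i j => ?_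
  fin_cases i <;> fin_cases j <;>
    simp only [hyperbolicRot, Matrix.mul_apply, Fin.sum_univ_three]
  · refine (c0.mul c1).congr_deriv ?_
    simp; grind
  · refine s0.congr_deriv ?_
    simp; grind
  · refine (c0.mul s1).congr_deriv ?_
    simp; grind
  · refine (s0.mul c1).congr_deriv ?_
    simp; grind
  · refine c0.congr_deriv ?_
    simp; grind
  · refine (s0.mul s1).congr_deriv ?_
    simp; grind
  · refine s1.congr_deriv ?_
    simp
  · refine (hasDerivAt_const (0 : ℝ) (0 : ℝ)).congr_deriv ?_
    simp; grind
  · refine c1.congr_deriv ?_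
    simp

theorem hasDerivAt_sphericalRot (x w : Plane) :
    HasDerivAt (fun t : ℝ => sphericalRot (x + t • w)) (sphericalRot x *
      !![0, -1 * (Real.cos (x 1) * w 0), -1 * w 1; Real.cos (x 1) * w 0, 0, -(Real.sin (x 1) * w 0);
        w 1, Real.sin (x 1) * w 0, 0]) 0 := by
  have h1 := Real.sin_sq_add_cos_sq (x 1)
  have c0 := (hasDerivAt_line x w 0).cos
  have s0 := (hasDerivAt_line x w 0).sin
  have c1 := (hasDerivAt_line x w 1).cos
  have s1 := (hasDerivAt_line x w 1).sin
  refine QuadraticModel.hasDerivAt_mat3 fun i j => ?_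
  fin_cases i <;> fin_cases j <;>
    simp only [sphericalRot, Matrix.mul_apply, Fin.sum_univ_three]
  · refine (c0.mul c1).congr_deriv ?_
    simp; grind
  · refine s0.neg.congr_deriv ?_
    simp; grind
  · refine (c0.mul s1).neg.congr_deriv ?_
    simp; grind
  · refine (s0.mul c1).congr_deriv ?_
    simp; grind
  · refine c0.congr_deriv ?_
    simp; grind
  · refine (s0.mul s1).neg.congr_deriv ?_
    simp; grind
  · refine s1.congr_deriv ?_
    simp
  · refine (hasDerivAt_const (0 : ℝ) (0 : ℝ)).congr_deriv ?_
    simp; grind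
  · refine c1.congr_deriv ?_
    simp

theorem hasDerivAt_lorentzianRot (x w : Plane) :
    HasDerivAt (fun t : ℝ => lorentzianRot (x + t • w)) (lorentzianRot x *
      !![0, -(Real.cosh (x 1) * w 0), w 1; Real.cosh (x 1) * w 0, 0, Real.sinh (x 1) * w 0;
        w 1, Real.sinh (x 1) * w 0, 0]) 0 := by
  have h1 := Real.cosh_sq (x 1)
  have c0 := (hasDerivAt_line x w 0).cos
  have s0 := (hasDerivAt_line x w 0).sin
  have c1 := (hasDerivAt_line x w 1).cosh
  have s1 := (hasDerivAt_line x w 1).sinh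
  refine QuadraticModel.hasDerivAt_mat3 fun i j => ?_
  fin_cases i <;> fin_cases j <;>
    simp only [lorentzianRot, Matrix.mul_apply, Fin.sum_univ_three]
  · refine (c0.mul c1).congr_deriv ?_
    simp; grind
  · refine s0.neg.congr_deriv ?_
    simp; grind
  · refine (c0.mul s1).congr_deriv ?_
    simp; grind
  · refine (s0.mul c1).congr_deriv ?_
    simp; grind
  · refine c0.congr_deriv ?_
    simp; grind
  · refine (s0.mul s1).congr_deriv ?_
    simp; grind
  · refine s1.congr_deriv ?_
    simp
  · refine (hasDerivAt_const (0 : ℝ) (0 : ℝ)).congr_deriv ?_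
    simp; grind
  · refine c1.congr_deriv ?_
    simp

end

noncomputable section

/-! ### Adapted frame fields from their Maurer-Cartan forms -/

section Adapted

variable {f : Plane → R5} {s : Plane → Frame} {U : Set Plane}

theorem mfderiv_eq_sum_maurerCartan (hs : ContDiff ℝ ∞ s) (h0 : ∀ y, s y 0 = f y) {x : Plane}
    (hli : LinearIndependent ℝ (s x)) (w : Plane) :
    (mfderiv (𝓡 2) 𝓘(ℝ, R5) f x w : R5) = ∑ i, maurerCartan s x w i 0 • s x i := by
  have hs' : MDifferentiableAt (𝓡 2) 𝓘(ℝ, Frame) s x :=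
    ((contMDiff_iff_contDiff.2 hs) x).mdifferentiableAt (by simp)
  have h1 := mfderiv_frame_apply hs' (f := f) (j := 0) (Filter.Eventually.of_forall h0) w
  have h2 := frameMatrix_mfderiv hli w
  refine h1.trans ?_
  funext i
  have h3 := congrFun (congrFun h2 i) 0
  rw [Matrix.mul_apply] at h3
  refine h3.trans ?_
  rw [Finset.sum_apply]
  refine Finset.sum_congr rfl fun j _ => ?_
  rw [frameMatrix_apply, Pi.smul_apply, smul_eq_mul, mul_comm]

theorem isOneAdapted_of (hU : IsOpen U) (hs : ContDiff ℝ ∞ s) (h0 : ∀ y, s y 0 = f y)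
    (hli : ∀ y ∈ U, LinearIndependent ℝ (s y))
    (hΩ : ∀ y ∈ U, ∀ w : Plane, maurerCartan s y w 0 0 = 0 ∧ maurerCartan s y w 3 0 = 0 ∧
      maurerCartan s y w 4 0 = 0)
    (hsurj : ∀ y ∈ U, ∀ a b, ∃ w : Plane, maurerCartan s y w 1 0 = a ∧ maurerCartan s y w 2 0 = b) :
    IsOneAdapted f U s := by
  refine ⟨hU, (contMDiff_iff_contDiff.2 hs).contMDiffOn, fun y hy => ⟨hli y hy, h0 y, ?_⟩⟩
  have key : ∀ w : Plane, (mfderiv (𝓡 2) 𝓘(ℝ, R5) f y w : R5) =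
      maurerCartan s y w 1 0 • s y 1 + maurerCartan s y w 2 0 • s y 2 := by
    intro w
    obtain ⟨a0, a3, a4⟩ := hΩ y hy w
    refine (mfderiv_eq_sum_maurerCartan hs h0 (hli y hy) w).trans ?_
    rw [Fin.sum_univ_five, a0, a3, a4, zero_smul, zero_smul, zero_smul, zero_add, add_zero, add_zero]
  ext z
  rw [SetLike.mem_coe, Submodule.mem_span_pair]
  constructor
  · rintro ⟨a, b, rfl⟩
    obtain ⟨w, rfl, rfl⟩ := hsurj y hy a b
    exact ⟨w, key w⟩
  · rintro ⟨w, rfl⟩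
    exact ⟨_, _, (key w).symm⟩

/-- The condition ω⁰₀ = 0 says that the differential of f has no component along f, which gives
transversality. -/
theorem isCentroaffineImmersion_of (hs : ContDiff ℝ ∞ s) (h0 : ∀ y, s y 0 = f y)
    (hli : ∀ y, LinearIndependent ℝ (s y))
    (hΩ : ∀ y w : Plane, maurerCartan s y w 0 0 = 0)
    (hinj : ∀ y w : Plane, maurerCartan s y w 1 0 = 0 → maurerCartan s y w 2 0 = 0 → w = 0) :
    IsCentroaffineImmersion f := by
  have hf : f = fun y => s y 0 := funext fun y => (h0 y).symm
  refine ⟨?_, fun x => ⟨?_, fun v hv => ?_⟩⟩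
  · rw [hf]
    exact contMDiff_iff_contDiff.2 (contDiff_pi.1 hs 0)
  · refine (injective_iff_map_eq_zero _).2 fun w hw => ?_
    have h1 := (mfderiv_eq_sum_maurerCartan hs h0 (hli x) w).symm.trans hw
    have h2 := Fintype.linearIndependent_iff.1 (hli x) _ h1
    exact hinj x w (h2 1) (h2 2)
  · have h1 := (mfderiv_eq_sum_maurerCartan hs h0 (hli x) v).symm.trans hv
    have h2 : ∑ i, (maurerCartan s x v i 0 - if i = 0 then 1 else 0) • s x i = 0 := by
      simp only [sub_smul, Finset.sum_sub_distrib, h1, ite_smul, one_smul, zero_smul,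
        Finset.sum_ite_eq', Finset.mem_univ, if_true, h0, sub_self]
    have h3 := Fintype.linearIndependent_iff.1 (hli x) _ h2 0
    have h4 : maurerCartan s x v 0 0 = 0 := hΩ x v
    rw [h4] at h3
    simp at h3

theorem isThreeAdaptedSpaceLike_of (hU : IsOpen U) (hs : ContDiff ℝ ∞ s) (h0 : ∀ y, s y 0 = f y)
    (hli : ∀ y ∈ U, LinearIndependent ℝ (s y)) {ε : ℝ} (hε : ε = 1 ∨ ε = -1)
    (hΩ : ∀ y ∈ U, ∀ w : Plane, ∃ a b c, maurerCartan s y w = spaceLikeMat ε a b c)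
    (hsurj : ∀ y ∈ U, ∀ a b, ∃ w : Plane, maurerCartan s y w 1 0 = a ∧ maurerCartan s y w 2 0 = b) :
    IsThreeAdaptedSpaceLike f U s := by
  refine ⟨⟨isOneAdapted_of hU hs h0 hli (fun y hy w => ?_) hsurj, ε, hε,
    fun y hy => ⟨fun w i => ?_, fun w i => ?_, fun w i => ?_⟩⟩, fun y hy w => ?_⟩ <;>
  obtain ⟨a, b, c, h⟩ := hΩ y hy w <;> rw [h]
  · simp [spaceLikeMat]
  · fin_cases i <;> simp [tangIdx, spaceLikeMat]
  · fin_cases i <;> simp [tangIdx, spaceLikeMat]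
  · fin_cases i <;> simp [tangIdx, spaceLikeMat]
  · simp [spaceLikeMat]

theorem isThreeAdaptedTimeLike_of (hU : IsOpen U) (hs : ContDiff ℝ ∞ s) (h0 : ∀ y, s y 0 = f y)
    (hli : ∀ y ∈ U, LinearIndependent ℝ (s y))
    (hΩ : ∀ y ∈ U, ∀ w : Plane, ∃ a b c, maurerCartan s y w = timeLikeMat a b c)
    (hsurj : ∀ y ∈ U, ∀ a b, ∃ w : Plane, maurerCartan s y w 1 0 = a ∧ maurerCartan s y w 2 0 = b) :
    IsThreeAdaptedTimeLike f U s := by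
  refine ⟨⟨isOneAdapted_of hU hs h0 hli (fun y hy w => ?_) hsurj,
    fun y hy => ⟨fun w i => ?_, fun w i => ?_, fun w i => ?_⟩⟩, fun y hy w => ?_⟩ <;>
  obtain ⟨a, b, c, h⟩ := hΩ y hy w <;> rw [h]
  · simp [timeLikeMat]
  · fin_cases i <;> simp [tangIdx, timeLikeMat]
  · fin_cases i <;> simp [tangIdx, timeLikeMat]
  · fin_cases i <;> simp [tangIdx, timeLikeMat]
  · simp [timeLikeMat]

/-- Space-like surfaces whose Maurer-Cartan form is that of a warped product metric. -/
theorem hasMetric_of_warped (hU : IsOpen U) (hs : ContDiff ℝ ∞ s) (h0 : ∀ y, s y 0 = f y)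
    (hli : ∀ y ∈ U, LinearIndependent ℝ (s y)) {ε : ℝ} (hε : ε = 1 ∨ ε = -1) {k k' k'' : ℝ → ℝ}
    (hk : ∀ y ∈ U, k (y 1) ≠ 0) (hk' : ∀ t, HasDerivAt k' (k'' t) t)
    (hΩ : ∀ (y w : Plane), maurerCartan s y w =
      spaceLikeMat ε (√3 * (k (y 1) * w 0)) (√3 * w 1) (-k' (y 1) * w 0)) {x : Plane} (hx : x ∈ U) :
    HasSpaceLikeMetricAt f x (fun w => 3 * (k (x 1) ^ 2 * w 0 ^ 2 + w 1 ^ 2)) ∧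
      ∀ K, k'' (x 1) = -(3 * K) * k (x 1) → HasGaussCurvatureAt f x K := by
  have h3 : √3 * √3 = 3 := Real.mul_self_sqrt (by norm_num)
  have h3' : √3 ≠ 0 := by positivity
  have had : IsThreeAdaptedSpaceLike f U s := by
    refine isThreeAdaptedSpaceLike_of hU hs h0 hli hε (fun y _ w => ⟨_, _, _, hΩ y w⟩) ?_
    intro y hy a b
    have hky := hk y hy
    refine ⟨!₂[a / √3 / k (y 1), b / √3], ?_, ?_⟩ <;> rw [hΩ] <;> simp [spaceLikeMat] <;> field_simp
  refine ⟨⟨U, s, hx, had, fun w => ?_⟩, fun K hK => ⟨U, s, hx, had, fun a b => ?_⟩⟩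
  · rw [hΩ]
    simp [spaceLikeMat]
    linear_combination (-(k (x 1) ^ 2 * w 0 ^ 2 + w 1 ^ 2)) * h3
  · have hcon : ∀ y b : Plane, connForm s y b = k' (y 1) * b 0 := by
      intro y b
      rw [connForm, hΩ]
      simp [spaceLikeMat]
    have hfd : ∀ a b : Plane, fderiv ℝ (fun y => connForm s y b) x a = k'' (x 1) * a 1 * b 0 := by
      intro a b
      simp only [hcon]
      have h1 : HasFDerivAt (fun y : Plane => y 1) (EuclideanSpace.proj (𝕜 := ℝ) (1 : Fin 2)) x :=
        (EuclideanSpace.proj (𝕜 := ℝ) (1 : Fin 2) : Plane →L[ℝ] ℝ).hasFDerivAt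
      have h2 := ((hk' (x 1)).comp_hasFDerivAt x h1).mul_const (b 0)
      have h4 := h2.fderiv
      simp only [Function.comp_def] at h4
      rw [h4]
      simp
      ring
    -- Here α = k'(v) du and ω¹₀ ∧ ω²₀ = 3k du ∧ dv, whence K = -k''/(3k).
    rw [hfd, hfd, hΩ, hΩ]
    simp [spaceLikeMat]
    linear_combination (a 1 * b 0 - b 1 * a 0) * hK -
      K * k (x 1) * (a 0 * b 1 - b 0 * a 1) * h3

end Adapted

/-! ### The models in terms of the moving frames -/

theorem frame_apply_zero {𝓜 : QuadraticModel} {A : Plane → Mat3} {x : Plane}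
    (hA : A x * 𝓜.J * (A x)ᵀ = 𝓜.J) : 𝓜.frame A x 0 = 𝓜.quad ((A x).col 0) := by
  rw [← 𝓜.rep_mulVec_single hA, Matrix.mulVec_single_one]
  rfl

theorem linearIndependent_frame {𝓜 : QuadraticModel} {A : Plane → Mat3} {x : Plane}
    (hA : A x * 𝓜.J * (A x)ᵀ = 𝓜.J) : LinearIndependent ℝ (𝓜.frame A x) :=
  isUnit_frameMatrix.1 (𝓜.isUnit_rep hA)

theorem spaceLikeModel_quad {ε : ℝ} (hε : ε * ε = 1) (p : Fin 3 → ℝ) :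
    (spaceLikeModel ε hε).quad p = ![p 0 ^ 2 + ε / 2 * (p 1 ^ 2 + p 2 ^ 2), √3 * (p 0 * p 1),
      √3 * (p 0 * p 2), 3 / 2 * (p 1 ^ 2 - p 2 ^ 2), 3 * (p 1 * p 2)] := by
  ext i
  fin_cases i <;> simp [QuadraticModel.quad, spaceLikeModel, Matrix.vecMulVec_apply] <;> ring

theorem timeLikeModel_quad (p : Fin 3 → ℝ) :
    timeLikeModel.quad p = ![p 0 ^ 2 - (p 1 ^ 2 - p 2 ^ 2) / 2, √6 / 2 * (p 0 * (p 1 + p 2)),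
      -(√6 / 2 * (p 0 * (p 1 - p 2))), 3 / 4 * (p 1 + p 2) ^ 2, 3 / 4 * (p 1 - p 2) ^ 2] := by
  ext i
  fin_cases i <;> simp [QuadraticModel.quad, timeLikeModel, Matrix.vecMulVec_apply] <;> ring

/-- The model of the hyperbolic plane. -/
abbrev hypModel : QuadraticModel := spaceLikeModel 1 (by norm_num)

/-- The model of the sphere. -/
abbrev sphModel : QuadraticModel := spaceLikeModel (-1) (by norm_num)

theorem hyperbolicModel_eq (x : Plane) :
    hyperbolicModel x = hypModel.quad ((hyperbolicRot x).col 0) := by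
  have h0 := Real.cosh_sq (x 0)
  have h1 := Real.cosh_sq (x 1)
  rw [spaceLikeModel_quad]
  ext i
  fin_cases i <;> simp [hyperbolicModel, hyperbolicRot] <;> grind

theorem sphericalModel_eq (x : Plane) :
    sphericalModel x = sphModel.quad ((sphericalRot x).col 0) := by
  have h0 := Real.sin_sq_add_cos_sq (x 0)
  have h1 := Real.sin_sq_add_cos_sq (x 1)
  rw [spaceLikeModel_quad]
  ext i
  fin_cases i <;> simp [sphericalModel, sphericalRot] <;> grind

theorem lorentzianModel_eq (x : Plane) :
    lorentzianModel x = timeLikeModel.quad ((lorentzianRot x).col 0) := by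
  have h0 := Real.sin_sq_add_cos_sq (x 0)
  have h1 := Real.cosh_sq (x 1)
  have h2 := Real.cosh_two_mul (x 1)
  have h3 := Real.sinh_two_mul (x 1)
  rw [timeLikeModel_quad]
  ext i
  fin_cases i <;> simp [lorentzianModel, lorentzianRot, h2, h3] <;> grind

theorem maurerCartan_hyperbolic (x w : Plane) :
    maurerCartan (hypModel.frame hyperbolicRot) x w =
      spaceLikeMat 1 (√3 * (Real.cosh (x 1) * w 0)) (√3 * w 1) (-Real.sinh (x 1) * w 0) := by
  rw [QuadraticModel.maurerCartan_frame _ contDiff_hyperbolicRot (hyperbolicRot_mul x)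
    (hasDerivAt_hyperbolicRot x w), spaceLikeModel_drep]

theorem maurerCartan_spherical (x w : Plane) :
    maurerCartan (sphModel.frame sphericalRot) x w =
      spaceLikeMat (-1) (√3 * (Real.cos (x 1) * w 0)) (√3 * w 1)
        (-(fun t => -Real.sin t) (x 1) * w 0) := by
  rw [QuadraticModel.maurerCartan_frame _ contDiff_sphericalRot (sphericalRot_mul x)
    (hasDerivAt_sphericalRot x w), spaceLikeModel_drep]
  simp

theorem maurerCartan_lorentzian (x w : Plane) :
    maurerCartan (timeLikeModel.frame lorentzianRot) x w =
      timeLikeMat (√6 / 2 * (Real.cosh (x 1) * w 0 + w 1)) (-(√6 / 2 * (Real.cosh (x 1) * w 0 - w 1)))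
        (Real.sinh (x 1) * w 0) := by
  rw [QuadraticModel.maurerCartan_frame _ contDiff_lorentzianRot (lorentzianRot_mul x)
    (hasDerivAt_lorentzianRot x w), timeLikeModel_drep]

theorem hyperbolic_frame_zero (x : Plane) :
    hypModel.frame hyperbolicRot x 0 = hyperbolicModel x := by
  rw [frame_apply_zero (hyperbolicRot_mul x), hyperbolicModel_eq]

theorem spherical_frame_zero (x : Plane) :
    sphModel.frame sphericalRot x 0 = sphericalModel x := by
  rw [frame_apply_zero (sphericalRot_mul x), sphericalModel_eq]

theorem lorentzian_frame_zero (x : Plane) :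
    timeLikeModel.frame lorentzianRot x 0 = lorentzianModel x := by
  rw [frame_apply_zero (lorentzianRot_mul x), lorentzianModel_eq]

/-! ### Immersions, metrics and curvatures -/

theorem isCentroaffineImmersion_hyperbolicModel : IsCentroaffineImmersion hyperbolicModel := by
  refine isCentroaffineImmersion_of (hypModel.contDiff_frame contDiff_hyperbolicRot)
    hyperbolic_frame_zero (fun y => linearIndependent_frame (hyperbolicRot_mul y)) ?_ ?_
  · intro y w
    rw [maurerCartan_hyperbolic]
    simp [spaceLikeMat]
  · intro y w h1 h2
    rw [maurerCartan_hyperbolic] at h1 h2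
    have hc := (Real.cosh_pos (y 1)).ne'
    simp [spaceLikeMat, hc] at h1 h2
    ext i
    fin_cases i <;> simp [h1, h2]

theorem isCentroaffineImmersion_lorentzianModel : IsCentroaffineImmersion lorentzianModel := by
  refine isCentroaffineImmersion_of (timeLikeModel.contDiff_frame contDiff_lorentzianRot)
    lorentzian_frame_zero (fun y => linearIndependent_frame (lorentzianRot_mul y)) ?_ ?_
  · intro y w
    rw [maurerCartan_lorentzian]
    simp [timeLikeMat]
  · intro y w h1 h2
    rw [maurerCartan_lorentzian] at h1 h2
    have hc := (Real.cosh_pos (y 1)).ne'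
    simp [timeLikeMat] at h1 h2
    have h3 : w 0 = 0 := by
      have : Real.cosh (y 1) * w 0 = 0 := by linarith
      simpa [hc] using this
    have h4 : w 1 = 0 := by simpa [h3] using h1
    ext i
    fin_cases i <;> simp [h3, h4]

theorem hyperbolicModel_metric (x : Plane) :
    HasSpaceLikeMetricAt hyperbolicModel x
      (fun w => 3 * (Real.cosh (x 1) ^ 2 * w 0 ^ 2 + w 1 ^ 2)) ∧
    HasGaussCurvatureAt hyperbolicModel x (-1 / 3) := by
  obtain ⟨h1, h2⟩ := hasMetric_of_warped (f := hyperbolicModel) isOpen_univ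
    (hypModel.contDiff_frame contDiff_hyperbolicRot)
    hyperbolic_frame_zero (fun y _ => linearIndependent_frame (hyperbolicRot_mul y)) (Or.inl rfl)
    (k := Real.cosh) (fun y _ => (Real.cosh_pos _).ne') (Real.hasDerivAt_sinh)
    maurerCartan_hyperbolic (Set.mem_univ x)
  exact ⟨h1, h2 _ (by ring)⟩

theorem sphericalModel_metric (x : Plane) (hx : Real.cos (x 1) ≠ 0) :
    HasSpaceLikeMetricAt sphericalModel x
      (fun w => 3 * (Real.cos (x 1) ^ 2 * w 0 ^ 2 + w 1 ^ 2)) ∧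
    HasGaussCurvatureAt sphericalModel x (1 / 3) := by
  have hU : IsOpen {y : Plane | Real.cos (y 1) ≠ 0} := by
    refine isOpen_ne_fun ?_ continuous_const
    fun_prop
  obtain ⟨h1, h2⟩ := hasMetric_of_warped (f := sphericalModel) hU
    (sphModel.contDiff_frame contDiff_sphericalRot)
    spherical_frame_zero (fun y _ => linearIndependent_frame (sphericalRot_mul y)) (Or.inr rfl)
    (k := Real.cos) (fun y hy => hy) (fun t => (Real.hasDerivAt_sin t).neg)
    maurerCartan_spherical hx
  exact ⟨h1, h2 _ (by ring)⟩

theorem lorentzianModel_metric (x : Plane) :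
    HasTimeLikeMetricAt lorentzianModel x
      (fun w => 3 * (-(Real.cosh (x 1) ^ 2 * w 0 ^ 2) + w 1 ^ 2)) := by
  have h6 : √6 * √6 = 6 := Real.mul_self_sqrt (by norm_num)
  have h6' : √6 ≠ 0 := by positivity
  refine ⟨Set.univ, timeLikeModel.frame lorentzianRot, trivial, isThreeAdaptedTimeLike_of isOpen_univ
    (timeLikeModel.contDiff_frame contDiff_lorentzianRot) lorentzian_frame_zero
    (fun y _ => linearIndependent_frame (lorentzianRot_mul y))
    (fun y _ w => ⟨_, _, _, maurerCartan_lorentzian y w⟩) ?_, fun w => ?_⟩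
  · intro y _ a b
    have hc := (Real.cosh_pos (y 1)).ne'
    refine ⟨!₂[(a - b) / √6 / Real.cosh (y 1), (a + b) / √6], ?_, ?_⟩ <;>
      rw [maurerCartan_lorentzian] <;> simp [timeLikeMat] <;> field_simp <;> ring
  · rw [maurerCartan_lorentzian]
    simp [timeLikeMat]
    linear_combination (-(1 / 2) * (-(Real.cosh (x 1) ^ 2 * w 0 ^ 2) + w 1 ^ 2)) * h6

end

noncomputable section

attribute [local instance] Matrix.linftyOpNormedRing Matrix.linftyOpNormedAlgebra

/-! ### Irreducibility -/

theorem mulVec_mem_of_hasDerivAt (W : Submodule ℝ R5) {B : ℝ → Mat5} {X : Mat5}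
    (hB : HasDerivAt B X 0) (hW : ∀ t, ∀ w ∈ W, B t *ᵥ w ∈ W) : ∀ w ∈ W, X *ᵥ w ∈ W := by
  intro w hw
  have h1 := hB.matrixMulVec (hasDerivAt_const (0 : ℝ) w)
  rw [Matrix.mulVec_zero, add_zero] at h1
  exact h1.mem_submodule W (Filter.Eventually.of_forall fun t => hW t w hw)

theorem submodule_eq_top_of_single_mem {W : Submodule ℝ R5}
    (h : ∀ i, (Pi.single i 1 : R5) ∈ W) : W = ⊤ := by
  refine eq_top_iff.2 fun w _ => ?_
  rw [pi_eq_sum_univ' w]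
  refine W.sum_mem fun i _ => W.smul_mem _ ?_
  convert h i using 1

/-- The isotropy generator Z lies in the generated algebra and has eigenvalues 0, ±i, ±2i, so an
invariant subspace that is not annihilated by the zeroth coordinate contains e₀, and e₀ is cyclic.
If that coordinate vanishes on W, invariance propagates the vanishing to all the others. -/
theorem spaceLike_irreducible {ε : ℝ} (hε : ε * ε = 1) (W : Submodule ℝ R5)
    (hW : ∀ a b, ∀ w ∈ W, spaceLikeMat ε a b 0 *ᵥ w ∈ W) : W = ⊥ ∨ W = ⊤ := by
  have hZ : ∀ w ∈ W, spaceLikeMat ε 0 0 1 *ᵥ w ∈ W := by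
    intro w hw
    have h1 := W.smul_mem (3 * ε) (W.sub_mem (hW 1 0 _ (hW 0 1 w hw)) (hW 0 1 _ (hW 1 0 w hw)))
    have h2 := W.neg_mem h1
    -- The bracket of the two tangential generators is -(ε/3)Z, so the second alternative holds.
    have key : ∀ x, x = (3 * ε) • (spaceLikeMat ε 1 0 0 *ᵥ spaceLikeMat ε 0 1 0 *ᵥ w -
        spaceLikeMat ε 0 1 0 *ᵥ spaceLikeMat ε 1 0 0 *ᵥ w) →
        spaceLikeMat ε 0 0 1 *ᵥ w = x ∨ spaceLikeMat ε 0 0 1 *ᵥ w = -x := by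
      rintro _ rfl
      right
      ext i
      fin_cases i <;> simp [spaceLikeMat, Matrix.mulVec, dotProduct, Fin.sum_univ_five] <;> grind
    rcases key _ rfl with h | h <;> rw [h] <;> assumption
  by_cases h0 : ∀ w ∈ W, w 0 = 0
  · left
    refine (Submodule.eq_bot_iff _).2 fun w hw => ?_
    have hε0 : ε ≠ 0 := left_ne_zero_of_mul_eq_one hε
    have h12 : ∀ w ∈ W, w 1 = 0 ∧ w 2 = 0 := by
      intro w hw
      have h1 := h0 _ (hW 1 0 w hw)
      have h2 := h0 _ (hW 0 1 w hw)
      simp [spaceLikeMat, Matrix.mulVec, dotProduct, Fin.sum_univ_five, hε0] at h1 h2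
      exact ⟨h1, h2⟩
    have h3 := h12 _ (hW 1 0 w hw)
    simp [spaceLikeMat, Matrix.mulVec, dotProduct, Fin.sum_univ_five, hε0, h0 w hw] at h3
    ext i
    fin_cases i <;> simp [h0 w hw, h12 w hw, h3]
  · right
    push Not at h0
    obtain ⟨w, hw, hw0⟩ := h0
    -- The operator (Z² + 1)(Z² + 4) = Z⁴ + 5Z² + 4 kills e₁, …, e₄ and multiplies e₀ by 4.
    have e0 : (Pi.single 0 1 : R5) ∈ W := by
      have h1 := hZ _ (hZ w hw)
      have h2 := hZ _ (hZ _ h1)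
      have h3 := W.smul_mem (1 / (4 * w 0)) (W.add_mem (W.add_mem h2 (W.smul_mem 5 h1))
        (W.smul_mem 4 hw))
      convert h3 using 1
      ext i
      fin_cases i <;> simp [spaceLikeMat, dotProduct, Fin.sum_univ_five] <;>
        field_simp <;> norm_num
    have e1 : (Pi.single 1 1 : R5) ∈ W := by
      convert hW 1 0 _ e0 using 1
      ext i
      fin_cases i <;> simp [spaceLikeMat]
    have e2 : (Pi.single 2 1 : R5) ∈ W := by
      convert hW 0 1 _ e0 using 1
      ext i
      fin_cases i <;> simp [spaceLikeMat]
    have e3 : (Pi.single 3 1 : R5) ∈ W := by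
      convert W.sub_mem (hW 1 0 _ e1) (W.smul_mem ε e0) using 1
      ext i
      fin_cases i <;> simp [spaceLikeMat]
    have e4 : (Pi.single 4 1 : R5) ∈ W := by
      convert hW 1 0 _ e2 using 1
      ext i
      fin_cases i <;> simp [spaceLikeMat]
    refine submodule_eq_top_of_single_mem fun i => ?_
    fin_cases i <;> assumption

/-- The same argument with the real weights 0, ±1, ±2 of Z. -/
theorem timeLike_irreducible (W : Submodule ℝ R5)
    (hW : ∀ a b, ∀ w ∈ W, timeLikeMat a b 0 *ᵥ w ∈ W) : W = ⊥ ∨ W = ⊤ := by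
  have hZ : ∀ w ∈ W, timeLikeMat 0 0 1 *ᵥ w ∈ W := by
    intro w hw
    have h1 := W.smul_mem 3 (W.sub_mem (hW 1 0 _ (hW 0 1 w hw)) (hW 0 1 _ (hW 1 0 w hw)))
    convert h1 using 1
    ext i
    fin_cases i <;> simp [timeLikeMat, Matrix.mulVec, dotProduct, Fin.sum_univ_five] <;> grind
  by_cases h0 : ∀ w ∈ W, w 0 = 0
  · left
    refine (Submodule.eq_bot_iff _).2 fun w hw => ?_
    have h12 : ∀ w ∈ W, w 1 = 0 ∧ w 2 = 0 := by
      intro w hw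
      have h1 := h0 _ (hW 1 0 w hw)
      have h2 := h0 _ (hW 0 1 w hw)
      simp [timeLikeMat, Matrix.mulVec, dotProduct, Fin.sum_univ_five] at h1 h2
      exact ⟨h2, h1⟩
    have h3 := (h12 _ (hW 0 1 w hw)).1
    have h4 := (h12 _ (hW 1 0 w hw)).2
    simp [timeLikeMat, Matrix.mulVec, dotProduct, Fin.sum_univ_five, h0 w hw] at h3 h4
    ext i
    fin_cases i <;> simp [h0 w hw, h12 w hw, h3, h4]
  · right
    push Not at h0
    obtain ⟨w, hw, hw0⟩ := h0
    -- The projector onto e₀ comes from (Z² - 1)(Z² - 4) = Z⁴ - 5Z² + 4.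
    have e0 : (Pi.single 0 1 : R5) ∈ W := by
      have h1 := hZ _ (hZ w hw)
      have h2 := hZ _ (hZ _ h1)
      have h3 := W.smul_mem (1 / (4 * w 0)) (W.add_mem (W.sub_mem h2 (W.smul_mem 5 h1))
        (W.smul_mem 4 hw))
      convert h3 using 1
      ext i
      fin_cases i <;> simp [timeLikeMat, dotProduct, Fin.sum_univ_five] <;>
        field_simp <;> norm_num
    have e1 : (Pi.single 1 1 : R5) ∈ W := by
      convert hW 1 0 _ e0 using 1
      ext i
      fin_cases i <;> simp [timeLikeMat]
    have e2 : (Pi.single 2 1 : R5) ∈ W := by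
      convert hW 0 1 _ e0 using 1
      ext i
      fin_cases i <;> simp [timeLikeMat]
    have e3 : (Pi.single 3 1 : R5) ∈ W := by
      convert hW 1 0 _ e1 using 1
      ext i
      fin_cases i <;> simp [timeLikeMat]
    have e4 : (Pi.single 4 1 : R5) ∈ W := by
      convert hW 0 1 _ e2 using 1
      ext i
      fin_cases i <;> simp [timeLikeMat]
    refine submodule_eq_top_of_single_mem fun i => ?_
    fin_cases i <;> assumption

/-! ### Representations -/

namespace QuadraticModel

variable (𝓜 : QuadraticModel)

theorem continuous_rep : Continuous 𝓜.rep := by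
  refine continuous_matrix fun i j => ?_
  have hq : Continuous 𝓜.q := 𝓜.q.continuous_of_finiteDimensional
  have h1 : (fun A => 𝓜.rep A i j) =
      fun A => 𝓜.q (A * (𝓜.σ (Pi.single j 1) * Aᵀ)) i := by
    funext A
    rw [← rep_mulVec, Matrix.mulVec_single_one]
    rfl
  rw [h1]
  refine (continuous_apply i).comp (hq.comp ?_)
  exact continuous_id.matrix_mul (continuous_const.matrix_mul continuous_id.matrix_transpose)

theorem transpose_mul_J_mul {A : Mat3} (hA : A * 𝓜.J * Aᵀ = 𝓜.J) : Aᵀ * 𝓜.J * A = 𝓜.J := by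
  have h1 := mul_eq_one_comm.1 (𝓜.mul_inv_eq_one hA)
  calc Aᵀ * 𝓜.J * A = 𝓜.J * 𝓜.J * (Aᵀ * 𝓜.J * A) := by rw [𝓜.J_mul_J, one_mul]
    _ = 𝓜.J * (𝓜.J * Aᵀ * 𝓜.J * A) := by simp only [mul_assoc]
    _ = 𝓜.J := by rw [h1, mul_one]

/-- A priori ASAᵀ = S only modulo J; the J-trace is invariant under A and removes the ambiguity. -/
theorem conj_eq_of_rep_eq_one {A : Mat3} (hA : A * 𝓜.J * Aᵀ = 𝓜.J) (h : 𝓜.rep A = 1) {S : Mat3}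
    (hS : Sᵀ = S) : A * S * Aᵀ = S := by
  have h1 := 𝓜.rep_mulVec_q hA hS
  rw [h, Matrix.one_mulVec, ← mul_assoc] at h1
  have h2 := 𝓜.σ_q (A * S * Aᵀ) (by
    rw [Matrix.transpose_mul, Matrix.transpose_mul, Matrix.transpose_transpose, hS, mul_assoc])
  have h3 : (𝓜.J * (A * S * Aᵀ)).trace = (𝓜.J * S).trace := by
    rw [← mul_assoc, Matrix.trace_mul_comm, ← mul_assoc, ← mul_assoc, 𝓜.transpose_mul_J_mul hA]
  rw [← h1, 𝓜.σ_q S hS, h3] at h2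
  exact (sub_left_inj.1 h2).symm

/-- Fixing the three diagonal units makes A diagonal with entries ±1, fixing two off-diagonal
symmetric matrices makes the signs agree, and the determinant then excludes -1. -/
theorem eq_one_of_rep_eq_one {A : Mat3} (hA : A * 𝓜.J * Aᵀ = 𝓜.J) (hdet : A.det = 1)
    (h : 𝓜.rep A = 1) : A = 1 := by
  have hS : ∀ a b c d e f : ℝ, A * !![a, b, c; b, d, e; c, e, f] * Aᵀ =
      !![a, b, c; b, d, e; c, e, f] := fun a b c d e f =>
    𝓜.conj_eq_of_rep_eq_one hA h (by ext i j; fin_cases i <;> fin_cases j <;> rfl)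
  have k0 := fun i j => congrFun (congrFun (hS 1 0 0 0 0 0) i) j
  have k1 := fun i j => congrFun (congrFun (hS 0 0 0 1 0 0) i) j
  have k2 := fun i j => congrFun (congrFun (hS 0 0 0 0 0 1) i) j
  have k3 := congrFun (congrFun (hS 0 1 0 0 0 0) 0) 1
  have k4 := congrFun (congrFun (hS 0 0 1 0 0 0) 0) 2
  have a1 := k0 1 1
  have a2 := k0 2 2
  have b0 := k1 0 0
  have b2 := k1 2 2
  have c0 := k2 0 0
  have c1 := k2 1 1
  have a0 := k0 0 0
  simp [Matrix.mul_apply, Fin.sum_univ_three] at a0 a1 a2 b0 b2 c0 c1 k3 k4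
  rw [Matrix.det_fin_three] at hdet
  simp only [a1, a2, b0, b2, c0, c1, mul_zero, zero_mul, sub_zero, add_zero, zero_add]
    at hdet k3 k4
  have d2 : A 2 2 = 1 := by grind
  have d0 : A 0 0 = 1 := by grind
  have d1 : A 1 1 = 1 := by grind
  ext i j
  fin_cases i <;> fin_cases j <;> simp [a1, a2, b0, b2, c0, c1, d0, d1, d2]

/-- The orbits of the representations of linear groups on trace free symmetric matrices. -/
theorem isIrreducibleOrbit_of {Γ : Type*} [Group Γ] [TopologicalSpace Γ] (τ : Γ →* Mat3)
    (hτ : Continuous τ) (hinj : Function.Injective τ)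
    (hJ : ∀ γ, τ γ * 𝓜.J * (τ γ)ᵀ = 𝓜.J) (hdet : ∀ γ, (τ γ).det = 1) {A : Plane → Mat3}
    {f : Plane → R5} (hf : ∀ x, f x = 𝓜.quad ((A x).col 0)) (hA : ∀ x, ∃ γ, τ γ = A x)
    (hirr : ∀ W : Submodule ℝ R5, (∀ x, ∀ w ∈ W, 𝓜.rep (A x) *ᵥ w ∈ W) → W = ⊥ ∨ W = ⊤)
    (horb : ∀ γ, ∃ x, (A x).col 0 = (τ γ).col 0) : IsIrreducibleOrbit Γ (Set.range f) := by
  let ρ₀ : Γ →* Mat5 :=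
    { toFun := fun γ => 𝓜.rep (τ γ)
      map_one' := by rw [map_one, rep_one]
      map_mul' := fun γ δ => by rw [map_mul, 𝓜.rep_mul (hJ γ)] }
  -- Continuity into the group of units also requires continuity of the inverse, which this formula
  -- makes visible.
  have hinv : ∀ γ, ρ₀ γ⁻¹ = 𝓜.rep (𝓜.J * (τ γ)ᵀ * 𝓜.J) := by
    intro γ
    have h1 : τ γ⁻¹ = 𝓜.J * (τ γ)ᵀ * 𝓜.J :=
      left_inv_eq_right_inv (by rw [← map_mul, inv_mul_cancel, map_one]) (𝓜.mul_inv_eq_one (hJ γ))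
    exact congrArg 𝓜.rep h1
  refine ⟨ρ₀.toHomUnits, ?_, ?_, ?_, ?_⟩
  · refine Units.continuous_iff.2 ⟨𝓜.continuous_rep.comp hτ, ?_⟩
    have h2 : (fun γ => ((ρ₀.toHomUnits γ)⁻¹ : GL (Fin 5) ℝ).val) =
        fun γ => 𝓜.rep (𝓜.J * (τ γ)ᵀ * 𝓜.J) := by
      funext γ
      rw [← map_inv]
      exact hinv γ
    rw [h2]
    exact 𝓜.continuous_rep.comp ((continuous_const.matrix_mul hτ.matrix_transpose).matrix_mul
      continuous_const)
  · refine (injective_iff_map_eq_one _).2 fun γ hγ => hinj ?_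
    rw [map_one]
    exact 𝓜.eq_one_of_rep_eq_one (hJ γ) (hdet γ) (congrArg Units.val hγ)
  · intro W hW
    refine hirr W fun x w hw => ?_
    obtain ⟨γ, hγ⟩ := hA x
    rw [← hγ]
    exact hW γ w hw
  · have h3 : ∀ γ, ((ρ₀.toHomUnits γ : GL (Fin 5) ℝ) : Mat5) *ᵥ (Pi.single 0 1 : R5) =
        𝓜.quad ((τ γ).col 0) := fun γ => 𝓜.rep_mulVec_single (hJ γ)
    ext y
    constructor
    · rintro ⟨x, rfl⟩
      obtain ⟨γ, hγ⟩ := hA x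
      exact ⟨γ, by rw [hf, ← hγ]; exact h3 γ⟩
    · rintro ⟨γ, rfl⟩
      obtain ⟨x, hx⟩ := horb γ
      exact ⟨x, by rw [hf, hx]; exact (h3 γ).symm⟩

/-- Only the velocities of A at the origin enter, where A = 1; they supply the two tangential
generators used for irreducibility. -/
theorem drep_mulVec_mem {A : Plane → Mat3} (hA0 : A 0 = 1) {w : Plane} {ξ : Mat3}
    (h : HasDerivAt (fun t : ℝ => A (0 + t • w)) (A 0 * ξ) 0) {W : Submodule ℝ R5}
    (hW : ∀ x, ∀ y ∈ W, 𝓜.rep (A x) *ᵥ y ∈ W) : ∀ y ∈ W, 𝓜.drep ξ *ᵥ y ∈ W := by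
  have h1 := 𝓜.hasDerivAt_rep (A := fun t : ℝ => A (0 + t • w)) (t := 0) (x := ξ)
    (by simp [hA0]) (by simpa using h)
  have h2 : 𝓜.rep (A (0 + (0 : ℝ) • w)) * 𝓜.drep ξ = 𝓜.drep ξ := by
    simp [hA0, 𝓜.rep_one]
  rw [h2] at h1
  exact mulVec_mem_of_hasDerivAt W h1 fun t => hW _

end QuadraticModel

/-! ### Parametrizations of the quadrics -/

theorem exists_cos_sin {a b : ℝ} (h : a ^ 2 + b ^ 2 = 1) : ∃ u, Real.cos u = a ∧ Real.sin u = b := by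
  have hn : ‖(⟨a, b⟩ : ℂ)‖ = 1 := by
    rw [Complex.norm_def, Complex.normSq_mk, ← sq, ← sq, h, Real.sqrt_one]
  refine ⟨Complex.arg ⟨a, b⟩, ?_, ?_⟩
  · simpa [hn] using Complex.norm_mul_cos_arg ⟨a, b⟩
  · simpa [hn] using Complex.norm_mul_sin_arg ⟨a, b⟩

theorem exists_hyperbolicRot {p : Fin 3 → ℝ} (h : p 0 ^ 2 - p 1 ^ 2 - p 2 ^ 2 = 1) (h0 : 0 < p 0) :
    ∃ x, (hyperbolicRot x).col 0 = p := by
  set v := Real.arsinh (p 2) with hv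
  have hs : Real.sinh v = p 2 := Real.sinh_arsinh _
  have hc := Real.cosh_pos v
  have hc2 := Real.cosh_sq v
  set u := Real.arsinh (p 1 / Real.cosh v) with hu
  have hsu : Real.sinh u * Real.cosh v = p 1 := by
    rw [hu, Real.sinh_arsinh]
    field_simp
  have hcu : Real.cosh u * Real.cosh v = p 0 := by
    have h1 := Real.cosh_sq u
    have h2 := Real.cosh_pos u
    refine (sq_eq_sq₀ (by positivity) h0.le).1 ?_
    rw [hs] at hc2
    calc _ = (Real.sinh u * Real.cosh v) ^ 2 + Real.cosh v ^ 2 := by rw [mul_pow, h1]; ring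
      _ = p 0 ^ 2 := by rw [hsu, hc2]; linarith
  refine ⟨!₂[u, v], ?_⟩
  ext i
  fin_cases i <;> simp [hyperbolicRot, hs, hsu, hcu]

theorem exists_lorentzianRot {p : Fin 3 → ℝ} (h : p 0 ^ 2 + p 1 ^ 2 - p 2 ^ 2 = 1) :
    ∃ x, (lorentzianRot x).col 0 = p := by
  set v := Real.arsinh (p 2) with hv
  have hs : Real.sinh v = p 2 := Real.sinh_arsinh _
  have hc := Real.cosh_pos v
  have hc2 := Real.cosh_sq v
  obtain ⟨u, hcu, hsu⟩ := exists_cos_sin (a := p 0 / Real.cosh v) (b := p 1 / Real.cosh v) (by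
    field_simp
    rw [hc2, hs]
    linarith)
  refine ⟨!₂[u, v], ?_⟩
  ext i
  fin_cases i <;> simp [lorentzianRot, hs, hsu, hcu] <;> field_simp

theorem exists_sphericalRot {p : Fin 3 → ℝ} (h : p 0 ^ 2 + p 1 ^ 2 + p 2 ^ 2 = 1) :
    ∃ x, (sphericalRot x).col 0 = p := by
  set v := Real.arcsin (p 2) with hv
  have hs : Real.sin v = p 2 := Real.sin_arcsin (by nlinarith [sq_nonneg (p 0), sq_nonneg (p 1)])
    (by nlinarith [sq_nonneg (p 0), sq_nonneg (p 1)])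
  have hc2 := Real.sin_sq_add_cos_sq v
  rw [hs] at hc2
  -- The poles, where the longitude is arbitrary and 0 is taken.
  by_cases hc : Real.cos v = 0
  · have h2 : p 0 ^ 2 + p 1 ^ 2 = 0 := by
      rw [hc] at hc2
      linarith
    have h0 : p 0 = 0 := by nlinarith [sq_nonneg (p 0), sq_nonneg (p 1)]
    have h1 : p 1 = 0 := by nlinarith [sq_nonneg (p 0), sq_nonneg (p 1)]
    refine ⟨!₂[0, v], ?_⟩
    ext i
    fin_cases i <;> simp [sphericalRot, hs, hc, h0, h1]
  · obtain ⟨u, hcu, hsu⟩ := exists_cos_sin (a := p 0 / Real.cos v) (b := p 1 / Real.cos v) (by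
      field_simp
      linarith)
    refine ⟨!₂[u, v], ?_⟩
    ext i
    fin_cases i <;> simp [sphericalRot, hs, hsu, hcu] <;> field_simp

/-! ### The three orbits -/

/-- The inclusion of the Lorentz group into the matrices. -/
def soPlusVal (k : Fin 3) : soPlus k →* Mat3 := (Units.coeHom _).comp (soPlus k).subtype

theorem soPlusVal_apply {k : Fin 3} (γ : soPlus k) : soPlusVal k γ = (γ : GL (Fin 3) ℝ).val := rfl

theorem continuous_soPlusVal (k : Fin 3) : Continuous (soPlusVal k) :=
  Units.continuous_val.comp continuous_subtype_val

theorem injective_soPlusVal (k : Fin 3) : Function.Injective (soPlusVal k) :=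
  Units.val_injective.comp Subtype.val_injective

theorem exists_soPlusVal_eq {k : Fin 3} {A : Mat3} (h1 : Aᵀ * lorentzForm k * A = lorentzForm k)
    (h2 : A.det = 1) (h3 : 0 < A k k) : ∃ γ, soPlusVal k γ = A := by
  have hu : IsUnit A := (Matrix.isUnit_iff_isUnit_det _).2 (by rw [h2]; exact isUnit_one)
  exact ⟨⟨hu.unit, h1, h2, h3⟩, rfl⟩

theorem hypModel_J : hypModel.J = -lorentzForm 0 := by
  ext i j
  fin_cases i <;> fin_cases j <;> simp [spaceLikeModel, lorentzForm]

theorem timeLikeModel_J : timeLikeModel.J = lorentzForm 2 := by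
  ext i j
  fin_cases i <;> fin_cases j <;> simp [timeLikeModel, lorentzForm]

theorem sphModel_J : sphModel.J = 1 := by
  ext i j
  fin_cases i <;> fin_cases j <;> simp [spaceLikeModel]

theorem isIrreducibleOrbit_hyperbolicModel :
    IsIrreducibleOrbit (soPlus 0) (Set.range hyperbolicModel) := by
  refine hypModel.isIrreducibleOrbit_of (soPlusVal 0) (continuous_soPlusVal 0)
    (injective_soPlusVal 0) (fun γ => ?_) (fun γ => γ.2.2.1) hyperbolicModel_eq (fun x => ?_)
    (fun W hW => spaceLike_irreducible (ε := 1) (by norm_num) W fun a b w hw => ?_) (fun γ => ?_)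
  · rw [hypModel_J, mul_neg, neg_mul, soPlusVal_apply, lorentz_transpose γ.2.1]
  · refine exists_soPlusVal_eq ?_ ?_ ?_
    · have h := hypModel.transpose_mul_J_mul (hyperbolicRot_mul x)
      rw [hypModel_J, mul_neg, neg_mul, neg_inj] at h
      exact h
    · have h0 := Real.cosh_sq (x 0)
      have h1 := Real.cosh_sq (x 1)
      rw [Matrix.det_fin_three]
      simp [hyperbolicRot]
      grind
    · have := Real.cosh_pos (x 0)
      have := Real.cosh_pos (x 1)
      simp [hyperbolicRot]
      positivity
  · have h := hypModel.drep_mulVec_mem (A := hyperbolicRot) (by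
      ext i j
      fin_cases i <;> fin_cases j <;> simp [hyperbolicRot])
      (hasDerivAt_hyperbolicRot 0 !₂[a / √3, b / √3]) hW w hw
    rw [spaceLikeModel_drep] at h
    convert h using 3 <;> simp <;> field_simp
  · have h := congrFun (congrFun γ.2.1 0) 0
    simp [Matrix.mul_apply, lorentzForm, Fin.sum_univ_three, Matrix.diagonal_apply] at h
    refine exists_hyperbolicRot ?_ γ.2.2.2
    simp only [Matrix.col_apply, soPlusVal_apply]
    linarith

theorem isIrreducibleOrbit_lorentzianModel :
    IsIrreducibleOrbit (soPlus 2) (Set.range lorentzianModel) := by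
  refine timeLikeModel.isIrreducibleOrbit_of (soPlusVal 2) (continuous_soPlusVal 2)
    (injective_soPlusVal 2) (fun γ => ?_) (fun γ => γ.2.2.1) lorentzianModel_eq (fun x => ?_)
    (fun W hW => timeLike_irreducible W fun a b w hw => ?_) (fun γ => ?_)
  · rw [timeLikeModel_J, soPlusVal_apply, lorentz_transpose γ.2.1]
  · refine exists_soPlusVal_eq ?_ ?_ ?_
    · have h := timeLikeModel.transpose_mul_J_mul (lorentzianRot_mul x)
      rw [timeLikeModel_J] at h
      exact h
    · have h0 := Real.sin_sq_add_cos_sq (x 0)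
      have h1 := Real.cosh_sq (x 1)
      rw [Matrix.det_fin_three]
      simp [lorentzianRot]
      grind
    · simpa [lorentzianRot] using Real.cosh_pos (x 1)
  · have h := timeLikeModel.drep_mulVec_mem (A := lorentzianRot) (by
      ext i j
      fin_cases i <;> fin_cases j <;> simp [lorentzianRot])
      (hasDerivAt_lorentzianRot 0 !₂[(a - b) / √6, (a + b) / √6]) hW w hw
    rw [timeLikeModel_drep] at h
    convert h using 3 <;> simp <;> field_simp <;> ring
  · have h := congrFun (congrFun γ.2.1 0) 0
    simp [Matrix.mul_apply, lorentzForm, Fin.sum_univ_three, Matrix.diagonal_apply] at h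
    refine exists_lorentzianRot ?_
    simp only [Matrix.col_apply, soPlusVal_apply]
    linarith

theorem isIrreducibleOrbit_sphericalModel :
    IsIrreducibleOrbit (Matrix.specialOrthogonalGroup (Fin 3) ℝ) (Set.range sphericalModel) := by
  have hO : ∀ γ : Matrix.specialOrthogonalGroup (Fin 3) ℝ, γ.1 * γ.1ᵀ = 1 := fun γ =>
    (Matrix.mem_orthogonalGroup_iff (Fin 3) ℝ).1 (Matrix.mem_specialOrthogonalGroup_iff.1 γ.2).1
  refine sphModel.isIrreducibleOrbit_of (Matrix.specialOrthogonalGroup (Fin 3) ℝ).subtype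
    continuous_subtype_val Subtype.val_injective (fun γ => ?_)
    (fun γ => (Matrix.mem_specialOrthogonalGroup_iff.1 γ.2).2) sphericalModel_eq (fun x => ?_)
    (fun W hW => spaceLike_irreducible (ε := -1) (by norm_num) W fun a b w hw => ?_) (fun γ => ?_)
  · rw [sphModel_J, mul_one]
    exact hO γ
  · refine ⟨⟨sphericalRot x, Matrix.mem_specialOrthogonalGroup_iff.2
      ⟨(Matrix.mem_orthogonalGroup_iff (Fin 3) ℝ).2 ?_, ?_⟩⟩, rfl⟩
    · have h := sphericalRot_mul x
      rw [sphModel_J, mul_one] at h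
      exact h
    · have h0 := Real.sin_sq_add_cos_sq (x 0)
      have h1 := Real.sin_sq_add_cos_sq (x 1)
      rw [Matrix.det_fin_three]
      simp [sphericalRot]
      grind
  · have h := sphModel.drep_mulVec_mem (A := sphericalRot) (by
      ext i j
      fin_cases i <;> fin_cases j <;> simp [sphericalRot])
      (hasDerivAt_sphericalRot 0 !₂[a / √3, b / √3]) hW w hw
    rw [spaceLikeModel_drep] at h
    convert h using 3 <;> simp <;> field_simp
  · have h1 : γ.1ᵀ * γ.1 = 1 := mul_eq_one_comm.1 (hO γ)
    have h := congrFun (congrFun h1 0) 0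
    simp [Matrix.mul_apply, Fin.sum_univ_three] at h
    refine exists_sphericalRot ?_
    simp only [Matrix.col_apply, Submonoid.coe_subtype]
    linarith

end

noncomputable section

/-! ### Fibres of the quadratic maps -/

theorem eq_or_eq_neg_of_vecMulVec_eq {p p' : Fin 3 → ℝ}
    (h : Matrix.vecMulVec p p = Matrix.vecMulVec p' p') : p = p' ∨ p = -p' := by
  have h' : ∀ i j, p i * p j = p' i * p' j := fun i j => congrFun (congrFun h i) j
  by_cases h0 : p = 0
  · left
    ext i
    have h1 := h' i i
    rw [h0] at h1 ⊢
    simpa [eq_comm] using h1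
  · obtain ⟨i, hi⟩ := Function.ne_iff.1 h0
    rw [Pi.zero_apply] at hi
    rcases mul_self_eq_mul_self_iff.1 (h' i i) with h1 | h1
    · left
      ext j
      have h2 := h' i j
      rw [← h1] at h2
      exact mul_left_cancel₀ hi h2
    · right
      ext j
      have h2 := h' i j
      rw [eq_neg_iff_add_eq_zero, add_comm, ← eq_neg_iff_add_eq_zero] at h1
      rw [h1, neg_mul, ← mul_neg] at h2
      exact mul_left_cancel₀ hi h2

/-- The equality of J-traces lets ppᵀ be recovered from its class modulo J, and ppᵀ determines p up
to sign. -/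
theorem QuadraticModel.quad_eq_iff (𝓜 : QuadraticModel) {p p' : Fin 3 → ℝ}
    (h : (𝓜.J * Matrix.vecMulVec p p).trace = (𝓜.J * Matrix.vecMulVec p' p').trace) :
    𝓜.quad p = 𝓜.quad p' ↔ p = p' ∨ p = -p' := by
  constructor
  · intro hq
    refine eq_or_eq_neg_of_vecMulVec_eq ?_
    have h1 := congrArg 𝓜.σ hq
    rw [QuadraticModel.quad, QuadraticModel.quad, 𝓜.σ_q _ (Matrix.transpose_vecMulVec _ _),
      𝓜.σ_q _ (Matrix.transpose_vecMulVec _ _), h] at h1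
    exact sub_left_inj.1 h1
  · rintro (rfl | rfl)
    · rfl
    · simp [QuadraticModel.quad]

/-! ### The hyperbolic plane -/

/-- An explicit continuous left inverse exists: with p = (p₀, p₁, p₂) on the hyperboloid, the first
coordinate of the model gives p₀ > 0, the next two then give p₁ and p₂, and `arsinh` recovers v and
u. -/
theorem isEmbedding_hyperbolicModel : Topology.IsEmbedding hyperbolicModel := by
  -- On the surface this is p₀ = cosh u cosh v ≥ 1; the maximum keeps the denominators nonzero on
  -- all of ℝ⁵ without changing the value there.
  let P : R5 → ℝ := fun y => √(max 1 ((2 * y 0 + 1) / 3))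
  have hP : Continuous P := by fun_prop
  have hP0 : ∀ y, P y ≠ 0 := fun y => (Real.sqrt_pos.2 (by positivity)).ne'
  have h3 : √3 ≠ 0 := by positivity
  let v : R5 → ℝ := fun y => Real.arsinh (y 2 / (√3 * P y))
  have hv : Continuous v := Real.continuous_arsinh.comp
    ((continuous_apply 2).div (by fun_prop) fun y => mul_ne_zero h3 (hP0 y))
  let w : R5 → ℝ := fun y => Real.arsinh (y 1 / (√3 * P y) / Real.cosh (v y))
  have hw : Continuous w := Real.continuous_arsinh.comp
    (((continuous_apply 1).div (by fun_prop) fun y => mul_ne_zero h3 (hP0 y)).div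
      (Real.continuous_cosh.comp hv) fun y => (Real.cosh_pos _).ne')
  have hg : Continuous fun y => (!₂[w y, v y] : Plane) := by
    refine (PiLp.continuous_toLp 2 _).comp (continuous_pi fun i => ?_)
    fin_cases i
    · exact hw
    · exact hv
  refine Function.LeftInverse.isEmbedding (f := fun y => (!₂[w y, v y] : Plane)) (fun x => ?_) hg
    isCentroaffineImmersion_hyperbolicModel.1.continuous
  have c0 := Real.one_le_cosh (x 0)
  have c1 := Real.one_le_cosh (x 1)
  have c01 : 1 ≤ Real.cosh (x 0) * Real.cosh (x 1) := one_le_mul_of_one_le_of_one_le c0 c1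
  have hPx : P (hyperbolicModel x) = Real.cosh (x 0) * Real.cosh (x 1) := by
    have h1 : (2 * hyperbolicModel x 0 + 1) / 3 = (Real.cosh (x 0) * Real.cosh (x 1)) ^ 2 := by
      simp [hyperbolicModel]
      ring
    simp only [P]
    rw [h1, max_eq_right (by nlinarith), Real.sqrt_sq (by positivity)]
  have hvx : v (hyperbolicModel x) = x 1 := by
    simp only [v, hPx]
    rw [← Real.arsinh_sinh (x 1)]
    congr 1
    simp [hyperbolicModel]
    field_simp
  have hwx : w (hyperbolicModel x) = x 0 := by
    simp only [w, hPx, hvx]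
    rw [← Real.arsinh_sinh (x 0)]
    congr 1
    simp [hyperbolicModel]
    field_simp
  ext i
  fin_cases i
  · exact hwx
  · exact hvx

/-! ### The sphere -/

/-- The quadratic map of the spherical model. -/
def sphereQuad (y : EuclideanSpace ℝ (Fin 3)) : R5 := sphModel.quad fun i => y i

theorem sphereQuad_eq (y : EuclideanSpace ℝ (Fin 3)) : sphereQuad y =
    ![y 0 ^ 2 - (y 1 ^ 2 + y 2 ^ 2) / 2, √3 * (y 0 * y 1), √3 * (y 0 * y 2),
      3 / 2 * (y 1 ^ 2 - y 2 ^ 2), 3 * (y 1 * y 2)] := by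
  rw [sphereQuad, spaceLikeModel_quad]
  ext i
  fin_cases i <;> simp
  ring

theorem contDiff_sphereQuad : ContDiff ℝ ∞ sphereQuad := by
  refine contDiff_pi.2 fun i => ?_
  simp only [sphereQuad_eq]
  fin_cases i <;> simp <;> fun_prop

theorem fderiv_sphereQuad (p y : EuclideanSpace ℝ (Fin 3)) : fderiv ℝ sphereQuad p y =
    ![2 * (p 0 * y 0) - (p 1 * y 1 + p 2 * y 2), √3 * (p 0 * y 1 + p 1 * y 0),
      √3 * (p 0 * y 2 + p 2 * y 0), 3 * (p 1 * y 1 - p 2 * y 2),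
      3 * (p 1 * y 2 + p 2 * y 1)] := by
  have hl : HasDerivAt (fun t : ℝ => p + t • y) y 0 := by
    simpa using ((hasDerivAt_id (0 : ℝ)).smul_const y).const_add p
  have hc : ∀ i : Fin 3, HasDerivAt (fun t : ℝ => p i + t * y i) (y i) 0 := fun i => by
    simpa using ((hasDerivAt_id (0 : ℝ)).mul_const (y i)).const_add (p i)
  have h0 : HasFDerivAt sphereQuad (fderiv ℝ sphereQuad p) (p + (0 : ℝ) • y) := by
    simpa using (contDiff_sphereQuad.differentiable (by simp) p).hasFDerivAt
  refine (h0.comp_hasDerivAt (0 : ℝ) hl).unique (hasDerivAt_pi.2 fun i => ?_)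
  simp only [Function.comp_apply, sphereQuad_eq]
  fin_cases i <;> simp
  · refine (((hc 0).pow 2).sub ((((hc 1).pow 2).add ((hc 2).pow 2)).div_const 2)).congr_deriv ?_
    simp
    ring
  · refine (((hc 0).mul (hc 1)).const_mul √3).congr_deriv ?_
    simp
    ring
  · refine (((hc 0).mul (hc 2)).const_mul √3).congr_deriv ?_
    simp
    ring
  · refine ((((hc 1).pow 2).sub ((hc 2).pow 2)).const_mul (3 / 2)).congr_deriv ?_
    simp
    ring
  · refine (((hc 1).mul (hc 2)).const_mul 3).congr_deriv ?_
    simp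
    ring

/-- A kernel vector y makes pyᵀ + ypᵀ a multiple of the identity. The multiple is zero because the
symmetrized product has rank at most 2; then every product pᵢyⱼ vanishes, and |p| = 1 gives y = 0.
-/
theorem fderiv_sphereQuad_injective {p : EuclideanSpace ℝ (Fin 3)}
    (hp : p 0 ^ 2 + p 1 ^ 2 + p 2 ^ 2 = 1) : Function.Injective (fderiv ℝ sphereQuad p) := by
  refine (injective_iff_map_eq_zero _).2 fun y hy => ?_
  rw [fderiv_sphereQuad] at hy
  have h0 := congrFun hy 0
  have h1 := congrFun hy 1
  have h2 := congrFun hy 2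
  have h3 := congrFun hy 3
  have h4 := congrFun hy 4
  simp at h0 h1 h2 h3 h4
  have k1 : p 1 * y 1 = p 0 * y 0 := by linarith
  have k2 : p 2 * y 2 = p 0 * y 0 := by linarith
  have k0 : p 0 * y 0 = 0 := by
    have : (p 0 * y 0) ^ 2 + (p 0 * y 1) ^ 2 = 0 := by
      linear_combination (p 0 * y 1) * h1 - (p 0 * y 0) * k1
    nlinarith [sq_nonneg (p 0 * y 0), sq_nonneg (p 0 * y 1)]
  rw [k0] at k1 k2
  have a01 : (p 0 * y 1) ^ 2 = 0 := by linear_combination (p 0 * y 1) * h1 - (p 0 * y 0) * k1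
  have a02 : (p 0 * y 2) ^ 2 = 0 := by linear_combination (p 0 * y 2) * h2 - (p 0 * y 0) * k2
  have a12 : (p 1 * y 2) ^ 2 = 0 := by linear_combination (p 1 * y 2) * h4 - (p 1 * y 1) * k2
  have a10 : (p 1 * y 0) ^ 2 = 0 := by linear_combination (p 1 * y 0) * h1 - (p 1 * y 1) * k0
  have a20 : (p 2 * y 0) ^ 2 = 0 := by linear_combination (p 2 * y 0) * h2 - (p 2 * y 2) * k0
  have a21 : (p 2 * y 1) ^ 2 = 0 := by linear_combination (p 2 * y 1) * h4 - (p 2 * y 2) * k1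
  ext i
  show y i = 0
  rw [← sq_eq_zero_iff]
  fin_cases i
  · show y 0 ^ 2 = 0
    linear_combination (-(y 0 ^ 2)) * hp + a10 + a20 + p 0 * y 0 * k0
  · show y 1 ^ 2 = 0
    linear_combination (-(y 1 ^ 2)) * hp + a01 + a21 + p 1 * y 1 * k1
  · show y 2 ^ 2 = 0
    linear_combination (-(y 2 ^ 2)) * hp + a02 + a12 + p 2 * y 2 * k2

theorem sq_sum_eq_one (p : Metric.sphere (0 : EuclideanSpace ℝ (Fin 3)) 1) :
    p.1 0 ^ 2 + p.1 1 ^ 2 + p.1 2 ^ 2 = 1 := by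
  have h1 : ‖p.1‖ ^ 2 = 1 := by
    rw [norm_eq_of_mem_sphere, one_pow]
  rw [EuclideanSpace.norm_sq_eq, Fin.sum_univ_three] at h1
  simpa using h1

/-- The immersion of the sphere. -/
def sphereImmersion (p : Metric.sphere (0 : EuclideanSpace ℝ (Fin 3)) 1) : R5 := sphereQuad p.1

theorem isCentroaffineImmersion_sphereImmersion : IsCentroaffineImmersion sphereImmersion := by
  have : Fact (Module.finrank ℝ (EuclideanSpace ℝ (Fin 3)) = 2 + 1) := ⟨by simp⟩
  have hcoe : ContMDiff (𝓡 2) 𝓘(ℝ, EuclideanSpace ℝ (Fin 3)) ∞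
      ((↑) : Metric.sphere (0 : EuclideanSpace ℝ (Fin 3)) 1 → EuclideanSpace ℝ (Fin 3)) :=
    contMDiff_coe_sphere (n := 2)
  have hQ := contMDiff_iff_contDiff.2 contDiff_sphereQuad
  have key : ∀ (p : Metric.sphere (0 : EuclideanSpace ℝ (Fin 3)) 1) (v : TangentSpace (𝓡 2) p),
      (mfderiv (𝓡 2) 𝓘(ℝ, R5) sphereImmersion p v : R5) = fderiv ℝ sphereQuad p.1
        (mfderiv (𝓡 2) 𝓘(ℝ, EuclideanSpace ℝ (Fin 3))
          ((↑) : Metric.sphere (0 : EuclideanSpace ℝ (Fin 3)) 1 → EuclideanSpace ℝ (Fin 3)) p v) := by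
    intro p v
    have h1 := mfderiv_comp_apply p ((hQ p.1).mdifferentiableAt (by simp))
      ((hcoe p).mdifferentiableAt (by simp)) v
    rw [mfderiv_eq_fderiv] at h1
    exact h1
  refine ⟨hQ.comp hcoe, fun p => ⟨fun v w h => ?_, fun v hv => ?_⟩⟩
  · have h1 := ((key p v).symm.trans h).trans (key p w)
    exact injective_mvfderiv_subtypeVal_sphere (n := 2) p (fderiv_sphereQuad_injective (sq_sum_eq_one p) h1)
  · have h1 := (key p v).symm.trans hv
    -- Euler's identity for a homogeneous quadratic map. If f(p) were tangent, injectivity would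
    -- make the normal vector p/2 tangent to the sphere.
    have h2 : sphereImmersion p = fderiv ℝ sphereQuad p.1 ((1 / 2 : ℝ) • p.1) := by
      rw [fderiv_sphereQuad, sphereImmersion, sphereQuad_eq]
      ext i
      fin_cases i <;> simp <;> ring
    have h3 := fderiv_sphereQuad_injective (sq_sum_eq_one p) (h1.trans h2)
    have h4 : (1 / 2 : ℝ) • p.1 ∈ (ℝ ∙ p.1)ᗮ := by
      rw [← range_mvfderiv_subtypeVal (n := 2), ← h3]
      exact ⟨v, rfl⟩
    rw [Submodule.mem_orthogonal_singleton_iff_inner_right, inner_smul_right,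
      real_inner_self_eq_norm_sq, norm_eq_of_mem_sphere] at h4
    norm_num at h4

theorem sphereImmersion_eq_iff (p q : Metric.sphere (0 : EuclideanSpace ℝ (Fin 3)) 1) :
    sphereImmersion p = sphereImmersion q ↔ p = q ∨ p = -q := by
  have h1 := sq_sum_eq_one p
  have h2 := sq_sum_eq_one q
  refine (sphModel.quad_eq_iff ?_).trans (or_congr ?_ ?_)
  · simp [sphModel_J, dotProduct, Fin.sum_univ_three]
    linarith
  · refine ⟨fun h => ?_, fun h => by rw [h]⟩
    ext i
    exact congrFun h i
  · refine ⟨fun h => ?_, fun h => by rw [h]; rfl⟩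
    ext i
    exact congrFun h i

theorem sphericalModel_eq_sphereImmersion (x : Plane)
    (p : Metric.sphere (0 : EuclideanSpace ℝ (Fin 3)) 1)
    (h : (p : EuclideanSpace ℝ (Fin 3)) = sphereParam x) : sphericalModel x = sphereImmersion p := by
  rw [sphericalModel_eq, sphereImmersion, sphereQuad, h]
  congr 1
  ext i
  fin_cases i <;> simp [sphericalRot, sphereParam]

/-! ### The Lorentzian surface -/

theorem hyperboloidParam_eq (x : Plane) : hyperboloidParam x = √3 • (lorentzianRot x).col 0 := by
  ext i
  fin_cases i <;> simp [hyperboloidParam, lorentzianRot]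

theorem lorentzianRot_col_sq (x : Plane) : (lorentzianRot x).col 0 0 ^ 2 +
    (lorentzianRot x).col 0 1 ^ 2 - (lorentzianRot x).col 0 2 ^ 2 = 1 := by
  have h0 := Real.sin_sq_add_cos_sq (x 0)
  have h1 := Real.cosh_sq (x 1)
  simp [lorentzianRot]
  grind

theorem lorentzianModel_eq_iff (x y : Plane) : lorentzianModel x = lorentzianModel y ↔
    (lorentzianRot x).col 0 = (lorentzianRot y).col 0 ∨
      (lorentzianRot x).col 0 = -(lorentzianRot y).col 0 := by
  rw [lorentzianModel_eq, lorentzianModel_eq]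
  refine timeLikeModel.quad_eq_iff ?_
  have hx := lorentzianRot_col_sq x
  have hy := lorentzianRot_col_sq y
  have h : ∀ p : Fin 3 → ℝ, (timeLikeModel.J * Matrix.vecMulVec p p).trace =
      p 0 ^ 2 + p 1 ^ 2 - p 2 ^ 2 := by
    intro p
    simp [timeLikeModel, Matrix.trace_fin_three, Fin.sum_univ_three,
      Matrix.vecMulVec_apply, Matrix.vecMul, dotProduct]
    ring
  rw [h, h, hx, hy]

theorem lorentzianModel_eq_iff_hyperboloidParam (x y : Plane) :
    lorentzianModel x = lorentzianModel y ↔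
      hyperboloidParam x = hyperboloidParam y ∨ hyperboloidParam x = -hyperboloidParam y := by
  have h3 : √3 ≠ 0 := by positivity
  rw [lorentzianModel_eq_iff, hyperboloidParam_eq, hyperboloidParam_eq, ← smul_neg,
    (smul_right_injective _ h3).eq_iff, (smul_right_injective _ h3).eq_iff]

theorem lorentzianRot_col_eq_iff (x y : Plane) :
    (lorentzianRot x).col 0 = (lorentzianRot y).col 0 ↔
      Real.cos (x 0) = Real.cos (y 0) ∧ Real.sin (x 0) = Real.sin (y 0) ∧ x 1 = y 1 := by
  constructor
  · intro h
    have h0 := congrFun h 0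
    have h1 := congrFun h 1
    have h2 := congrFun h 2
    simp [lorentzianRot] at h0 h1 h2
    rw [h2] at h0 h1
    have hc := (Real.cosh_pos (y 1)).ne'
    exact ⟨mul_right_cancel₀ hc h0, mul_right_cancel₀ hc h1, h2⟩
  · rintro ⟨h0, h1, h2⟩
    ext i
    fin_cases i <;> simp [lorentzianRot, h0, h1, h2]

theorem lorentzianRot_col_neg (x : Plane) (n : ℤ) :
    (lorentzianRot !₂[x 0 + n * Real.pi, (-1) ^ n * x 1]).col 0 =
      (-1 : ℝ) ^ n • (lorentzianRot x).col 0 := by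
  rcases Int.even_or_odd n with h | h
  · ext i
    fin_cases i <;> simp [lorentzianRot, h.neg_one_zpow, Real.cos_add_int_mul_pi,
      Real.sin_add_int_mul_pi]
  · ext i
    fin_cases i <;> simp [lorentzianRot, h.neg_one_zpow, Real.cos_add_int_mul_pi,
      Real.sin_add_int_mul_pi]

theorem lorentzianModel_eq_iff_exists_int (x y : Plane) :
    lorentzianModel x = lorentzianModel y ↔
      ∃ n : ℤ, y 0 = x 0 + n * Real.pi ∧ y 1 = (-1) ^ n * x 1 := by
  rw [lorentzianModel_eq_iff]
  constructor
  · have key : ∀ m : ℤ, (lorentzianRot y).col 0 =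
        (lorentzianRot !₂[x 0 + m * Real.pi, (-1) ^ m * x 1]).col 0 →
        ∃ n : ℤ, y 0 = x 0 + n * Real.pi ∧ y 1 = (-1) ^ n * x 1 := by
      intro m h
      obtain ⟨h0, h1, h2⟩ := (lorentzianRot_col_eq_iff _ _).1 h
      obtain ⟨k, hk⟩ := Real.Angle.angle_eq_iff_two_pi_dvd_sub.1 (Real.Angle.cos_sin_inj h0 h1)
      refine ⟨2 * k + m, ?_, ?_⟩
      · simp at hk
        push_cast
        linarith
      · rw [h2, zpow_add₀ (by norm_num), zpow_mul]
        simp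
    rintro (h | h)
    · refine key 0 ?_
      rw [lorentzianRot_col_neg, ← h]
      simp
    · refine key 1 ?_
      rw [lorentzianRot_col_neg, h]
      simp
  · rintro ⟨n, h0, h1⟩
    have hy : y = !₂[x 0 + n * Real.pi, (-1) ^ n * x 1] := by
      ext i
      fin_cases i
      · exact h0
      · exact h1
    rw [hy, lorentzianRot_col_neg]
    rcases Int.even_or_odd n with h | h
    · left
      simp [h.neg_one_zpow]
    · right
      simp [h.neg_one_zpow]

theorem range_hyperboloidParam : Set.range hyperboloidParam = oneSheetHyperboloid := by
  have h3 : √3 * √3 = 3 := Real.mul_self_sqrt (by norm_num)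
  have h3' : √3 ≠ 0 := by positivity
  ext p
  constructor
  · rintro ⟨x, rfl⟩
    have hx := lorentzianRot_col_sq x
    simp only [hyperboloidParam_eq, oneSheetHyperboloid, Set.mem_ofPred_eq, Pi.smul_apply,
      smul_eq_mul]
    linear_combination 3 * hx + ((lorentzianRot x).col 0 0 ^ 2 +
      (lorentzianRot x).col 0 1 ^ 2 - (lorentzianRot x).col 0 2 ^ 2) * h3
  · intro hp
    have hp' : p 0 ^ 2 + p 1 ^ 2 - p 2 ^ 2 = 3 := hp
    obtain ⟨x, hx⟩ := exists_lorentzianRot (p := (√3)⁻¹ • p) (by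
      simp only [Pi.smul_apply, smul_eq_mul, mul_pow]
      rw [← mul_add, ← mul_sub, hp', inv_pow, sq, h3]
      norm_num)
    exact ⟨x, by rw [hyperboloidParam_eq, hx, smul_inv_smul₀ h3']⟩

/-- The strip 0 ≤ u ≤ π already covers the surface, and there the map is proper, hence closed onto
its image. A quotient map obtained after restriction forces the full map to be one. -/
theorem isQuotientMap_lorentzianModel :
    Topology.IsQuotientMap (Set.rangeFactorization lorentzianModel) := by
  have hcont : Continuous lorentzianModel := isCentroaffineImmersion_lorentzianModel.1.continuous
  let j : Set.Icc 0 Real.pi × ℝ → Plane := fun z => !₂[(z.1 : ℝ), z.2]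
  have hj : Continuous j := by
    refine (PiLp.continuous_toLp 2 _).comp (continuous_pi fun i => ?_)
    fin_cases i
    · exact continuous_subtype_val.comp continuous_fst
    · exact continuous_snd
  have hproper : IsProperMap (lorentzianModel ∘ j) := by
    rw [isProperMap_iff_isCompact_preimage]
    refine ⟨hcont.comp hj, fun S hS => ?_⟩
    -- On the surface y₃ + y₄ = 3/2 · (p₁² + p₂²) with p₂ = sinh v, so a bound on it bounds v.
    obtain ⟨R, hR⟩ := (hS.image (f := fun y : R5 => y 3 + y 4) (by fun_prop)).bddAbove
    refine IsCompact.of_isClosed_subset (isCompact_univ.prod (isCompact_Icc (a := -(|R| + 1))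
      (b := |R| + 1))) (hS.isClosed.preimage (hcont.comp hj)) ?_
    rintro ⟨u, v⟩ hz
    have h1 : lorentzianModel (j (u, v)) 3 + lorentzianModel (j (u, v)) 4 ≤ R :=
      hR ⟨_, hz, rfl⟩
    rw [lorentzianModel_eq, timeLikeModel_quad] at h1
    have h2 : 3 / 2 * Real.sinh v ^ 2 ≤ R := by
      refine le_trans ?_ h1
      simp [lorentzianRot, j]
      nlinarith [sq_nonneg (Real.sin u * Real.cosh v)]
    have h3 : v ^ 2 ≤ Real.sinh v ^ 2 := by
      rw [sq_le_sq, Real.abs_sinh]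
      exact Real.self_le_sinh_iff.2 (abs_nonneg _)
    have h4 : |v| ≤ |R| + 1 := by
      nlinarith [le_abs_self R, abs_nonneg R, sq_abs v, abs_nonneg v]
    exact ⟨trivial, abs_le.1 h4⟩
  have hq : Topology.IsQuotientMap (Set.rangeFactorization lorentzianModel ∘ j) := by
    refine IsClosedMap.isQuotientMap ?_ (hcont.rangeFactorization.comp hj) ?_
    · intro C hC
      have h1 := (hproper.isClosedMap C hC).preimage
        (continuous_subtype_val : Continuous (Subtype.val : Set.range lorentzianModel → R5))
      convert h1 using 1
      ext y
      constructor
      · rintro ⟨z, hz, rfl⟩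
        exact ⟨z, hz, rfl⟩
      · rintro ⟨z, hz, h⟩
        exact ⟨z, hz, Subtype.ext h⟩
    · rintro ⟨_, x, rfl⟩
      -- A deck transformation (u, v) ↦ (u + nπ, (-1)ⁿv) brings the point into the strip.
      obtain ⟨n, hn, -⟩ := existsUnique_add_zsmul_mem_Ico Real.pi_pos (x 0) 0
      rw [zero_add, zsmul_eq_mul] at hn
      refine ⟨(⟨x 0 + n * Real.pi, hn.1, hn.2.le⟩, (-1) ^ n * x 1), Subtype.ext ?_⟩
      exact ((lorentzianModel_eq_iff_exists_int _ _).2 ⟨n, rfl, rfl⟩).symm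
  exact Topology.IsQuotientMap.of_comp hj hcont.rangeFactorization hq

end

noncomputable section

attribute [local instance] Matrix.linftyOpNormedRing Matrix.linftyOpNormedAlgebra

/-! ### Vectors annihilated by the equivariant maps -/

/-- TJ is an idempotent of trace 1, hence of rank one, and so is T. A symmetric rank-one matrix is
±ppᵀ. -/
theorem exists_eq_vecMulVec_of_idempotent {T J : Mat3} (hT : Tᵀ = T) (hJ : J * J = 1)
    (h1 : T * J * T = T) (h2 : (J * T).trace = 1) :
    ∃ p : Fin 3 → ℝ, T = Matrix.vecMulVec p p ∨ T = -Matrix.vecMulVec p p := by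
  have hP : T * J * (T * J) = T * J := by rw [← mul_assoc, h1]
  have htr : (T * J).trace = 1 := by rw [Matrix.trace_mul_comm, h2]
  -- Rank at most one is expressed by the vanishing of all 2 × 2 minors.
  have hadj : (T * J).adjugate = 0 := by
    generalize T * J = P at hP htr
    have e := fun i j => congrFun (congrFun hP i) j
    simp only [Matrix.mul_apply, Fin.sum_univ_three, Fin.forall_fin_succ, IsEmpty.forall_iff,
      and_true, Fin.succ_zero_eq_one, Fin.succ_one_eq_two] at e
    rw [Matrix.trace_fin_three] at htr
    rw [Matrix.adjugate_fin_three]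
    obtain ⟨⟨e1, e2, e3⟩, ⟨e4, e5, e6⟩, e7, e8, e9⟩ := e
    ext i j
    fin_cases i <;> fin_cases j <;> simp at * <;> grind
  have hadjT : T.adjugate = 0 := by
    have h3 : T = T * J * J := by rw [mul_assoc, hJ, mul_one]
    rw [h3, Matrix.adjugate_mul_distrib, hadj, mul_zero]
  have hsym : ∀ i j, T j i = T i j := fun i j => congrFun (congrFun hT i) j
  have hm : ∀ i j k, T i i * T j k = T i j * T i k := by
    have e := fun i j => congrFun (congrFun hadjT i) j
    simp only [Matrix.adjugate_fin_three, Fin.forall_fin_succ, IsEmpty.forall_iff,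
      and_true, Fin.succ_zero_eq_one, Fin.succ_one_eq_two] at e
    simp at e
    obtain ⟨⟨e1, e2, e3⟩, ⟨e4, e5, e6⟩, e7, e8, e9⟩ := e
    have s1 := hsym 0 1
    have s2 := hsym 0 2
    have s3 := hsym 1 2
    intro i j k
    fin_cases i <;> fin_cases j <;> fin_cases k <;> simp <;> grind
  obtain ⟨i, hi⟩ : ∃ i, T i i ≠ 0 := by
    by_contra! hc
    have h0 : T = 0 := by
      ext i j
      have h4 := hm i j j
      rw [hc i, zero_mul, eq_comm, mul_self_eq_zero] at h4
      exact h4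
    simp [h0] at h2
  have hi0 : (0 : ℝ) < |T i i| := abs_pos.2 hi
  have hs : √|T i i| * √|T i i| = |T i i| := Real.mul_self_sqrt hi0.le
  have hs0 : √|T i i| ≠ 0 := (Real.sqrt_pos.2 hi0).ne'
  -- A row through a nonzero diagonal entry, normalized; the sign of that entry decides between ppᵀ
  -- and -ppᵀ.
  refine ⟨fun j => T i j / √|T i i|, ?_⟩
  rcases lt_or_gt_of_ne hi with hlt | hgt
  · right
    ext j k
    rw [abs_of_neg hlt] at hs hs0 ⊢
    rw [Matrix.neg_apply, Matrix.vecMulVec_apply, div_mul_div_comm, hs, ← hm i j k]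
    field_simp
  · left
    ext j k
    rw [abs_of_pos hgt] at hs hs0 ⊢
    rw [Matrix.vecMulVec_apply, div_mul_div_comm, hs, ← hm i j k]
    field_simp

/-! ### The covariant and the invariant that cut out the quadric images -/

namespace QuadraticModel

variable (𝓜 : QuadraticModel)

theorem J_mul_add {x : Mat3} (hx : x * 𝓜.J + 𝓜.J * xᵀ = 0) : 𝓜.J * x + xᵀ * 𝓜.J = 0 := by
  have h1 : 𝓜.J * (x * 𝓜.J + 𝓜.J * xᵀ) * 𝓜.J = 𝓜.J * x + xᵀ * 𝓜.J := by
    rw [mul_add, add_mul, ← mul_assoc 𝓜.J 𝓜.J, 𝓜.J_mul_J, one_mul, ← mul_assoc, mul_assoc _ 𝓜.J,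
      𝓜.J_mul_J, mul_one]
  rw [← h1, hx, mul_zero, zero_mul]

theorem drep_mulVec_q {x : Mat3} (hx : x * 𝓜.J + 𝓜.J * xᵀ = 0) {S : Mat3} (hS : Sᵀ = S) :
    𝓜.drep x *ᵥ 𝓜.q S = 𝓜.q (x * S + S * xᵀ) := by
  rw [drep_mulVec, 𝓜.σ_q S hS]
  have h1 : x * (S - ((𝓜.J * S).trace / 3) • 𝓜.J) + (S - ((𝓜.J * S).trace / 3) • 𝓜.J) * xᵀ =
      x * S + S * xᵀ - ((𝓜.J * S).trace / 3) • (x * 𝓜.J + 𝓜.J * xᵀ) := by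
    rw [mul_sub, sub_mul, Matrix.mul_smul, Matrix.smul_mul, smul_add]
    abel
  rw [h1, hx, smul_zero, sub_zero]

theorem trace_J_mul_σ (v : R5) : (𝓜.J * 𝓜.σ v).trace = 0 := by
  have h1 := 𝓜.σ_q _ (𝓜.transpose_σ v)
  rw [𝓜.q_σ, eq_comm, sub_eq_self] at h1
  rcases smul_eq_zero.1 h1 with h2 | h2
  · linarith
  · rw [h2, zero_mul, Matrix.trace_zero]

/-- For x in the Lie algebra of J the matrix xS + Sxᵀ stays J-trace free, so no correction by J is
needed. -/
theorem σ_drep_mulVec {x : Mat3} (hx : x * 𝓜.J + 𝓜.J * xᵀ = 0) (v : R5) :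
    𝓜.σ (𝓜.drep x *ᵥ v) = x * 𝓜.σ v + 𝓜.σ v * xᵀ := by
  rw [drep_mulVec, 𝓜.σ_q]
  · have h1 : (𝓜.J * (x * 𝓜.σ v + 𝓜.σ v * xᵀ)).trace = ((𝓜.J * x + xᵀ * 𝓜.J) * 𝓜.σ v).trace := by
      rw [mul_add, add_mul, Matrix.trace_add, Matrix.trace_add, ← mul_assoc, ← mul_assoc,
        Matrix.trace_mul_comm (𝓜.J * 𝓜.σ v), mul_assoc xᵀ]
    rw [h1, 𝓜.J_mul_add hx]
    simp
  · rw [Matrix.transpose_add, Matrix.transpose_mul, Matrix.transpose_mul, 𝓜.transpose_σ,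
      Matrix.transpose_transpose, add_comm]

/-- The trace free part of the quadratic covariant. -/
def covariant (v : R5) : R5 := 𝓜.q (3 • (𝓜.σ v * 𝓜.J * 𝓜.σ v) - 𝓜.σ v)

/-- The quadratic invariant, normalized to vanish on the orbit of the first basis vector. -/
def invariant (v : R5) : ℝ := (𝓜.J * 𝓜.σ v * 𝓜.J * 𝓜.σ v).trace - 2 / 3

/-- The section of the quadratic model as a continuous linear map. -/
def σL : R5 →L[ℝ] Mat3 := LinearMap.toContinuousLinearMap 𝓜.σ

/-- The coordinates of the quadratic model as a continuous linear map. -/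
def qL : Mat3 →L[ℝ] R5 := LinearMap.toContinuousLinearMap 𝓜.q

/-- The trace as a continuous linear map. -/
def traceL : Mat3 →L[ℝ] ℝ := LinearMap.toContinuousLinearMap (Matrix.traceLinearMap (Fin 3) ℝ ℝ)

theorem differentiable_covariant : Differentiable ℝ 𝓜.covariant :=
  𝓜.qL.differentiable.comp ((((𝓜.σL.differentiable.mul_const 𝓜.J).mul
    𝓜.σL.differentiable).const_smul (3 : ℕ)).sub 𝓜.σL.differentiable)

theorem differentiable_invariant : Differentiable ℝ 𝓜.invariant :=
  (traceL.differentiable.comp (((𝓜.σL.differentiable.const_mul 𝓜.J).mul_const 𝓜.J).mul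
    𝓜.σL.differentiable)).sub_const (2 / 3)

theorem hasDerivAt_σ_line (y h : R5) :
    HasDerivAt (fun t : ℝ => 𝓜.σ (y + t • h)) (𝓜.σ h) 0 := by
  have hl : HasDerivAt (fun t : ℝ => y + t • h) h 0 := by
    simpa using ((hasDerivAt_id (0 : ℝ)).smul_const h).const_add y
  exact 𝓜.σL.hasFDerivAt.comp_hasDerivAt (0 : ℝ) hl

theorem fderiv_apply_of_hasDerivAt_line {F : Type*} [NormedAddCommGroup F] [NormedSpace ℝ F]
    {N : R5 → F} (hN : Differentiable ℝ N) {y h : R5} {z : F}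
    (hz : HasDerivAt (fun t : ℝ => N (y + t • h)) z 0) : fderiv ℝ N y h = z := by
  have hl : HasDerivAt (fun t : ℝ => y + t • h) h 0 := by
    simpa using ((hasDerivAt_id (0 : ℝ)).smul_const h).const_add y
  have h0 : HasFDerivAt N (fderiv ℝ N y) (y + (0 : ℝ) • h) := by
    simpa using (hN y).hasFDerivAt
  exact (h0.comp_hasDerivAt (0 : ℝ) hl).unique hz

theorem fderiv_covariant {x : Mat3} (hx : x * 𝓜.J + 𝓜.J * xᵀ = 0) (y : R5) :
    fderiv ℝ 𝓜.covariant y (𝓜.drep x *ᵥ y) = 𝓜.drep x *ᵥ 𝓜.covariant y := by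
  have hσ := 𝓜.hasDerivAt_σ_line y (𝓜.drep x *ᵥ y)
  have h1 := 𝓜.qL.hasFDerivAt.comp_hasDerivAt (0 : ℝ)
    ((((hσ.mul_const 𝓜.J).mul hσ).const_smul (3 : ℕ)).sub hσ)
  refine (fderiv_apply_of_hasDerivAt_line 𝓜.differentiable_covariant h1).trans ?_
  rw [covariant, 𝓜.drep_mulVec_q hx]
  · refine congrArg 𝓜.q ?_
    rw [zero_smul, add_zero, 𝓜.σ_drep_mulVec hx]
    -- The inner terms of the Leibniz rule cancel because Jx + xᵀJ = 0.
    have h2 : 𝓜.σ y * xᵀ * 𝓜.J * 𝓜.σ y + 𝓜.σ y * 𝓜.J * (x * 𝓜.σ y) = 0 := by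
      calc _ = 𝓜.σ y * (𝓜.J * x + xᵀ * 𝓜.J) * 𝓜.σ y := by
            simp only [mul_add, add_mul, mul_assoc]
            exact add_comm _ _
        _ = 0 := by rw [𝓜.J_mul_add hx, mul_zero, zero_mul]
    have h3 : (x * 𝓜.σ y + 𝓜.σ y * xᵀ) * 𝓜.J * 𝓜.σ y + 𝓜.σ y * 𝓜.J * (x * 𝓜.σ y + 𝓜.σ y * xᵀ) =
        x * (𝓜.σ y * 𝓜.J * 𝓜.σ y) + 𝓜.σ y * 𝓜.J * 𝓜.σ y * xᵀ := by
      calc _ = x * (𝓜.σ y * 𝓜.J * 𝓜.σ y) + 𝓜.σ y * 𝓜.J * 𝓜.σ y * xᵀ +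
            (𝓜.σ y * xᵀ * 𝓜.J * 𝓜.σ y + 𝓜.σ y * 𝓜.J * (x * 𝓜.σ y)) := by
            simp only [mul_add, add_mul, mul_assoc]
            abel
        _ = _ := by rw [h2, add_zero]
    rw [h3]
    simp only [mul_sub, sub_mul, smul_add, mul_smul_comm, smul_mul_assoc]
    abel
  · simp only [Matrix.transpose_sub, Matrix.transpose_smul, Matrix.transpose_mul, 𝓜.transpose_σ]
    have hJt : 𝓜.Jᵀ = 𝓜.J := 𝓜.transpose_J
    rw [hJt, mul_assoc]

/-- The power traces of JS are invariant under the J-orthogonal algebra; infinitesimally this is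
skewness of x and cyclicity of the trace. -/
theorem fderiv_invariant {x : Mat3} (hx : x * 𝓜.J + 𝓜.J * xᵀ = 0) (y : R5) :
    fderiv ℝ 𝓜.invariant y (𝓜.drep x *ᵥ y) = 0 := by
  have hσ := 𝓜.hasDerivAt_σ_line y (𝓜.drep x *ᵥ y)
  have h1 := (traceL.hasFDerivAt.comp_hasDerivAt (0 : ℝ)
    (((hσ.const_mul 𝓜.J).mul_const 𝓜.J).mul hσ)).sub_const (2 / 3)
  refine (fderiv_apply_of_hasDerivAt_line 𝓜.differentiable_invariant h1).trans ?_
  rw [zero_smul, add_zero, 𝓜.σ_drep_mulVec hx]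
  set S := 𝓜.σ y
  have hJx : xᵀ * 𝓜.J = -(𝓜.J * x) := by
    rw [eq_neg_iff_add_eq_zero, add_comm]
    exact 𝓜.J_mul_add hx
  have e1 : (𝓜.J * (S * xᵀ) * 𝓜.J * S).trace = -(𝓜.J * (x * S) * 𝓜.J * S).trace := by
    have h2 : 𝓜.J * (S * xᵀ) * 𝓜.J * S = 𝓜.J * S * (xᵀ * 𝓜.J) * S := by simp only [mul_assoc]
    rw [h2, hJx, mul_neg, neg_mul, Matrix.trace_neg, neg_inj]
    calc _ = ((𝓜.J * S) * (𝓜.J * x * S)).trace := by simp only [mul_assoc]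
      _ = ((𝓜.J * x * S) * (𝓜.J * S)).trace := Matrix.trace_mul_comm _ _
      _ = _ := by simp only [mul_assoc]
  have e2 : (𝓜.J * S * 𝓜.J * (x * S + S * xᵀ)).trace =
      (𝓜.J * (x * S + S * xᵀ) * 𝓜.J * S).trace := by
    calc _ = ((𝓜.J * S) * (𝓜.J * (x * S + S * xᵀ))).trace := by simp only [mul_assoc]
      _ = ((𝓜.J * (x * S + S * xᵀ)) * (𝓜.J * S)).trace := Matrix.trace_mul_comm _ _
      _ = _ := by simp only [mul_assoc]
  show (𝓜.J * (x * S + S * xᵀ) * 𝓜.J * S + 𝓜.J * S * 𝓜.J * (x * S + S * xᵀ)).trace = 0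
  rw [Matrix.trace_add, e2]
  simp only [mul_add, add_mul, Matrix.trace_add, e1]
  ring

theorem σ_single : 𝓜.σ (Pi.single 0 1) = Matrix.single 0 0 1 - (1 / 3 : ℝ) • 𝓜.J := by
  rw [← 𝓜.q_single, 𝓜.σ_q _ (by simp), Matrix.trace_mul_single, 𝓜.J_zero_zero]
  simp

theorem single_mul_J_mul_single :
    (Matrix.single 0 0 1 : Mat3) * 𝓜.J * Matrix.single 0 0 1 = Matrix.single 0 0 1 := by
  rw [Matrix.single_mul_mul_single, 𝓜.J_zero_zero]
  simp

theorem σ_single_mul : 𝓜.σ (Pi.single 0 1) * 𝓜.J * 𝓜.σ (Pi.single 0 1) =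
    (1 / 3 : ℝ) • Matrix.single 0 0 1 + (1 / 9 : ℝ) • 𝓜.J := by
  rw [𝓜.σ_single]
  simp only [sub_mul, mul_sub, smul_mul_assoc, mul_smul_comm, 𝓜.J_mul_J, one_mul,
    𝓜.single_mul_J_mul_single]
  simp only [mul_assoc, 𝓜.J_mul_J, mul_one]
  module

theorem covariant_single : 𝓜.covariant (Pi.single 0 1) = 0 := by
  rw [covariant, 𝓜.σ_single_mul, 𝓜.σ_single]
  have h1 : 3 • ((1 / 3 : ℝ) • (Matrix.single 0 0 1 : Mat3) + (1 / 9 : ℝ) • 𝓜.J) -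
      (Matrix.single 0 0 1 - (1 / 3 : ℝ) • 𝓜.J) = (2 / 3 : ℝ) • 𝓜.J := by
    module
  rw [h1, map_smul, 𝓜.q_J, smul_zero]

theorem invariant_single : 𝓜.invariant (Pi.single 0 1) = 0 := by
  rw [invariant, mul_assoc 𝓜.J, mul_assoc 𝓜.J, 𝓜.σ_single_mul, mul_add, mul_smul_comm,
    mul_smul_comm, 𝓜.J_mul_J, Matrix.trace_add, Matrix.trace_smul, Matrix.trace_smul,
    Matrix.trace_mul_single, 𝓜.J_zero_zero]
  simp
  norm_num

/-- The covariant and the invariant together say that T = S + J/3 satisfies TJT = T and tr(JT) = 1,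
so T = ±ppᵀ. The minus sign corresponds to the other quadric pᵀJp = -1. -/
theorem exists_quad_of_isCentralizing {V : Submodule ℝ Mat5}
    (hV : ∀ X ∈ V, ∃ x, X = 𝓜.drep x ∧ x * 𝓜.J + 𝓜.J * xᵀ = 0) {w : R5} (hw0 : w ≠ 0)
    (hw : IsCentralizing V w) :
    ∃ p, ((𝓜.J * Matrix.vecMulVec p p).trace = 1 ∧ w = 𝓜.quad p) ∨
      ((𝓜.J * Matrix.vecMulVec p p).trace = -1 ∧ w = -𝓜.quad p) := by
  have h1 : 𝓜.covariant w = 0 := by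
    refine hw _ 𝓜.differentiable_covariant (fun X hX y => ?_) 𝓜.covariant_single
    obtain ⟨x, rfl, hx⟩ := hV X hX
    exact 𝓜.fderiv_covariant hx y
  -- The scalar invariant is tested through the vector-valued equivariant map y ↦ I(y)y; since w ≠ 0
  -- the scalar itself vanishes.
  have h2 : 𝓜.invariant w • w = 0 := by
    refine hw (fun y => 𝓜.invariant y • y) (𝓜.differentiable_invariant.smul differentiable_id)
      (fun X hX y => ?_) (by simp only [𝓜.invariant_single, zero_smul])
    obtain ⟨x, rfl, hx⟩ := hV X hX
    have h3 := ((𝓜.differentiable_invariant y).hasFDerivAt.smul (hasFDerivAt_id y)).fderiv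
    refine (congrArg (fun L : R5 →L[ℝ] R5 => L (𝓜.drep x *ᵥ y)) h3).trans ?_
    simp [𝓜.fderiv_invariant hx, Matrix.mulVec_smul]
  have h3 : (𝓜.J * 𝓜.σ w * 𝓜.J * 𝓜.σ w).trace = 2 / 3 :=
    sub_eq_zero.1 ((smul_eq_zero.1 h2).resolve_right hw0)
  set S := 𝓜.σ w with hS
  have hSt : Sᵀ = S := 𝓜.transpose_σ w
  have htr : (𝓜.J * S).trace = 0 := 𝓜.trace_J_mul_σ w
  have h4 : 3 • (S * 𝓜.J * S) - S = (2 / 3 : ℝ) • 𝓜.J := by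
    have h5 := 𝓜.σ_q (3 • (S * 𝓜.J * S) - S) (by
      rw [Matrix.transpose_sub, Matrix.transpose_smul, Matrix.transpose_mul, Matrix.transpose_mul,
        hSt, 𝓜.transpose_J, mul_assoc])
    rw [show 𝓜.q (3 • (S * 𝓜.J * S) - S) = 0 from h1, map_zero, eq_comm, sub_eq_zero] at h5
    rw [h5]
    congr 1
    rw [mul_sub, Matrix.trace_sub, htr, mul_smul_comm, Matrix.trace_smul, ← mul_assoc, ← mul_assoc,
      h3]
    norm_num
  set T := S + (1 / 3 : ℝ) • 𝓜.J with hT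
  have hTt : Tᵀ = T := by
    rw [hT, Matrix.transpose_add, Matrix.transpose_smul, hSt, 𝓜.transpose_J]
  have hTT : T * 𝓜.J * T = T := by
    have h6 : T * 𝓜.J * T = S * 𝓜.J * S + (2 / 3 : ℝ) • S + (1 / 9 : ℝ) • 𝓜.J := by
      rw [hT]
      simp only [add_mul, mul_add, smul_mul_assoc, mul_smul_comm, mul_assoc, 𝓜.J_mul_J, mul_one]
      simp only [← mul_assoc, one_mul]
      module
    have h7 : S * 𝓜.J * S = (1 / 3 : ℝ) • S + (2 / 9 : ℝ) • 𝓜.J := by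
      have h8 : (3 : ℝ) • (S * 𝓜.J * S) = S + (2 / 3 : ℝ) • 𝓜.J := by
        rw [← h4]
        module
      calc S * 𝓜.J * S = (1 / 3 : ℝ) • ((3 : ℝ) • (S * 𝓜.J * S)) := by module
        _ = _ := by
          rw [h8]
          module
    rw [h6, h7, hT]
    module
  have hTtr : (𝓜.J * T).trace = 1 := by
    rw [hT, mul_add, Matrix.trace_add, htr, mul_smul_comm, 𝓜.J_mul_J]
    simp
  have hqT : 𝓜.q T = w := by
    rw [hT, map_add, map_smul, 𝓜.q_J, smul_zero, add_zero, hS, 𝓜.q_σ]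
  obtain ⟨p, hp | hp⟩ := exists_eq_vecMulVec_of_idempotent hTt 𝓜.J_mul_J hTT hTtr
  · refine ⟨p, Or.inl ⟨hp ▸ hTtr, ?_⟩⟩
    rw [← hqT, hp, quad]
  · refine ⟨p, Or.inr ⟨?_, ?_⟩⟩
    · rw [hp, mul_neg, Matrix.trace_neg] at hTtr
      linarith
    · rw [← hqT, hp, map_neg, quad]

/-- The curve of images of a solution of a linear differential equation. -/
theorem hasDerivAt_quad {x : Mat3} (hx : x * 𝓜.J + 𝓜.J * xᵀ = 0) {p : ℝ → Fin 3 → ℝ} {t : ℝ}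
    (hp : HasDerivAt p (x *ᵥ p t) t) :
    HasDerivAt (fun s => 𝓜.quad (p s)) (𝓜.drep x *ᵥ 𝓜.quad (p t)) t := by
  have h1 : HasDerivAt (fun s => Matrix.vecMulVec (p s) (p s))
      (x * Matrix.vecMulVec (p t) (p t) + Matrix.vecMulVec (p t) (p t) * xᵀ) t := by
    refine hasDerivAt_mat3 fun i j => ?_
    refine ((hasDerivAt_pi.1 hp i).mul (hasDerivAt_pi.1 hp j)).congr_deriv ?_
    rw [Matrix.mul_vecMulVec, Matrix.vecMulVec_mul, Matrix.vecMul_transpose]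
    rfl
  rw [quad, 𝓜.drep_mulVec_q hx (Matrix.transpose_vecMulVec _ _)]
  exact 𝓜.qL.hasFDerivAt.comp_hasDerivAt t h1

end QuadraticModel

end

noncomputable section

/-! ### Homogeneous bundles and the three models -/

theorem spaceLikeModel_trace {ε : ℝ} (hε : ε * ε = 1) (p : Fin 3 → ℝ) :
    ((spaceLikeModel ε hε).J * Matrix.vecMulVec p p).trace =
      p 0 ^ 2 - ε * (p 1 ^ 2 + p 2 ^ 2) := by
  simp [spaceLikeModel, Matrix.trace_fin_three, Matrix.vecMulVec_apply, Matrix.vecMul, dotProduct,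
    Fin.sum_univ_three]
  ring

theorem timeLikeModel_trace (p : Fin 3 → ℝ) :
    (timeLikeModel.J * Matrix.vecMulVec p p).trace = p 0 ^ 2 + p 1 ^ 2 - p 2 ^ 2 := by
  simp [timeLikeModel, Matrix.trace_fin_three, Matrix.vecMulVec_apply, Matrix.vecMul, dotProduct,
    Fin.sum_univ_three]
  ring

theorem spaceLikeModel_skew {ε : ℝ} (hε : ε * ε = 1) (a b c : ℝ) :
    (!![0, ε * a, ε * b; a, 0, -c; b, c, 0] : Mat3) * (spaceLikeModel ε hε).J +
      (spaceLikeModel ε hε).J * (!![0, ε * a, ε * b; a, 0, -c; b, c, 0] : Mat3)ᵀ = 0 := by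
  ext i j
  fin_cases i <;> fin_cases j <;>
    simp [spaceLikeModel, Matrix.vecMul, dotProduct, Fin.sum_univ_three] <;> grind

theorem timeLikeModel_skew (a b c : ℝ) :
    (!![0, -a, b; a, 0, c; b, c, 0] : Mat3) * timeLikeModel.J +
      timeLikeModel.J * (!![0, -a, b; a, 0, c; b, c, 0] : Mat3)ᵀ = 0 := by
  ext i j
  fin_cases i <;> fin_cases j <;> simp [timeLikeModel, Matrix.vecMul, dotProduct,
    Fin.sum_univ_three]

theorem exists_spaceLikeModel_drep {ε : ℝ} (hε : ε * ε = 1) (a b c : ℝ) :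
    ∃ x, spaceLikeMat ε a b c = (spaceLikeModel ε hε).drep x ∧
      x * (spaceLikeModel ε hε).J + (spaceLikeModel ε hε).J * xᵀ = 0 := by
  have h3 : √3 ≠ 0 := by positivity
  refine ⟨_, ?_, spaceLikeModel_skew hε (a / √3) (b / √3) c⟩
  rw [spaceLikeModel_drep, mul_div_cancel₀ _ h3, mul_div_cancel₀ _ h3]

theorem exists_timeLikeModel_drep (a b c : ℝ) :
    ∃ x, timeLikeMat a b c = timeLikeModel.drep x ∧
      x * timeLikeModel.J + timeLikeModel.J * xᵀ = 0 := by
  have h6 : √6 ≠ 0 := by positivity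
  refine ⟨_, ?_, timeLikeModel_skew ((a - b) / √6) ((a + b) / √6) c⟩
  rw [timeLikeModel_drep]
  congr 1 <;> field_simp <;> ring

section Models

variable {P : Type*} [TopologicalSpace P] [ChartedSpace (EuclideanSpace ℝ (Fin 3)) P]
  [IsManifold (𝓡 3) ∞ P] [PreconnectedSpace P] {e : P → Frame} {V : Submodule ℝ Mat5}

/-- The zeroth coordinate is ±(p₀² + (p₁² + p₂²)/2), positive exactly on the wanted sheet. The two
sheets p₀ > 0 and p₀ < 0 of the hyperboloid have the same image. -/
theorem glEquivalent_hyperbolicModel (he : ContMDiff (𝓡 3) 𝓘(ℝ, Frame) ∞ e)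
    (hli : ∀ q, LinearIndependent ℝ (e q)) (hV : ∀ q v, maurerCartan (n := 3) e q v ∈ V)
    (hdim : Module.finrank ℝ V = 3) {q : P}
    (hsurj : ∀ X ∈ V, ∃ v, maurerCartan (n := 3) e q v = X)
    (hmul : ∀ p p', ∃ r, frameMatrix (e r) =
      frameMatrix (e p) * (frameMatrix (e q))⁻¹ * frameMatrix (e p'))
    (hVm : ∀ X, X ∈ V ↔ ∃ a b c, X = spaceLikeMat 1 a b c) :
    GLEquivalent (Set.range fun p => e p 0) (Set.range hyperbolicModel) := by
  refine glEquivalent_of_orbit he hli hV hdim hsurj hmul ?_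
    ⟨spaceLikeMat 1 (√3 * 0) (√3 * 1) 0, (hVm _).2 ⟨_, _, _, rfl⟩, fun v => ?_⟩
    ⟨spaceLikeMat 1 (√3 * 1) (√3 * 0) 0, (hVm _).2 ⟨_, _, _, rfl⟩, fun v u => ?_⟩
    (c := fun w => w 0) (continuous_apply 0) (by simp) fun w hw0 hw => ?_
  · ext i
    fin_cases i <;> simp [hyperbolicModel] <;> norm_num
  · simp only [hyperbolicModel_eq, ← spaceLikeModel_drep (ε := 1) (by norm_num)]
    refine hypModel.hasDerivAt_quad (p := fun t => (hyperbolicRot !₂[0, t]).col 0)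
      (spaceLikeModel_skew _ _ _ _) (hasDerivAt_pi.2 fun i => ?_)
    fin_cases i <;> simp [hyperbolicRot, Matrix.mulVec, dotProduct, Fin.sum_univ_three]
    · exact Real.hasDerivAt_cosh v
    · exact hasDerivAt_const _ _
    · exact Real.hasDerivAt_sinh v
  · simp only [hyperbolicModel_eq, ← spaceLikeModel_drep (ε := 1) (by norm_num)]
    refine hypModel.hasDerivAt_quad (p := fun t => (hyperbolicRot !₂[t, v]).col 0)
      (spaceLikeModel_skew _ _ _ _) (hasDerivAt_pi.2 fun i => ?_)
    fin_cases i <;> simp [hyperbolicRot, Matrix.mulVec, dotProduct, Fin.sum_univ_three]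
    · exact (Real.hasDerivAt_cosh u).mul_const _
    · exact (Real.hasDerivAt_sinh u).mul_const _
    · exact hasDerivAt_const _ _
  · obtain ⟨p, ⟨h1, rfl⟩ | ⟨h1, rfl⟩⟩ := hypModel.exists_quad_of_isCentralizing (fun X hX => by
      obtain ⟨a, b, c, rfl⟩ := (hVm X).1 hX
      exact exists_spaceLikeModel_drep _ a b c) hw0 hw
    · rw [spaceLikeModel_trace] at h1
      have h2 : hypModel.quad p 0 = p 0 ^ 2 + 1 / 2 * (p 1 ^ 2 + p 2 ^ 2) := by
        simp [spaceLikeModel_quad]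
      refine ⟨?_, fun _ => ?_⟩
      · rw [h2]
        nlinarith [sq_nonneg (p 1), sq_nonneg (p 2)]
      · have h3 : p 0 ≠ 0 := by
          intro h
          rw [h] at h1
          nlinarith [sq_nonneg (p 1), sq_nonneg (p 2)]
        rcases lt_or_gt_of_ne h3 with h3 | h3
        · obtain ⟨x, hx⟩ := exists_hyperbolicRot (p := -p) (by
            simp only [Pi.neg_apply]
            linarith) (by simpa using h3)
          refine ⟨x, ?_⟩
          rw [hyperbolicModel_eq, hx]
          exact (hypModel.quad_eq_iff (by simp)).2 (Or.inr rfl)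
        · obtain ⟨x, hx⟩ := exists_hyperbolicRot (p := p) (by linarith) h3
          exact ⟨x, by rw [hyperbolicModel_eq, hx]⟩
    · rw [spaceLikeModel_trace] at h1
      have h2 : (-hypModel.quad p) 0 = -(p 0 ^ 2 + 1 / 2 * (p 1 ^ 2 + p 2 ^ 2)) := by
        simp [spaceLikeModel_quad]
      have h3 : (-hypModel.quad p) 0 < 0 := by
        rw [h2]
        nlinarith [sq_nonneg (p 0)]
      exact ⟨h3.ne, fun h => absurd h h3.not_gt⟩

/-- For a definite J the quadric pᵀJp = -1 is empty, so the constant function 1 serves as separator.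
-/
theorem glEquivalent_sphericalModel (he : ContMDiff (𝓡 3) 𝓘(ℝ, Frame) ∞ e)
    (hli : ∀ q, LinearIndependent ℝ (e q)) (hV : ∀ q v, maurerCartan (n := 3) e q v ∈ V)
    (hdim : Module.finrank ℝ V = 3) {q : P}
    (hsurj : ∀ X ∈ V, ∃ v, maurerCartan (n := 3) e q v = X)
    (hmul : ∀ p p', ∃ r, frameMatrix (e r) =
      frameMatrix (e p) * (frameMatrix (e q))⁻¹ * frameMatrix (e p'))
    (hVm : ∀ X, X ∈ V ↔ ∃ a b c, X = spaceLikeMat (-1) a b c) :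
    GLEquivalent (Set.range fun p => e p 0) (Set.range sphericalModel) := by
  refine glEquivalent_of_orbit he hli hV hdim hsurj hmul ?_
    ⟨spaceLikeMat (-1) (√3 * 0) (√3 * 1) 0, (hVm _).2 ⟨_, _, _, rfl⟩, fun v => ?_⟩
    ⟨spaceLikeMat (-1) (√3 * 1) (√3 * 0) 0, (hVm _).2 ⟨_, _, _, rfl⟩, fun v u => ?_⟩
    (c := fun _ => 1) continuous_const one_pos fun w hw0 hw => ⟨one_ne_zero, fun _ => ?_⟩
  · ext i
    fin_cases i <;> simp [sphericalModel] <;> norm_num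
  · simp only [sphericalModel_eq, ← spaceLikeModel_drep (ε := -1) (by norm_num)]
    refine sphModel.hasDerivAt_quad (p := fun t => (sphericalRot !₂[0, t]).col 0)
      (spaceLikeModel_skew _ _ _ _) (hasDerivAt_pi.2 fun i => ?_)
    fin_cases i <;> simp [sphericalRot, Matrix.mulVec, dotProduct, Fin.sum_univ_three]
    · exact Real.hasDerivAt_cos v
    · exact hasDerivAt_const _ _
    · exact Real.hasDerivAt_sin v
  · simp only [sphericalModel_eq, ← spaceLikeModel_drep (ε := -1) (by norm_num)]
    refine sphModel.hasDerivAt_quad (p := fun t => (sphericalRot !₂[t, v]).col 0)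
      (spaceLikeModel_skew _ _ _ _) (hasDerivAt_pi.2 fun i => ?_)
    fin_cases i <;> simp [sphericalRot, Matrix.mulVec, dotProduct, Fin.sum_univ_three]
    · exact ((Real.hasDerivAt_cos u).mul_const _).congr_deriv (by ring)
    · exact (Real.hasDerivAt_sin u).mul_const _
    · exact hasDerivAt_const _ _
  · obtain ⟨p, ⟨h1, rfl⟩ | ⟨h1, rfl⟩⟩ := sphModel.exists_quad_of_isCentralizing (fun X hX => by
      obtain ⟨a, b, c, rfl⟩ := (hVm X).1 hX
      exact exists_spaceLikeModel_drep _ a b c) hw0 hw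
    · rw [spaceLikeModel_trace] at h1
      obtain ⟨x, hx⟩ := exists_sphericalRot (p := p) (by linarith)
      exact ⟨x, by rw [sphericalModel_eq, hx]⟩
    · rw [spaceLikeModel_trace] at h1
      nlinarith [sq_nonneg (p 0), sq_nonneg (p 1), sq_nonneg (p 2)]

/-- The separator is the last diagonal entry of σ(w) plus 1/6. It equals p₂² + 1/2 on the wanted set
and 1/2 - p₂² on the other, where p₂² ≥ 1. -/
theorem glEquivalent_lorentzianModel (he : ContMDiff (𝓡 3) 𝓘(ℝ, Frame) ∞ e)
    (hli : ∀ q, LinearIndependent ℝ (e q)) (hV : ∀ q v, maurerCartan (n := 3) e q v ∈ V)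
    (hdim : Module.finrank ℝ V = 3) {q : P}
    (hsurj : ∀ X ∈ V, ∃ v, maurerCartan (n := 3) e q v = X)
    (hmul : ∀ p p', ∃ r, frameMatrix (e r) =
      frameMatrix (e p) * (frameMatrix (e q))⁻¹ * frameMatrix (e p'))
    (hVm : ∀ X, X ∈ V ↔ ∃ a b c, X = timeLikeMat a b c) :
    GLEquivalent (Set.range fun p => e p 0) (Set.range lorentzianModel) := by
  refine glEquivalent_of_orbit he hli hV hdim hsurj hmul ?_
    ⟨_, (hVm _).2 ⟨_, _, _, timeLikeModel_drep 0 1 0⟩, fun v => ?_⟩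
    ⟨_, (hVm _).2 ⟨_, _, _, timeLikeModel_drep 1 0 0⟩, fun v u => ?_⟩
    (c := fun w => (w 3 + w 4 + w 0) / 3 + 1 / 6) (by fun_prop) (by simp; norm_num)
    fun w hw0 hw => ?_
  · ext i
    fin_cases i <;> simp [lorentzianModel] <;> norm_num
  · simp only [lorentzianModel_eq]
    refine timeLikeModel.hasDerivAt_quad (p := fun t => (lorentzianRot !₂[0, t]).col 0)
      (timeLikeModel_skew _ _ _) (hasDerivAt_pi.2 fun i => ?_)
    fin_cases i <;> simp [lorentzianRot, Matrix.mulVec, dotProduct, Fin.sum_univ_three]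
    · exact Real.hasDerivAt_cosh v
    · exact hasDerivAt_const _ _
    · exact Real.hasDerivAt_sinh v
  · simp only [lorentzianModel_eq]
    refine timeLikeModel.hasDerivAt_quad (p := fun t => (lorentzianRot !₂[t, v]).col 0)
      (timeLikeModel_skew _ _ _) (hasDerivAt_pi.2 fun i => ?_)
    fin_cases i <;> simp [lorentzianRot, Matrix.mulVec, dotProduct, Fin.sum_univ_three]
    · exact ((Real.hasDerivAt_cos u).mul_const _).congr_deriv (by ring)
    · exact (Real.hasDerivAt_sin u).mul_const _
    · exact hasDerivAt_const _ _
  · obtain ⟨p, ⟨h1, rfl⟩ | ⟨h1, rfl⟩⟩ := timeLikeModel.exists_quad_of_isCentralizing (fun X hX => by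
      obtain ⟨a, b, c, rfl⟩ := (hVm X).1 hX
      exact exists_timeLikeModel_drep a b c) hw0 hw
    · rw [timeLikeModel_trace] at h1
      refine ⟨?_, fun _ => ?_⟩
      · simp [timeLikeModel_quad]
        nlinarith [sq_nonneg (p 2)]
      · obtain ⟨x, hx⟩ := exists_lorentzianRot (p := p) h1
        exact ⟨x, by rw [lorentzianModel_eq, hx]⟩
    · rw [timeLikeModel_trace] at h1
      have h2 : ((-timeLikeModel.quad p) 3 + (-timeLikeModel.quad p) 4 +
          (-timeLikeModel.quad p) 0) / 3 + 1 / 6 < 0 := by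
        simp [timeLikeModel_quad]
        nlinarith [sq_nonneg (p 0), sq_nonneg (p 1), sq_nonneg (p 2)]
      exact ⟨h2.ne, fun h => absurd h h2.not_gt⟩

end Models

/-! ### The classification -/

/-- Excludes an empty bundle: a group acting faithfully on the empty set is trivial, hence not a
3-manifold. -/
theorem not_subsingleton_of_chartedSpace {G : Type*} [TopologicalSpace G]
    [ChartedSpace (EuclideanSpace ℝ (Fin 3)) G] (g : G) : ¬Subsingleton G := by
  intro hs
  have h1 : (chartAt (EuclideanSpace ℝ (Fin 3)) g).target = {chartAt _ g g} := by
    refine Set.Subset.antisymm (fun y hy => ?_) ?_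
    · rw [← (chartAt (EuclideanSpace ℝ (Fin 3)) g).right_inv hy]
      exact congrArg _ (Subsingleton.elim _ _)
    · rintro _ rfl
      exact mem_chart_target _ g
  have h2 := (chartAt (EuclideanSpace ℝ (Fin 3)) g).open_target
  rw [h1] at h2
  exact not_isOpen_singleton _ h2

/-- Packages the values of Ω at one point as a subspace; linearity in v and injectivity give its
dimension. -/
theorem exists_maurerCartan_range {P : Type*} [TopologicalSpace P]
    [ChartedSpace (EuclideanSpace ℝ (Fin 3)) P] (e : P → Frame) (q : P)
    (hinj : ∀ v : TangentSpace (𝓡 3) q, maurerCartan e q v = 0 → v = 0) :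
    ∃ V : Submodule ℝ Mat5, Module.finrank ℝ V = 3 ∧
      ∀ X, X ∈ V ↔ ∃ v : TangentSpace (𝓡 3) q, maurerCartan e q v = X := by
  let L : TangentSpace (𝓡 3) q →ₗ[ℝ] Mat5 :=
    { toFun := fun v => maurerCartan e q v
      map_add' := fun v w => by
        simp only [maurerCartan, map_add]
        exact mul_add _ _ _
      map_smul' := fun c v => by
        simp only [maurerCartan, map_smul]
        exact Matrix.mul_smul (frameMatrix (e q))⁻¹ c _ }
  refine ⟨LinearMap.range L, ?_, fun X => Iff.rfl⟩
  rw [LinearMap.finrank_range_of_inj ((injective_iff_map_eq_zero L).2 hinj)]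
  exact finrank_euclideanSpace_fin

/-- The kind of bundle and the sign ε alone decide which model occurs. -/
theorem glEquivalent_of_isHomogeneous {M : Type u} [TopologicalSpace M] [ChartedSpace Plane M]
    [IsManifold (𝓡 2) ∞ M] {f : M → R5} (hf : IsCentroaffineImmersion f) (hh : IsHomogeneous f) :
    GLEquivalent (Set.range f) (Set.range hyperbolicModel) ∨
    GLEquivalent (Set.range f) (Set.range sphericalModel) ∨
    GLEquivalent (Set.range f) (Set.range lorentzianModel) := by
  obtain ⟨F, hF, P, _, _, _, ι, ⟨hι, hinj, -, hr⟩, G, _, _, _, _, _, _, _, hG, hfaith, _, _⟩ := hh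
  set e : P → Frame := fun p => (ι p).2 with he_def
  have he : ContMDiff (𝓡 3) 𝓘(ℝ, Frame) ∞ e := contMDiff_snd.comp hι
  have hne : Nonempty P := by
    by_contra hP
    rw [not_nonempty_iff] at hP
    exact not_subsingleton_of_chartedSpace (1 : G)
      ⟨fun g h => FaithfulSMul.eq_of_smul_eq_smul (α := P) fun a => isEmptyElim a⟩
  have hfib : ∀ x, ∃ e, (x, e) ∈ F := hF.elim (fun h => h.2.1) (fun h => h.2.1)
  have hbase : ∀ q, LinearIndependent ℝ (e q) ∧ e q 0 = f (ι q).1 ∧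
      ∀ v : TangentSpace (𝓡 3) q, maurerCartan e q v = 0 → v = 0 := by
    intro q
    rcases hF with hF | hF
    · obtain ⟨h1, h2, ε, -, h3⟩ := maurerCartan_spaceLikeBundle hf hF hι hinj hr q
      exact ⟨h1, h2, fun v => (h3 v).2.2⟩
    · obtain ⟨h1, h2, h3⟩ := maurerCartan_timeLikeBundle hf hF hι hinj hr q
      exact ⟨h1, h2, fun v => (h3 v).2.2⟩
  have hli := fun q => (hbase q).1
  have hconn : PreconnectedSpace P := preconnectedSpace_of_symmetries he hG
  have hrange : Set.range f = Set.range fun p => e p 0 := by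
    ext y
    constructor
    · rintro ⟨x, rfl⟩
      obtain ⟨s, hs⟩ := hfib x
      rw [← hr] at hs
      obtain ⟨q, hq⟩ := hs
      exact ⟨q, by simp only [(hbase q).2.1, hq]⟩
    · rintro ⟨q, rfl⟩
      exact ⟨_, (hbase q).2.1.symm⟩
  obtain ⟨q⟩ := hne
  obtain ⟨V, hdim, hVq⟩ := exists_maurerCartan_range e q (hbase q).2.2
  have hsym : ∀ g : G, IsSymmetry e (smulDiffeomorph g) := fun g => (hG _).2 ⟨g, fun _ => rfl⟩
  have hV : ∀ p v, maurerCartan (n := 3) e p v ∈ V := by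
    intro p v
    obtain ⟨g, hg⟩ := MulAction.exists_smul_eq G p q
    have h1 := hsym g p v
    -- The target point is generalized so that replacing gp by q does not require transporting a
    -- tangent vector along an equality.
    have h2 : ∀ q', smulDiffeomorph g p = q' →
        ∃ w : TangentSpace (𝓡 3) q', maurerCartan e q' w = maurerCartan e p v := by
      rintro _ rfl
      exact ⟨_, h1⟩
    exact (hVq _).2 (h2 q hg)
  have hsurj : ∀ X ∈ V, ∃ v, maurerCartan (n := 3) e q v = X := fun X hX => (hVq X).1 hX
  -- A symmetry carrying q to p is left translation by e(p)e(q)⁻¹; the point r is its value at p'.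
  have hmul : ∀ p p', ∃ r, frameMatrix (e r) =
      frameMatrix (e p) * (frameMatrix (e q))⁻¹ * frameMatrix (e p') := by
    intro p p'
    obtain ⟨g, hg⟩ := MulAction.exists_smul_eq G q p
    refine ⟨smulDiffeomorph g p', ?_⟩
    have h1 := exists_left_translation he hli (hsym g) p' q
    have h2 : smulDiffeomorph g q = p := hg
    rw [h2] at h1
    rw [← h1, mul_assoc, Matrix.nonsing_inv_mul _
      ((Matrix.isUnit_iff_isUnit_det _).1 (isUnit_frameMatrix.2 (hli p'))), mul_one]
  have hbr := commutator_mem he hli hV hsurj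
  rw [hrange]
  rcases hF with hF | hF
  · obtain ⟨-, -, ε, hε, h3⟩ := maurerCartan_spaceLikeBundle hf hF hι hinj hr q
    have hVm := mem_iff_spaceLikeMat hdim (ε := ε) (fun X hX => by
      obtain ⟨v, rfl⟩ := hsurj X hX
      exact (h3 v).1) (fun X hX => by
      obtain ⟨v, rfl⟩ := hsurj X hX
      exact (h3 v).2.1) hbr
    rcases hε with rfl | rfl
    · exact Or.inl (glEquivalent_hyperbolicModel he hli hV hdim hsurj hmul hVm)
    · exact Or.inr (Or.inl (glEquivalent_sphericalModel he hli hV hdim hsurj hmul hVm))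
  · obtain ⟨-, -, h3⟩ := maurerCartan_timeLikeBundle hf hF hι hinj hr q
    have hVm := mem_iff_timeLikeMat hdim (fun X hX => by
      obtain ⟨v, rfl⟩ := hsurj X hX
      exact (h3 v).1) (fun X hX => by
      obtain ⟨v, rfl⟩ := hsurj X hX
      exact (h3 v).2.1) hbr
    exact Or.inr (Or.inr (glEquivalent_lorentzianModel he hli hV hdim hsurj hmul hVm))

end

theorem theorem6p1 :
    -- the classification
    (∀ (M : Type*) [TopologicalSpace M] [T2Space M] [SecondCountableTopology M]
        [ChartedSpace Plane M] [IsManifold (𝓡 2) ∞ M] (f : M → R5),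
      IsCentroaffineImmersion f → IsNondegenerate f → (IsSpaceLike f ∨ IsTimeLike f) →
      IsHomogeneous f →
      GLEquivalent (Set.range f) (Set.range hyperbolicModel) ∨
      GLEquivalent (Set.range f) (Set.range sphericalModel) ∨
      GLEquivalent (Set.range f) (Set.range lorentzianModel)) ∧
    -- the hyperbolic plane
    (IsIrreducibleOrbit (soPlus 0) (Set.range hyperbolicModel) ∧
      IsCentroaffineImmersion hyperbolicModel ∧ Topology.IsEmbedding hyperbolicModel ∧
      ∀ x : Plane,
        HasSpaceLikeMetricAt hyperbolicModel x
          (fun w => 3 * (Real.cosh (x 1) ^ 2 * w 0 ^ 2 + w 1 ^ 2)) ∧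
        HasGaussCurvatureAt hyperbolicModel x (-1 / 3)) ∧
    -- the sphere
    (IsIrreducibleOrbit (Matrix.specialOrthogonalGroup (Fin 3) ℝ) (Set.range sphericalModel) ∧
      (∃ φ : Metric.sphere (0 : EuclideanSpace ℝ (Fin 3)) 1 → R5,
        IsCentroaffineImmersion φ ∧
        (∀ (x : Plane) (p : Metric.sphere (0 : EuclideanSpace ℝ (Fin 3)) 1),
          (p : EuclideanSpace ℝ (Fin 3)) = sphereParam x → sphericalModel x = φ p) ∧
        ∀ p q, φ p = φ q ↔ p = q ∨ p = -q) ∧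
      ∀ x : Plane, Real.cos (x 1) ≠ 0 →
        HasSpaceLikeMetricAt sphericalModel x
          (fun w => 3 * (Real.cos (x 1) ^ 2 * w 0 ^ 2 + w 1 ^ 2)) ∧
        HasGaussCurvatureAt sphericalModel x (1 / 3)) ∧
    -- the Lorentzian surface
    (IsIrreducibleOrbit (soPlus 2) (Set.range lorentzianModel) ∧
      IsCentroaffineImmersion lorentzianModel ∧
      Topology.IsQuotientMap (Set.rangeFactorization lorentzianModel) ∧
      Set.range hyperboloidParam = oneSheetHyperboloid ∧
      ∀ x : Plane,
        HasTimeLikeMetricAt lorentzianModel x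
          (fun w => 3 * (-(Real.cosh (x 1) ^ 2 * w 0 ^ 2) + w 1 ^ 2)) ∧
        ∀ y : Plane,
          (lorentzianModel x = lorentzianModel y ↔
            hyperboloidParam x = hyperboloidParam y ∨ hyperboloidParam x = -hyperboloidParam y) ∧
          (lorentzianModel x = lorentzianModel y ↔
            ∃ n : ℤ, y 0 = x 0 + n * Real.pi ∧ y 1 = (-1) ^ n * x 1)) := by
  refine ⟨fun M _ _ _ _ _ f hf _ _ hh => glEquivalent_of_isHomogeneous hf hh,
    ⟨isIrreducibleOrbit_hyperbolicModel, isCentroaffineImmersion_hyperbolicModel,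
      isEmbedding_hyperbolicModel, hyperbolicModel_metric⟩,
    ⟨isIrreducibleOrbit_sphericalModel,
      ⟨sphereImmersion, isCentroaffineImmersion_sphereImmersion,
        sphericalModel_eq_sphereImmersion, sphereImmersion_eq_iff⟩, sphericalModel_metric⟩,
    isIrreducibleOrbit_lorentzianModel, isCentroaffineImmersion_lorentzianModel,
    isQuotientMap_lorentzianModel, range_hyperboloidParam,
    fun x => ⟨lorentzianModel_metric x, fun y => ⟨lorentzianModel_eq_iff_hyperboloidParam x y,
      lorentzianModel_eq_iff_exists_int x y⟩⟩⟩
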